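/- **Notation.** Let $n\ge 1$. Let $\mathcal W$ be the Weyl algebra over $\mathbb C$ with generators $x_1,\dots,x_n,y_1,\dots,y_n$ and relations $[x_i,x_j]=[y_i,y_j]=0$, $[y_i,x_j]=\delta_{ij}$; let $\mathcal C$ be the complex Clifford algebra with generators $e_1,\dots,e_n$ and relations $e_ie_j+e_je_i=2\delta_{ij}$, with its usual $\mathbb Z_2$-grading; and let $\mathcal W\otimes\mathcal C$ be graded through $\mathcal C$. The odd elements $\sum_j y_j\otimes e_j$ and $\sum_j x_j\otimes e_j$ generate a Lie superalgebra $\mathfrak{spo}(2|1)\subset\mathcal W\otimes\mathcal C$. The total angular momentum algebra (TAMA) $\mathfrak O$ is the subalgebra of all elements of $\mathcal W\otimes\mathcal C$ whose graded commutator with every element of $\mathfrak{spo}(2|1)$ vanishes, and $\mathfrak O_{\bar 0}=\mathfrak O\cap(\mathcal W\otimes\mathcal C)_{\bar 0}$ is the even TAMA. For $i\ne j$ put $$O_{ij}=x_iy_j-x_jy_i+\tfrac12 e_ie_j .$$ A *diagram* is a family $m=(m_{ij})_{1\le i<j\le n}$ of non-negative integers ($m_{ij}$ is the multiplicity of the chord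 $(i,j)$). It is *uncrossed* if there are no $i<j<k<l$ with $m_{ik}\ge1$ and $m_{jl}\ge1$, and *uncrossable* if it is uncrossed or is obtained from an uncrossed diagram by adding one to the multiplicity of a single chord. After a total order on the chords has been fixed, the monomial of $m$ is the product $\prod O_{ij}^{m_{ij}}$ taken in that order. In $U(\mathfrak{so}(n,\mathbb C))$, where $\mathfrak{so}(n,\mathbb C)$ is the Lie algebra of skew-symmetric matrices, put $X_{ij}=E_{ij}-E_{ji}$ and, for a sequence $A=(a_1,a_2,a_3,a_4)$ of distinct indices, $$X_A=2\,(X_{a_1a_2}X_{a_3a_4}+X_{a_1a_3}X_{a_4a_2}+X_{a_1a_4}X_{a_2a_3}).$$ Let $A,B$ be sequences of four distinct indices such that every index common to $A$ and $B$ occupies the same position in both, and let $\mathcal T\cong S_2^4$ be the group acting on pairs $(A,B)$ by exchanging $a_p$ and $b_p$ for the positions $p$ in an arbitrary subset of $\{1,2,3,4\}$. The *tableau relation* of $A,B$ is the element $$R_{A,B}=\sum_{\sigma\in\mathcal T}\sigma\Bigl(X_AX_B+\sum_{(a,b)\subset A\cap B}X_{A\setminus(a,b)}X_{B\setminus(a,b)}\Bigr)-12\,\delta_{A,B},$$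 where $(a,b)$ runs over the pairs of common entries of $A$ and $B$, taken in the order of their positions, and $A\setminus(a,b)$ is the sequence of the two remaining entries of $A$. **Theorem.** Let $n\in\{4,5\}$. 1. For every total order on the chords $(i,j)$, $1\le i<j\le n$, the monomials of the uncrossable diagrams, indexed by these diagrams, form a linear basis of the subalgebra of $\mathcal W\otimes\mathcal C$ generated by the $O_{ij}$. 2. This subalgebra is the even TAMA $\mathfrak O_{\bar0}$. 3. The assignment $X_{ij}\mapsto O_{ij}$ extends to an algebra homomorphism $U(\mathfrak{so}(n,\mathbb C))\to\mathcal W\otimes\mathcal C$ with image $\mathfrak O_{\bar0}$, and its kernel is the two-sided ideal generated by the tableau relations $R_{A,B}$. In particular this homomorphism induces an isomorphism $U(\mathfrak{so}(n,\mathbb C))/\langle R_{A,B}\rangle\cong\mathfrak O_{\bar 0}$. -/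

import Mathlib

open scoped TensorProduct

noncomputable section

namespace TAMA

/-! ### The Weyl algebra, the Clifford algebra and their tensor product -/

/-- The generators `x_1, …, x_n, y_1, …, y_n` of the Weyl algebra. -/
inductive WeylGen (n : ℕ) : Type
  | x (i : Fin n) : WeylGen n
  | y (i : Fin n) : WeylGen n

/-- The defining relations `[x_i, x_j] = 0`, `[y_i, y_j] = 0`, `[y_i, x_j] = δ_{ij}`. -/
inductive WeylRel (n : ℕ) : FreeAlgebra ℂ (WeylGen n) → FreeAlgebra ℂ (WeylGen n) → Prop
  | xx (i j : Fin n) : WeylRel n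
      (FreeAlgebra.ι ℂ (WeylGen.x i) * FreeAlgebra.ι ℂ (WeylGen.x j))
      (FreeAlgebra.ι ℂ (WeylGen.x j) * FreeAlgebra.ι ℂ (WeylGen.x i))
  | yy (i j : Fin n) : WeylRel n
      (FreeAlgebra.ι ℂ (WeylGen.y i) * FreeAlgebra.ι ℂ (WeylGen.y j))
      (FreeAlgebra.ι ℂ (WeylGen.y j) * FreeAlgebra.ι ℂ (WeylGen.y i))
  | yx (i j : Fin n) : WeylRel n
      (FreeAlgebra.ι ℂ (WeylGen.y i) * FreeAlgebra.ι ℂ (WeylGen.x j))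
      (FreeAlgebra.ι ℂ (WeylGen.x j) * FreeAlgebra.ι ℂ (WeylGen.y i) + if i = j then 1 else 0)

/-- The Weyl algebra `𝒲` of rank `n` over `ℂ`. -/
abbrev Weyl (n : ℕ) : Type := RingQuot (WeylRel n)

/-- The generator `x_i` of the Weyl algebra. -/
def wx {n : ℕ} (i : Fin n) : Weyl n :=
  RingQuot.mkAlgHom ℂ (WeylRel n) (FreeAlgebra.ι ℂ (WeylGen.x i))

/-- The generator `y_i` of the Weyl algebra. -/
def wy {n : ℕ} (i : Fin n) : Weyl n :=
  RingQuot.mkAlgHom ℂ (WeylRel n) (FreeAlgebra.ι ℂ (WeylGen.y i))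

/-- The quadratic form `v ↦ ∑ v_i ^ 2` on `ℂ^n`. -/
abbrev quad (n : ℕ) : QuadraticForm ℂ (Fin n → ℂ) :=
  QuadraticMap.weightedSumSquares ℂ (fun _ : Fin n => (1 : ℂ))

/-- The complex Clifford algebra `𝒞`, with `e_i e_j + e_j e_i = 2 δ_{ij}`. -/
abbrev Cliff (n : ℕ) : Type := CliffordAlgebra (quad n)

/-- The generator `e_i` of the Clifford algebra. -/
def ce {n : ℕ} (i : Fin n) : Cliff n := CliffordAlgebra.ι (quad n) (Pi.single i 1)

/-- The Weyl–Clifford algebra `𝒲 ⊗ 𝒞`. -/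
abbrev WC (n : ℕ) : Type := Weyl n ⊗[ℂ] Cliff n

/-- The even part `𝒲 ⊗ 𝒞_0` of the Weyl–Clifford algebra. -/
def evenWC (n : ℕ) : Subalgebra ℂ (WC n) :=
  (Algebra.TensorProduct.map (AlgHom.id ℂ (Weyl n)) (CliffordAlgebra.even (quad n)).val).range

/-- The parity automorphism of `𝒲 ⊗ 𝒞`: `a ↦ (-1)^{|a|} a` on homogeneous elements. -/
def parity (n : ℕ) : WC n →ₐ[ℂ] WC n :=
  Algebra.TensorProduct.map (AlgHom.id ℂ (Weyl n)) CliffordAlgebra.involute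

/-! ### The harmonic Lie superalgebra `𝔰𝔭𝔬(2|1)` and its centraliser -/

/-- The Dirac operator `∑ y_j ⊗ e_j`. -/
def dirac (n : ℕ) : WC n := ∑ j : Fin n, wy j ⊗ₜ[ℂ] ce j

/-- The vector variable `∑ x_j ⊗ e_j`. -/
def vecVar (n : ℕ) : WC n := ∑ j : Fin n, wx j ⊗ₜ[ℂ] ce j

/-- The odd part of the Lie superalgebra generated by `dirac n` and `vecVar n`. -/
def spoOdd (n : ℕ) : Submodule ℂ (WC n) := Submodule.span ℂ {dirac n, vecVar n}

/-- The even part of the Lie superalgebra generated by `dirac n` and `vecVar n`. -/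
def spoEven (n : ℕ) : Submodule ℂ (WC n) :=
  Submodule.span ℂ {dirac n * dirac n, vecVar n * vecVar n,
    dirac n * vecVar n + vecVar n * dirac n}

/-- The total angular momentum algebra `𝔒`: the elements whose graded commutator with every
element of the Lie superalgebra `𝔰𝔭𝔬(2|1) = spoEven ⊕ spoOdd` vanishes. -/
def tama (n : ℕ) : Subalgebra ℂ (WC n) where
  carrier := {a | (∀ s ∈ spoEven n, a * s = s * a) ∧ (∀ s ∈ spoOdd n, a * s = s * parity n a)}
  mul_mem' := by
    rintro a b ⟨ha, ha'⟩ ⟨hb, hb'⟩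
    refine ⟨fun s hs => ?_, fun s hs => ?_⟩
    · rw [mul_assoc, hb s hs, ← mul_assoc, ha s hs, mul_assoc]
    · rw [mul_assoc, hb' s hs, ← mul_assoc, ha' s hs, mul_assoc, map_mul]
  add_mem' := by
    rintro a b ⟨ha, ha'⟩ ⟨hb, hb'⟩
    refine ⟨fun s hs => ?_, fun s hs => ?_⟩
    · rw [add_mul, mul_add, ha s hs, hb s hs]
    · rw [add_mul, map_add, mul_add, ha' s hs, hb' s hs]
  algebraMap_mem' := by
    intro r
    refine ⟨fun s _ => Algebra.commutes r s, fun s _ => ?_⟩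
    rw [AlgHom.commutes]
    exact Algebra.commutes r s

/-- The even part `𝔒_0 = 𝔒 ∩ (𝒲 ⊗ 𝒞)_0`. -/
def evenTama (n : ℕ) : Subalgebra ℂ (WC n) := tama n ⊓ evenWC n

/-! ### The 2-index symmetries, diagrams and monomials -/

/-- `O_{ij} = x_i y_j - x_j y_i + (1/2) e_i e_j`, used for `i ≠ j`. -/
def O {n : ℕ} (i j : Fin n) : WC n :=
  (wx i * wy j - wx j * wy i) ⊗ₜ[ℂ] 1 + (1 / 2 : ℂ) • (1 ⊗ₜ[ℂ] (ce i * ce j))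

/-- Chords `(i, j)` with `i < j` of the `n`-gon. -/
abbrev Chord (n : ℕ) : Type := {c : Fin n × Fin n // c.1 < c.2}

/-- The subalgebra of `𝒲 ⊗ 𝒞` generated by the `O_{ij}`, `i < j`. -/
def twoIndexAlg (n : ℕ) : Subalgebra ℂ (WC n) :=
  Algebra.adjoin ℂ (Set.range fun c : Chord n => O c.1.1 c.1.2)

/-- A diagram: the chord `c` is labelled by its multiplicity `m c`. -/
abbrev Diagram (n : ℕ) : Type := Chord n → ℕ

/-- No two chords `(i, k)`, `(j, l)` with `i < j < k < l` both occur. -/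
def Uncrossed {n : ℕ} (m : Diagram n) : Prop :=
  ∀ (i j k l : Fin n) (hij : i < j) (hjk : j < k) (hkl : k < l),
    m ⟨(i, k), hij.trans hjk⟩ = 0 ∨ m ⟨(j, l), hjk.trans hkl⟩ = 0

/-- A diagram is uncrossable if it is uncrossed, or is obtained from an uncrossed diagram by
adding a single chord. -/
def Uncrossable {n : ℕ} (m : Diagram n) : Prop :=
  Uncrossed m ∨ ∃ (m' : Diagram n) (c : Chord n), Uncrossed m' ∧ m = m' + Pi.single c 1

/-- The monomial `∏ O_{ij} ^ m_{ij}`, the factors being multiplied in the order in which the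
chords appear in the list `l`. -/
def monomial {n : ℕ} (l : List (Chord n)) (m : Diagram n) : WC n :=
  (l.map fun c => O c.1.1 c.1.2 ^ m c).prod

/-! ### The tableau relations in `U(𝔰𝔬(n))` -/

/-- The universal enveloping algebra of `𝔰𝔬(n, ℂ)`, the skew-symmetric matrices. -/
abbrev Uso (n : ℕ) : Type :=
  UniversalEnvelopingAlgebra ℂ (LieAlgebra.Orthogonal.so (Fin n) ℂ)

/-- The skew-symmetric matrix `E_{ij} - E_{ji}`. -/
def soElt {n : ℕ} (i j : Fin n) : LieAlgebra.Orthogonal.so (Fin n) ℂ :=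
  ⟨Matrix.single i j 1 - Matrix.single j i 1, by
    rw [LieAlgebra.Orthogonal.mem_so]
    simp [Matrix.transpose_sub, Matrix.transpose_single]⟩

/-- `X_{ij}`, the image of `E_{ij} - E_{ji}` in the enveloping algebra. -/
def X {n : ℕ} (i j : Fin n) : Uso n := UniversalEnvelopingAlgebra.ι ℂ (soElt i j)

/-- `X_A` for a sequence `A` of four indices. The factor `2` is the one for which `X_A` is sent
by `X_{ij} ↦ O_{ij}` to the 4-index symmetry
`(3/2) e_A - ∑_{p<q} L_{a_p a_q} e_{a_p} e_{a_q} e_A`. -/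
def X4 {n : ℕ} (A : Fin 4 → Fin n) : Uso n :=
  2 * (X (A 0) (A 1) * X (A 2) (A 3) + X (A 0) (A 2) * X (A 3) (A 1)
    + X (A 0) (A 3) * X (A 1) (A 2))

/-- Replace the entries of `A` by those of `B` in the positions belonging to `S`. -/
def exchange {n : ℕ} (S : Finset (Fin 4)) (A B : Fin 4 → Fin n) : Fin 4 → Fin n :=
  fun p => if p ∈ S then B p else A p

/-- `X_A X_B + ∑ X_{A ∖ (a,b)} X_{B ∖ (a,b)}`, the sum being over the pairs `(a, b)` of common
entries of `A` and `B` (which occupy equal positions in `A` and `B`). A pair is recorded by the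
two remaining positions `r < s`: the entries of `A` and `B` in all other positions agree. -/
def tableauTerm {n : ℕ} (A B : Fin 4 → Fin n) : Uso n :=
  X4 A * X4 B +
    ∑ q : Fin 4 × Fin 4 with q.1 < q.2 ∧ ∀ p, p ≠ q.1 → p ≠ q.2 → A p = B p,
      X (A q.1) (A q.2) * X (B q.1) (B q.2)

/-- The tableau relation of `A` and `B`. The group `⟨(15), (26), (37), (48)⟩` permuting the eight
indices of `(A, B)` is parametrised by the set `S` of positions in which `A` and `B` are
exchanged. -/
def tableauRel {n : ℕ} (A B : Fin 4 → Fin n) : Uso n :=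
  (∑ S : Finset (Fin 4), tableauTerm (exchange S A B) (exchange S B A))
    - (if A = B then 12 else 0)

/-- `A` and `B` are sequences of four distinct indices, and an index occurring in both of them
occurs in the same position. -/
def Aligned {n : ℕ} (A B : Fin 4 → Fin n) : Prop :=
  Function.Injective A ∧ Function.Injective B ∧ ∀ p q, A p = B q → p = q

/-- The two-sided ideal of `U(𝔰𝔬(n))` generated by the tableau relations. -/
def tableauIdeal (n : ℕ) : TwoSidedIdeal (Uso n) :=
  TwoSidedIdeal.span {u | ∃ A B : Fin 4 → Fin n, Aligned A B ∧ u = tableauRel A B}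

end TAMA

end

/-! The algebra 𝒲 ⊗ 𝒞 acts on `Symb n` = ℂ[x, y] ⊗ Λ(e), and a ↦ a · 1 is the normally ordered
symbol, a linear injection (`symbol_injective`). Give x, y and e degree one. Then O_ij has as
leading part the operator Z_ij of multiplication by L_ij + ½ e_i e_j, with L_ij = x_i y_j − x_j y_i.
These operators commute, so the theorem reduces to the study of symbols p(Z) · 1 for commutative
polynomials p.

Spanning. The Pfaffian Pf of four O's satisfies 4 Pf² + ∑ O² = 3/4 (`four_mul_pf_sq`, by means of
the chirality element). Bracketing this with a rotation polarises it to sequences that differ in one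
place (`tabTerm_add_eq_zero`), and for n ≤ 5 no other pairs of sequences occur (`aligned_cases`).
Hence a product of two Pfaffians has lower order. A diagram that is not uncrossable contains two
crossings without a common chord copy (`exists_two_cross`); both can be resolved together, which
lowers a weight, so uncrossable monomials span (`word_mem_uncrossableSpan`). Only the 𝔰𝔬(n)
relations and the relations with A = B are used, so the same holds in U(𝔰𝔬(n)) modulo the tableau
relations.

Independence. The coefficients of p(Z) · 1 at ∅ and at a chord c are p(L) and ½ (∂p/∂c)(L).
Specialise to parallel vectors in positions 0 and 1, so that L_01 = 0; the non-crossing monomials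
without the chord (0, 1) stay independent (`separates_degen`). A polynomial in uncrossable diagrams
without this chord that vanishes after specialisation, together with its derivatives along the other
chords, is zero (`eq_zero_of_separates`). It follows that Z_01 F = p(Z) · 1 with p uncrossable
forces X_01 to divide p (`exists_eq_X_mul`). The case F = 0 gives independence by descent on the
degree; the general case permits cancelling Z_01.

Centraliser. The top component of the symbol of an even element of the centraliser is killed by the
leading parts of both odd brackets (`comp_symbol_mem_invariants`). The squares of these operators
make every coefficient SL₂-invariant, hence a polynomial in the L_ij once one L_ab is inverted.
Since n ≤ 5, an invariant symbol is determined by its coefficients at ∅ and at pairs avoiding a and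
b, and these can be matched by polynomials in Z, the pairs through Pfaffians
(`exists_polyZ_eq_pow`). Cancelling the power of Z_01 puts every invariant in the span of the
uncrossable symbols, and induction on the degree identifies the centraliser with the algebra of the
O_ij.

Presentation. The quotient by the tableau relations is spanned by uncrossable monomials whose images
in 𝒲 ⊗ 𝒞 are independent, so the induced map is injective (`quotient_hom_injective`). -/

noncomputable section

namespace TAMA

open MvPolynomial

/-! ### Evaluating polynomials at commuting elements of a noncommutative algebra -/

section CommLift

open scoped IsMulCommutative

variable {σ A : Type*} [Ring A] [Algebra ℂ A]

/-- The evaluation of polynomials at a family of commuting elements. -/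
def commLift (v : σ → A) (h : ∀ i j, Commute (v i) (v j)) : MvPolynomial σ ℂ →ₐ[ℂ] A :=
  haveI : IsMulCommutative (Algebra.adjoin ℂ (Set.range v)) :=
    Algebra.isMulCommutative_adjoin ℂ (by rintro _ ⟨i, rfl⟩ _ ⟨j, rfl⟩; exact h i j)
  (Algebra.adjoin ℂ (Set.range v)).val.comp
    (aeval fun i => (⟨v i, Algebra.subset_adjoin ⟨i, rfl⟩⟩ : Algebra.adjoin ℂ (Set.range v)))

@[simp] theorem commLift_X (v : σ → A) (h : ∀ i j, Commute (v i) (v j)) (i : σ) :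
    commLift v h (MvPolynomial.X i) = v i := by
  have : IsMulCommutative (Algebra.adjoin ℂ (Set.range v)) :=
    Algebra.isMulCommutative_adjoin ℂ (by rintro _ ⟨i, rfl⟩ _ ⟨j, rfl⟩; exact h i j)
  simp [commLift]

end CommLift

/-! ### The module of symbols and its elementary operators -/

/-- Polynomials in `x_1, …, x_n` (left summand) and `y_1, …, y_n` (right summand). -/
abbrev Poly (n : ℕ) : Type := MvPolynomial (Fin n ⊕ Fin n) ℂ

/-- The module of symbols `ℂ[x, y] ⊗ Λ(e)`; a function on the subsets of the index set records
the coefficients of the ordered wedge products of the `e_i`. -/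
abbrev Symb (n : ℕ) : Type := Finset (Fin n) → Poly n

variable {n : ℕ}

/-- Multiplication by a polynomial. -/
def mulOp (f : Poly n) : Module.End ℂ (Symb n) where
  toFun F S := f * F S
  map_add' F G := by ext1 S; simp [mul_add]
  map_smul' c F := by ext1 S; simp

/-- Partial differentiation. -/
def derOp (v : Fin n ⊕ Fin n) : Module.End ℂ (Symb n) where
  toFun F S := pderiv v (F S)
  map_add' F G := by ext1 S; simp
  map_smul' c F := by ext1 S; simp

/-- The sign of `e_i` in front of `S`. -/
def sgn (i : Fin n) (S : Finset (Fin n)) : ℂ := (-1) ^ (S.filter (· < i)).card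

/-- Wedge multiplication by (`b = true`) or contraction with (`b = false`) `e_i`. -/
def flipOp (i : Fin n) (b : Bool) : Module.End ℂ (Symb n) where
  toFun F S := if (i ∈ S ↔ b) then sgn i S • F (symmDiff S {i}) else 0
  map_add' F G := by ext1 S; by_cases h : (i ∈ S ↔ b) <;> simp [h]
  map_smul' c F := by ext1 S; by_cases h : (i ∈ S ↔ b) <;> simp [h, smul_comm c]

/-- Wedge multiplication by `e_i`. -/
abbrev wedge (i : Fin n) : Module.End ℂ (Symb n) := flipOp i true

/-- Contraction with `e_i`. -/
abbrev contr (i : Fin n) : Module.End ℂ (Symb n) := flipOp i false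

/-- The parity operator. -/
def parOp (n : ℕ) : Module.End ℂ (Symb n) where
  toFun F S := ((-1 : ℂ) ^ S.card) • F S
  map_add' F G := by ext1 S; simp
  map_smul' c F := by ext1 S; simp [smul_comm c]

@[simp] theorem mulOp_apply (f : Poly n) (F : Symb n) (S : Finset (Fin n)) :
    mulOp f F S = f * F S := rfl

@[simp] theorem derOp_apply (v : Fin n ⊕ Fin n) (F : Symb n) (S : Finset (Fin n)) :
    derOp v F S = pderiv v (F S) := rfl

theorem flipOp_apply (i : Fin n) (b : Bool) (F : Symb n) (S : Finset (Fin n)) :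
    flipOp i b F S = if (i ∈ S ↔ b) then sgn i S • F (symmDiff S {i}) else 0 := rfl

@[simp] theorem parOp_apply (F : Symb n) (S : Finset (Fin n)) :
    parOp n F S = ((-1 : ℂ) ^ S.card) • F S := rfl

theorem sgn_mul_self (i : Fin n) (S : Finset (Fin n)) : sgn i S * sgn i S = 1 := by
  rw [sgn, ← pow_add, ← two_mul, pow_mul]; simp

theorem mem_symmDiff_singleton {i j : Fin n} {S : Finset (Fin n)} :
    i ∈ symmDiff S {j} ↔ (if i = j then i ∉ S else i ∈ S) := by
  by_cases h : i = j
  · subst h; simp [Finset.mem_symmDiff]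
  · simp [Finset.mem_symmDiff, h]

theorem neg_one_pow_card_symmDiff (S : Finset (Fin n)) (j : Fin n) :
    (-1 : ℂ) ^ (symmDiff S {j}).card = - (-1) ^ S.card := by
  by_cases h : j ∈ S
  · have : symmDiff S {j} = S.erase j := by
      ext k; rw [mem_symmDiff_singleton]; by_cases hk : k = j <;> simp [hk, h]
    rw [this, ← Finset.card_erase_add_one h, pow_succ]; ring
  · have : symmDiff S {j} = insert j S := by
      ext k; rw [mem_symmDiff_singleton]; by_cases hk : k = j <;> simp [hk, h]
    rw [this, Finset.card_insert_of_notMem h, pow_succ]; ring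

theorem sgn_symmDiff (i j : Fin n) (S : Finset (Fin n)) :
    sgn i (symmDiff S {j}) = if j < i then - sgn i S else sgn i S := by
  have : (symmDiff S {j}).filter (· < i)
      = if j < i then symmDiff (S.filter (· < i)) {j} else S.filter (· < i) := by
    split_ifs with h <;> ext k <;> simp only [Finset.mem_filter, mem_symmDiff_singleton] <;>
      by_cases hk : k = j <;> grind
  rw [sgn, this]
  split_ifs with h
  · rw [neg_one_pow_card_symmDiff, sgn]
  · rfl

/-- Toggling the smaller index changes the sign attached to the larger one, and not conversely. The
Boolean treats wedges and contractions together. -/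
theorem flipOp_anticomm {i j : Fin n} (hij : i ≠ j) (b c : Bool) :
    flipOp i b * flipOp j c = - (flipOp j c * flipOp i b) := by
  refine LinearMap.ext fun F => funext fun S => ?_
  have hsd : symmDiff (symmDiff S {i}) {j} = symmDiff (symmDiff S {j}) {i} := by
    rw [symmDiff_right_comm]
  simp only [Module.End.mul_apply, LinearMap.neg_apply, Pi.neg_apply, flipOp_apply,
    mem_symmDiff_singleton, sgn_symmDiff, hij, hij.symm, if_false, hsd]
  rcases lt_or_gt_of_ne hij with h | h
  all_goals
    have h' := h.not_gt
    by_cases h1 : (i ∈ S ↔ b) <;> by_cases h2 : (j ∈ S ↔ c) <;>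
      simp [h1, h2, h, h', smul_smul, mul_comm]

theorem flipOp_sq (i : Fin n) (b : Bool) : flipOp i b * flipOp i b = 0 := by
  refine LinearMap.ext fun F => funext fun S => ?_
  simp only [Module.End.mul_apply, flipOp_apply, mem_symmDiff_singleton, if_true]
  by_cases h1 : i ∈ S <;> cases b <;> simp [h1]

theorem wedge_contr_add (i : Fin n) : wedge i * contr i + contr i * wedge i = 1 := by
  refine LinearMap.ext fun F => funext fun S => ?_
  simp only [Module.End.mul_apply, LinearMap.add_apply, Pi.add_apply, flipOp_apply,
    mem_symmDiff_singleton, if_true, sgn_symmDiff, lt_irrefl, if_false, Module.End.one_apply]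
  by_cases h1 : i ∈ S <;>
    simp [h1, smul_smul, sgn_mul_self]

theorem flipOp_parOp (i : Fin n) (b : Bool) :
    parOp n * flipOp i b = - (flipOp i b * parOp n) := by
  refine LinearMap.ext fun F => funext fun S => ?_
  simp only [Module.End.mul_apply, LinearMap.neg_apply, Pi.neg_apply, flipOp_apply, parOp_apply,
    neg_one_pow_card_symmDiff]
  by_cases h1 : (i ∈ S ↔ b) <;> simp [h1, smul_smul, mul_comm]

theorem mulOp_mul (f g : Poly n) : mulOp f * mulOp g = mulOp (f * g) := by
  refine LinearMap.ext fun F => funext fun S => ?_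
  simp [mul_assoc]

@[simp] theorem mulOp_zero : mulOp (0 : Poly n) = 0 :=
  LinearMap.ext fun F => funext fun S => by simp

@[simp] theorem mulOp_one : mulOp (1 : Poly n) = 1 :=
  LinearMap.ext fun F => funext fun S => by simp

theorem mulOp_add (f g : Poly n) : mulOp (f + g) = mulOp f + mulOp g :=
  LinearMap.ext fun F => funext fun S => by simp [add_mul]

theorem mulOp_sub (f g : Poly n) : mulOp (f - g) = mulOp f - mulOp g :=
  LinearMap.ext fun F => funext fun S => by simp [sub_mul]

theorem mulOp_comm (f g : Poly n) : Commute (mulOp f) (mulOp g) := by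
  rw [Commute, SemiconjBy, mulOp_mul, mulOp_mul, mul_comm]

theorem derOp_comm (v w : Fin n ⊕ Fin n) : Commute (derOp v) (derOp w) := by
  refine LinearMap.ext fun F => funext fun S => ?_
  simp only [Module.End.mul_apply, derOp_apply]
  -- A commutator of derivations is a derivation, so it only has to vanish on the variables.
  have h : ⁅(pderiv v : Derivation ℂ (Poly n) (Poly n)), pderiv w⁆ = 0 :=
    MvPolynomial.derivation_ext fun i => by
      rw [Derivation.commutator_apply]
      simp [pderiv_X, Pi.single_apply, apply_ite]
  have h' := DFunLike.congr_fun h (F S)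
  rwa [Derivation.commutator_apply, Derivation.zero_apply, sub_eq_zero] at h'

theorem derOp_mulOp (v : Fin n ⊕ Fin n) (f : Poly n) :
    derOp v * mulOp f = mulOp f * derOp v + mulOp (pderiv v f) := by
  refine LinearMap.ext fun F => funext fun S => ?_
  simp [mul_comm]

theorem flipOp_mulOp (i : Fin n) (b : Bool) (f : Poly n) : Commute (flipOp i b) (mulOp f) := by
  refine LinearMap.ext fun F => funext fun S => ?_
  simp only [Module.End.mul_apply, flipOp_apply, mulOp_apply]
  by_cases h1 : (i ∈ S ↔ b) <;> simp [h1]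

theorem flipOp_derOp (i : Fin n) (b : Bool) (v : Fin n ⊕ Fin n) :
    Commute (flipOp i b) (derOp v) := by
  refine LinearMap.ext fun F => funext fun S => ?_
  simp only [Module.End.mul_apply, flipOp_apply, derOp_apply]
  by_cases h1 : (i ∈ S ↔ b) <;> simp [h1]

theorem parOp_mulOp (f : Poly n) : Commute (parOp n) (mulOp f) := by
  refine LinearMap.ext fun F => funext fun S => ?_
  simp

theorem parOp_derOp (v : Fin n ⊕ Fin n) : Commute (parOp n) (derOp v) := by
  refine LinearMap.ext fun F => funext fun S => ?_
  simp

/-- The variable `x_i`. -/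
abbrev px (i : Fin n) : Poly n := MvPolynomial.X (Sum.inl i)

/-- The variable `y_i`. -/
abbrev py (i : Fin n) : Poly n := MvPolynomial.X (Sum.inr i)

/-- The symbol `1`. -/
def oneSymb (n : ℕ) : Symb n := Pi.single ∅ 1

end TAMA

end

noncomputable section

namespace TAMA

open MvPolynomial

variable {n : ℕ}

/-! ### Generation of the Weyl and Clifford algebras -/

theorem wx_comm (i j : Fin n) : Commute (wx i) (wx j) := by
  rw [Commute, SemiconjBy, wx, wx, ← map_mul, ← map_mul]
  exact RingQuot.mkAlgHom_rel ℂ (WeylRel.xx i j)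

theorem wy_comm (i j : Fin n) : Commute (wy i) (wy j) := by
  rw [Commute, SemiconjBy, wy, wy, ← map_mul, ← map_mul]
  exact RingQuot.mkAlgHom_rel ℂ (WeylRel.yy i j)

theorem wy_mul_wx (i j : Fin n) : wy i * wx j = wx j * wy i + if i = j then 1 else 0 := by
  have h := RingQuot.mkAlgHom_rel ℂ (WeylRel.yx i j)
  rw [map_mul, map_add, map_mul] at h
  rw [wx, wy, h]
  split_ifs <;> simp

theorem ce_mul_add (i j : Fin n) :
    ce i * ce j + ce j * ce i = if i = j then (2 : Cliff n) else 0 := by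
  rw [ce, ce, CliffordAlgebra.ι_mul_ι_add_swap]
  have : QuadraticMap.polar (quad n) (Pi.single i 1) (Pi.single j 1) = if i = j then 2 else 0 := by
    simp only [QuadraticMap.polar, QuadraticMap.weightedSumSquares_apply, Pi.add_apply, smul_eq_mul,
      one_mul, ← Finset.sum_sub_distrib]
    rw [Finset.sum_eq_single i]
    · by_cases h : i = j
      · subst h; simp; norm_num
      · simp [h]
    · intro b _ hb; simp [Pi.single_apply, hb]
    · simp
  rw [this]
  split_ifs
  · exact map_ofNat _ 2
  · exact map_zero _

theorem ce_sq (i : Fin n) : ce i * ce i = 1 := by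
  have h := ce_mul_add i i
  rw [if_pos rfl, ← two_smul ℂ, show (2 : Cliff n) = (2 : ℂ) • 1 by
    rw [← Algebra.algebraMap_eq_smul_one]; exact (map_ofNat _ 2).symm] at h
  exact smul_right_injective _ (two_ne_zero) h

theorem ce_anticomm {i j : Fin n} (h : i ≠ j) : ce i * ce j = - (ce j * ce i) := by
  have := ce_mul_add i j
  rw [if_neg h] at this
  exact eq_neg_of_add_eq_zero_left this

theorem weyl_adjoin :
    Algebra.adjoin ℂ (Set.range wx ∪ Set.range wy : Set (Weyl n)) = ⊤ := by
  rw [eq_top_iff]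
  rintro a -
  obtain ⟨b, rfl⟩ := RingQuot.mkAlgHom_surjective ℂ (WeylRel n) a
  induction b using FreeAlgebra.induction with
  | grade0 r => rw [AlgHom.commutes]; exact Subalgebra.algebraMap_mem _ _
  | grade1 g =>
    cases g with
    | x i => exact Algebra.subset_adjoin (Or.inl ⟨i, rfl⟩)
    | y i => exact Algebra.subset_adjoin (Or.inr ⟨i, rfl⟩)
  | mul a b ha hb => rw [map_mul]; exact mul_mem ha hb
  | add a b ha hb => rw [map_add]; exact add_mem ha hb

theorem cliff_adjoin : Algebra.adjoin ℂ (Set.range ce : Set (Cliff n)) = ⊤ := by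
  rw [eq_top_iff, ← CliffordAlgebra.adjoin_range_ι, Algebra.adjoin_le_iff]
  rintro _ ⟨v, rfl⟩
  have : CliffordAlgebra.ι (quad n) v = ∑ i, v i • ce i := by
    simp only [ce, ← map_smul, ← map_sum]
    congr 1
    ext j; simp [Finset.sum_apply, Pi.single_apply]
  rw [this]
  exact sum_mem fun i _ => Subalgebra.smul_mem _ (Algebra.subset_adjoin (Set.mem_range_self i)) _

theorem commute_of_adjoin_eq_top {A B : Type*} [Ring A] [Algebra ℂ A] [Ring B] [Algebra ℂ B]
    {s : Set A} (hs : Algebra.adjoin ℂ s = ⊤) (f : A →ₐ[ℂ] B) (c : B)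
    (h : ∀ a ∈ s, Commute (f a) c) (a : A) : Commute (f a) c := by
  have ha : a ∈ Algebra.adjoin ℂ s := hs ▸ Algebra.mem_top
  induction ha using Algebra.adjoin_induction with
  | mem x hx => exact h x hx
  | algebraMap r => rw [AlgHom.commutes]; exact Algebra.commutes r c
  | add x y _ _ hx hy => rw [map_add]; exact hx.add_left hy
  | mul x y _ _ hx hy => rw [map_mul]; exact hx.mul_left hy

theorem eq_top_of_left_mul_mem {A : Type*} [Ring A] [Algebra ℂ A] {s : Set A}
    (hs : Algebra.adjoin ℂ s = ⊤) (N : Submodule ℂ A) (h1 : (1 : A) ∈ N)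
    (h : ∀ g ∈ s, ∀ a ∈ N, g * a ∈ N) : N = ⊤ := by
  rw [eq_top_iff]
  rintro a -
  have ha : a ∈ Algebra.adjoin ℂ s := hs ▸ Algebra.mem_top
  suffices ∀ b ∈ N, a * b ∈ N by simpa using this 1 h1
  induction ha using Algebra.adjoin_induction with
  | mem x hx => exact h x hx
  | algebraMap r => intro b hb; rw [← Algebra.smul_def]; exact N.smul_mem r hb
  | add x y _ _ hx hy => intro b hb; rw [add_mul]; exact N.add_mem (hx b hb) (hy b hb)
  | mul x y _ _ hx hy => intro b hb; rw [mul_assoc]; exact hx _ (hy b hb)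

/-! ### The action of the Weyl–Clifford algebra on symbols -/

/-- The action of `y_i` on symbols. -/
def yOp (i : Fin n) : Module.End ℂ (Symb n) := mulOp (py i) + derOp (Sum.inl i)

/-- The action of `e_i` on symbols. -/
def gam (i : Fin n) : Module.End ℂ (Symb n) := wedge i + contr i

theorem yOp_mulOp (i : Fin n) (f : Poly n) :
    yOp i * mulOp f = mulOp f * yOp i + mulOp (pderiv (Sum.inl i) f) := by
  rw [yOp, add_mul, derOp_mulOp, mulOp_mul, mul_add, mulOp_mul, mul_comm f]
  abel

theorem yOp_comm (i j : Fin n) : Commute (yOp i) (yOp j) := by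
  have h (i j : Fin n) : Commute (derOp (Sum.inl i)) (mulOp (py j)) := by
    rw [Commute, SemiconjBy, derOp_mulOp]
    have : pderiv (Sum.inl i) (py j) = 0 := pderiv_X_of_ne (by simp)
    rw [this, mulOp_zero, add_zero]
  exact ((mulOp_comm _ _).add_right (h j i).symm).add_left ((h i j).add_right (derOp_comm _ _))

theorem gam_mul_add (i j : Fin n) :
    gam i * gam j + gam j * gam i = if i = j then (2 : Module.End ℂ (Symb n)) else 0 := by
  split_ifs with h
  · subst h
    have h1 := wedge_contr_add i
    have h2 := flipOp_sq i true
    have h3 := flipOp_sq i false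
    simp only [gam, add_mul, mul_add, h2, h3, zero_add, add_zero]
    rw [add_comm (contr i * wedge i), h1]; norm_num
  · simp only [gam, add_mul, mul_add, flipOp_anticomm h]
    abel

/-- Adding the double sum to its transpose leaves only anticommutators, which the hypothesis
evaluates. -/
theorem sum_smul_mul_self {A : Type*} [Ring A] [Algebra ℂ A] (g : Fin n → A)
    (hg : ∀ i j, g i * g j + g j * g i = if i = j then 2 else 0) (v : Fin n → ℂ) :
    (∑ i, v i • g i) * (∑ i, v i • g i) = algebraMap ℂ A (∑ i, v i * v i) := by
  have h1 : (∑ i, v i • g i) * (∑ i, v i • g i) = ∑ i, ∑ j, (v i * v j) • (g i * g j) := by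
    simp only [Finset.sum_mul_sum, smul_mul_smul_comm]
  have h2 : (∑ i, v i • g i) * (∑ i, v i • g i) = ∑ i, ∑ j, (v i * v j) • (g j * g i) := by
    rw [h1, Finset.sum_comm]
    exact Finset.sum_congr rfl fun i _ => Finset.sum_congr rfl fun j _ => by rw [mul_comm (v i)]
  have h3 : (2 : ℂ) • ((∑ i, v i • g i) * (∑ i, v i • g i))
      = (2 : ℂ) • algebraMap ℂ A (∑ i, v i * v i) := by
    rw [two_smul]
    nth_rw 1 [h1]
    rw [h2]
    simp_rw [← Finset.sum_add_distrib, ← smul_add, hg, smul_ite, smul_zero]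
    simp only [Finset.sum_ite_eq, Finset.mem_univ, if_true, map_sum, Finset.smul_sum]
    refine Finset.sum_congr rfl fun i _ => ?_
    rw [Algebra.smul_def, Algebra.smul_def, map_ofNat]
    exact (Nat.cast_commute 2 _).eq.symm
  exact smul_right_injective _ two_ne_zero h3

/-- The action of the Weyl algebra on symbols. -/
def weylAct (n : ℕ) : Weyl n →ₐ[ℂ] Module.End ℂ (Symb n) :=
  RingQuot.liftAlgHom ℂ ⟨FreeAlgebra.lift ℂ (fun g => match g with
    | WeylGen.x i => mulOp (px i)
    | WeylGen.y i => yOp i), by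
      rintro _ _ (⟨i, j⟩ | ⟨i, j⟩ | ⟨i, j⟩)
      · simpa using (mulOp_comm (px i) (px j)).eq
      · simpa using (yOp_comm i j).eq
      · have h := yOp_mulOp i (px j)
        by_cases hij : i = j
        · subst hij
          simpa using h
        · have h1 : pderiv (Sum.inl i) (px j) = 0 := pderiv_X_of_ne (by simpa using Ne.symm hij)
          rw [h1, mulOp_zero] at h
          simpa [hij] using h⟩

@[simp] theorem weylAct_wx (i : Fin n) : weylAct n (wx i) = mulOp (px i) := by
  simp [weylAct, wx]

@[simp] theorem weylAct_wy (i : Fin n) : weylAct n (wy i) = yOp i := by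
  simp [weylAct, wy]

/-- The action of the Clifford algebra on symbols. -/
def cliffAct (n : ℕ) : Cliff n →ₐ[ℂ] Module.End ℂ (Symb n) :=
  CliffordAlgebra.lift (quad n) ⟨Fintype.linearCombination ℂ gam, fun v => by
    rw [Fintype.linearCombination_apply, sum_smul_mul_self gam gam_mul_add]
    simp [QuadraticMap.weightedSumSquares_apply]⟩

@[simp] theorem cliffAct_ce (i : Fin n) : cliffAct n (ce i) = gam i := by
  simp [cliffAct, ce]

theorem weylAct_cliffAct_commute (a : Weyl n) (b : Cliff n) :
    Commute (weylAct n a) (cliffAct n b) := by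
  refine commute_of_adjoin_eq_top weyl_adjoin _ _ (fun a ha => ?_) a
  refine (commute_of_adjoin_eq_top cliff_adjoin _ _ ?_ b).symm
  rintro _ ⟨j, rfl⟩
  have hf (f : Poly n) : Commute (gam j) (mulOp f) :=
    (flipOp_mulOp j true f).add_left (flipOp_mulOp j false f)
  have hd (v) : Commute (gam j) (derOp v) :=
    (flipOp_derOp j true v).add_left (flipOp_derOp j false v)
  rcases ha with ⟨i, rfl⟩ | ⟨i, rfl⟩
  · simpa using hf _
  · simpa [yOp] using (hf _).add_right (hd _)

/-- The action of `𝒲 ⊗ 𝒞` on symbols. -/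
def act (n : ℕ) : WC n →ₐ[ℂ] Module.End ℂ (Symb n) :=
  Algebra.TensorProduct.lift (weylAct n) (cliffAct n) weylAct_cliffAct_commute

@[simp] theorem act_tmul (a : Weyl n) (b : Cliff n) :
    act n (a ⊗ₜ b) = weylAct n a * cliffAct n b := by
  simp [act]

/-- The normally ordered symbol of an element of `𝒲 ⊗ 𝒞`. -/
def symbol (n : ℕ) : WC n →ₗ[ℂ] Symb n :=
  (LinearMap.applyₗ (oneSymb n)) ∘ₗ (act n).toLinearMap

theorem symbol_apply (a : WC n) : symbol n a = act n a (oneSymb n) := rfl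

end TAMA

end

noncomputable section

namespace TAMA

open MvPolynomial

variable {n : ℕ}

/-! ### Normally ordered monomials and faithfulness of the symbol -/

/-- Polynomials in the `x_i`, inside the Weyl algebra. -/
def polyX (n : ℕ) : MvPolynomial (Fin n) ℂ →ₐ[ℂ] Weyl n := commLift wx wx_comm

/-- Polynomials in the `y_i`, inside the Weyl algebra. -/
def polyY (n : ℕ) : MvPolynomial (Fin n) ℂ →ₐ[ℂ] Weyl n := commLift wy wy_comm

theorem wy_mul_polyX (i : Fin n) (p : MvPolynomial (Fin n) ℂ) :
    wy i * polyX n p = polyX n p * wy i + polyX n (pderiv i p) := by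
  induction p using MvPolynomial.induction_on with
  | C a =>
    rw [pderiv_C, map_zero, add_zero, ← algebraMap_eq, AlgHom.commutes]
    exact (Algebra.commutes a _).symm
  | add p q hp hq => simp only [map_add, mul_add, add_mul, hp, hq]; abel
  | mul_X p j hp =>
    have h1 : polyX n (MvPolynomial.X j) = wx j := commLift_X _ _ _
    rw [map_mul, h1, ← mul_assoc, hp, add_mul, mul_assoc, wy_mul_wx, pderiv_mul, map_add, map_mul,
      h1, map_mul, mul_add, ← mul_assoc, add_assoc]
    congr 1
    rw [add_comm]
    congr 1
    by_cases hij : i = j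
    · subst hij; simp
    · rw [pderiv_X_of_ne (Ne.symm hij)]; simp [hij]

theorem span_polyX_mul_polyY :
    Submodule.span ℂ (Set.range fun q : (Fin n →₀ ℕ) × (Fin n →₀ ℕ) =>
      polyX n (MvPolynomial.monomial q.1 1) * polyY n (MvPolynomial.monomial q.2 1)) = ⊤ := by
  set N := Submodule.span ℂ (Set.range fun q : (Fin n →₀ ℕ) × (Fin n →₀ ℕ) =>
      polyX n (MvPolynomial.monomial q.1 1) * polyY n (MvPolynomial.monomial q.2 1)) with hN
  have key : ∀ p q, polyX n p * polyY n q ∈ N := by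
    intro p q
    induction p using MvPolynomial.induction_on' with
    | add p₁ p₂ h₁ h₂ => rw [map_add, add_mul]; exact N.add_mem h₁ h₂
    | monomial a r =>
      induction q using MvPolynomial.induction_on' with
      | add p₁ p₂ h₁ h₂ => rw [map_add, mul_add]; exact N.add_mem h₁ h₂
      | monomial b s =>
        have hr : MvPolynomial.monomial a r = r • MvPolynomial.monomial a (1 : ℂ) := by
          simp [smul_monomial]
        have hs : MvPolynomial.monomial b s = s • MvPolynomial.monomial b (1 : ℂ) := by
          simp [smul_monomial]
        rw [hr, hs, map_smul, map_smul, smul_mul_smul_comm]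
        exact N.smul_mem _ (Submodule.subset_span ⟨(a, b), rfl⟩)
  refine eq_top_of_left_mul_mem weyl_adjoin N (by simpa using key 1 1) fun g hg a ha => ?_
  induction ha using Submodule.span_induction with
  | zero => rw [mul_zero]; exact N.zero_mem
  | add a b _ _ ha hb => rw [mul_add]; exact N.add_mem ha hb
  | smul r a _ ha => rw [mul_smul_comm]; exact N.smul_mem r ha
  | mem a ha =>
    obtain ⟨⟨s, t⟩, rfl⟩ := ha
    rcases hg with ⟨i, rfl⟩ | ⟨i, rfl⟩
    · have : wx i = polyX n (MvPolynomial.X i) := (commLift_X _ _ _).symm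
      rw [this, ← mul_assoc, ← map_mul]; exact key _ _
    · have : wy i = polyY n (MvPolynomial.X i) := (commLift_X _ _ _).symm
      rw [← mul_assoc, wy_mul_polyX, add_mul, mul_assoc, this, ← map_mul]
      exact N.add_mem (key _ _) (key _ _)

/-- The predicate `k` carries a lower bound through the recursion: once e_i has moved past the head
h, every new word must still lie above h, so that h can be put back in front. -/
theorem ce_mul_prod_mem (i : Fin n) (l : List (Fin n)) (hl : l.Pairwise (· < ·)) (k : Fin n → Prop)
    (hk : ∀ j ∈ l, k j) (hi : k i) :
    ce i * (l.map ce).prod ∈ Submodule.span ℂ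
      {c : Cliff n | ∃ l' : List (Fin n), l'.Pairwise (· < ·) ∧ (∀ j ∈ l', k j) ∧
        c = (l'.map ce).prod} := by
  induction l generalizing k with
  | nil => exact Submodule.subset_span ⟨[i], by simp, by simpa using hi, by simp⟩
  | cons h l ih =>
    rw [List.pairwise_cons] at hl
    rcases lt_trichotomy i h with hih | rfl | hih
    · refine Submodule.subset_span ⟨i :: h :: l, ?_, ?_, by simp⟩
      · rw [List.pairwise_cons, List.pairwise_cons]
        exact ⟨fun j hj => by
          rcases List.mem_cons.1 hj with rfl | hj
          · exact hih
          · exact hih.trans (hl.1 j hj), hl⟩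
      · intro j hj
        rcases List.mem_cons.1 hj with rfl | hj
        · exact hi
        · exact hk j hj
    · rw [List.map_cons, List.prod_cons, ← mul_assoc, ce_sq, one_mul]
      exact Submodule.subset_span ⟨l, hl.2, fun j hj => hk j (List.mem_cons_of_mem _ hj), rfl⟩
    · rw [List.map_cons, List.prod_cons, ← mul_assoc, ce_anticomm hih.ne', neg_mul, mul_assoc]
      refine Submodule.neg_mem _ ?_
      have := ih hl.2 (fun j => h < j ∧ k j)
        (fun j hj => ⟨hl.1 j hj, hk j (List.mem_cons_of_mem _ hj)⟩) ⟨hih, hi⟩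
      generalize ce i * (l.map ce).prod = b at this
      induction this using Submodule.span_induction with
      | zero => rw [mul_zero]; exact Submodule.zero_mem _
      | add a b _ _ ha hb => rw [mul_add]; exact Submodule.add_mem _ ha hb
      | smul r a _ ha => rw [mul_smul_comm]; exact Submodule.smul_mem _ r ha
      | mem a ha =>
        obtain ⟨l', h1, h2, rfl⟩ := ha
        refine Submodule.subset_span ⟨h :: l', ?_, ?_, by simp⟩
        · rw [List.pairwise_cons]; exact ⟨fun j hj => (h2 j hj).1, h1⟩
        · intro j hj
          rcases List.mem_cons.1 hj with rfl | hj
          · exact hk _ List.mem_cons_self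
          · exact (h2 j hj).2

theorem span_ce_prod :
    Submodule.span ℂ (Set.range fun l : {l : List (Fin n) // l.Pairwise (· < ·)} =>
      (l.1.map ce).prod) = ⊤ := by
  refine eq_top_of_left_mul_mem cliff_adjoin _
    (Submodule.subset_span ⟨⟨[], List.Pairwise.nil⟩, by simp⟩) ?_
  rintro _ ⟨i, rfl⟩ a ha
  induction ha using Submodule.span_induction with
  | zero => rw [mul_zero]; exact Submodule.zero_mem _
  | add a b _ _ ha hb => rw [mul_add]; exact Submodule.add_mem _ ha hb
  | smul r a _ ha => rw [mul_smul_comm]; exact Submodule.smul_mem _ r ha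
  | mem a ha =>
    obtain ⟨⟨l, hl⟩, rfl⟩ := ha
    refine Submodule.span_mono ?_
      (ce_mul_prod_mem i l hl (fun _ => True) (fun _ _ => trivial) trivial)
    rintro _ ⟨l', h1, -, rfl⟩
    exact ⟨⟨l', h1⟩, rfl⟩

/-- The contraction contributes nothing since i is not in T, and the wedge has sign +1 since i
precedes all of T. -/
theorem gam_single (i : Fin n) (T : Finset (Fin n)) (hT : ∀ k ∈ T, i < k) :
    gam i (Pi.single T 1) = Pi.single (insert i T) 1 := by
  have hi : i ∉ T := fun h => lt_irrefl _ (hT i h)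
  have hins : symmDiff (insert i T) {i} = T := by
    ext k; rw [mem_symmDiff_singleton]; by_cases hk : k = i <;> simp [hk, hi]
  funext S
  simp only [gam, LinearMap.add_apply, Pi.add_apply, flipOp_apply]
  by_cases hS : S = insert i T
  · subst hS
    have : sgn i (insert i T) = 1 := by
      rw [sgn, Finset.filter_eq_empty_iff.2]
      · simp
      · intro k hk
        rcases Finset.mem_insert.1 hk with rfl | hk
        · exact lt_irrefl _
        · exact (hT k hk).not_gt
    simp [hins, this]
  · have h1 : i ∈ S → symmDiff S {i} ≠ T := by
      rintro h rfl
      apply hS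
      ext k; simp only [Finset.mem_insert, mem_symmDiff_singleton]
      by_cases hk : k = i <;> simp [hk, h]
    have h2 : i ∉ S → symmDiff S {i} ≠ T := by
      rintro h rfl
      apply hi; rw [mem_symmDiff_singleton]; simpa using h
    by_cases h : i ∈ S
    · simp [h, hS, h1 h]
    · simp [h, hS, h2 h]

theorem cliffAct_prod (l : List (Fin n)) (hl : l.Pairwise (· < ·)) :
    cliffAct n (l.map ce).prod (oneSymb n) = Pi.single l.toFinset 1 := by
  induction l with
  | nil => simp [oneSymb]
  | cons i l ih =>
    rw [List.pairwise_cons] at hl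
    rw [List.map_cons, List.prod_cons, map_mul, Module.End.mul_apply, ih hl.2, cliffAct_ce,
      gam_single _ _ (by simpa using hl.1), List.toFinset_cons]

theorem weylAct_polyX (p : MvPolynomial (Fin n) ℂ) (F : Symb n) :
    weylAct n (polyX n p) F = mulOp (rename Sum.inl p) F := by
  induction p using MvPolynomial.induction_on generalizing F with
  | C a =>
    rw [← algebraMap_eq, AlgHom.commutes, AlgHom.commutes, AlgHom.commutes]
    funext S; simp [Algebra.smul_def, Module.algebraMap_end_apply]
  | add p q hp hq => simp only [map_add, LinearMap.add_apply, hp, hq, mulOp_add]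
  | mul_X p j hp =>
    rw [map_mul, map_mul, Module.End.mul_apply, polyX, commLift_X, weylAct_wx, ← polyX, hp,
      map_mul, ← mulOp_mul, rename_X, Module.End.mul_apply]

theorem pderiv_inl_rename_inr (i : Fin n) (q : MvPolynomial (Fin n) ℂ) :
    pderiv (Sum.inl i) (rename (Sum.inr : Fin n → Fin n ⊕ Fin n) q) = 0 := by
  induction q using MvPolynomial.induction_on with
  | C a => simp
  | add p q hp hq => simp [hp, hq]
  | mul_X p j hp => rw [map_mul, pderiv_mul, hp, rename_X, pderiv_X_of_ne (by simp)]; simp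

theorem weylAct_polyY (q : MvPolynomial (Fin n) ℂ) (T : Finset (Fin n)) :
    weylAct n (polyY n q) (Pi.single T 1) = Pi.single T (rename Sum.inr q) := by
  induction q using MvPolynomial.induction_on with
  | C a =>
    rw [← algebraMap_eq, AlgHom.commutes, AlgHom.commutes, AlgHom.commutes]
    funext S
    by_cases h : S = T
    · subst h; simp [Algebra.smul_def, Module.algebraMap_end_apply]
    · simp [h, Module.algebraMap_end_apply]
  | add p q hp hq => simp only [map_add, LinearMap.add_apply, hp, hq, Pi.single_add]
  | mul_X p j hp =>
    rw [mul_comm p, map_mul, map_mul, Module.End.mul_apply, hp, polyY, commLift_X, weylAct_wy]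
    funext S
    by_cases h : S = T
    · subst h
      simp [yOp, pderiv_inl_rename_inr]
    · simp [yOp, h]

/-- The normally ordered monomials span, and their symbols are pairwise distinct members of a basis
of `Symb n`. A linear map sending a spanning family to an independent one is injective. -/
theorem symbol_injective : Function.Injective (symbol n) := by
  let f : ((Fin n →₀ ℕ) × (Fin n →₀ ℕ)) × {l : List (Fin n) // l.Pairwise (· < ·)} → WC n :=
    fun q => (polyX n (MvPolynomial.monomial q.1.1 1) * polyY n (MvPolynomial.monomial q.1.2 1))
      ⊗ₜ[ℂ] (q.2.1.map ce).prod
  let g : ((Fin n →₀ ℕ) × (Fin n →₀ ℕ)) × {l : List (Fin n) // l.Pairwise (· < ·)} →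
      (Σ _ : Finset (Fin n), (Fin n ⊕ Fin n →₀ ℕ)) :=
    fun q => ⟨q.2.1.toFinset, q.1.1.mapDomain Sum.inl + q.1.2.mapDomain Sum.inr⟩
  have hfspan : Submodule.span ℂ (Set.range f) = ⊤ := by
    rw [eq_top_iff, ← TensorProduct.map₂_mk_top_top_eq_top, ← span_polyX_mul_polyY,
      ← span_ce_prod, Submodule.map₂_span_span, Submodule.span_le]
    rintro _ ⟨_, ⟨q, rfl⟩, _, ⟨l, rfl⟩, rfl⟩
    exact Submodule.subset_span ⟨(q, l), rfl⟩
  have hfg : ∀ q, symbol n (f q)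
      = Pi.basis (fun _ : Finset (Fin n) => basisMonomials (Fin n ⊕ Fin n) ℂ) (g q) := by
    intro q
    rw [symbol_apply, act_tmul, Module.End.mul_apply, cliffAct_prod _ q.2.2, map_mul,
      Module.End.mul_apply, weylAct_polyY, weylAct_polyX, Pi.basis_apply]
    funext S
    by_cases h : S = q.2.1.toFinset
    · subst h
      simp [g, rename_monomial, monomial_mul]
    · simp [g, h]
  have hg : Function.Injective g := by
    rintro ⟨⟨a, b⟩, l, hl⟩ ⟨⟨a', b'⟩, l', hl'⟩ h
    simp only [g, Sigma.mk.injEq, heq_eq_eq] at h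
    obtain ⟨h1, h2⟩ := h
    have ha : a = a' := by
      ext i
      have := DFunLike.congr_fun h2 (Sum.inl i)
      simpa [Finsupp.mapDomain_apply Sum.inl_injective, Finsupp.mapDomain_of_notMem_range] using this
    have hb : b = b' := by
      ext i
      have := DFunLike.congr_fun h2 (Sum.inr i)
      simpa [Finsupp.mapDomain_apply Sum.inr_injective, Finsupp.mapDomain_of_notMem_range] using this
    have hll : l = l' := by
      have nd {l : List (Fin n)} (h : l.Pairwise (· < ·)) : l.Nodup := h.imp (fun h => h.ne)
      refine List.Perm.eq_of_pairwise (le := (· < ·)) ?_ hl hl' ?_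
      · intro a b _ _ h1 h2; exact absurd h1 h2.not_gt
      · exact List.perm_of_nodup_nodup_toFinset_eq (nd hl) (nd hl') h1
    subst ha hb hll; rfl
  have hli : LinearIndependent ℂ (symbol n ∘ f) := by
    rw [show symbol n ∘ f = _ ∘ g from funext hfg]
    exact (Module.Basis.linearIndependent _).comp g hg
  rw [injective_iff_map_eq_zero]
  intro a ha
  have : a ∈ Submodule.span ℂ (Set.range f) := hfspan ▸ Submodule.mem_top
  obtain ⟨c, rfl⟩ := (Finsupp.mem_span_range_iff_exists_finsupp).1 this
  have hc : Finsupp.linearCombination ℂ (symbol n ∘ f) c = 0 := by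
    rw [← ha, Finsupp.linearCombination_apply, Finsupp.sum, Finsupp.sum, map_sum]
    simp
  rw [(linearIndependent_iff.1 hli) c hc]; simp

end TAMA

end

noncomputable section

namespace TAMA

open MvPolynomial

variable {n : ℕ}

/-! ### The grading of symbols by total degree -/

/-- The homogeneous component of degree `j` of a polynomial (zero for negative `j`). -/
def homComp (j : ℤ) : Poly n →ₗ[ℂ] Poly n :=
  weightedHomogeneousComponent (fun _ => (1 : ℤ)) j

theorem coeff_homComp (j : ℤ) (f : Poly n) (m : Fin n ⊕ Fin n →₀ ℕ) :
    coeff m (homComp j f) = if Finsupp.weight (fun _ => (1 : ℤ)) m = j then coeff m f else 0 :=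
  coeff_weightedHomogeneousComponent _ _ _

theorem weight_one_nonneg (m : Fin n ⊕ Fin n →₀ ℕ) :
    0 ≤ Finsupp.weight (fun _ => (1 : ℤ)) m := by
  rw [Finsupp.weight_apply, Finsupp.sum]
  exact Finset.sum_nonneg fun i _ => by simp

theorem homComp_X_mul (j : ℤ) (v : Fin n ⊕ Fin n) (f : Poly n) :
    homComp (j + 1) (MvPolynomial.X v * f) = MvPolynomial.X v * homComp j f := by
  ext m
  rw [coeff_homComp, coeff_X_mul', coeff_X_mul', coeff_homComp]
  by_cases h : v ∈ m.support
  · have hm : m = (m - Finsupp.single v 1) + Finsupp.single v 1 := by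
      rw [tsub_add_cancel_of_le]
      rw [Finsupp.single_le_iff]
      exact Nat.one_le_iff_ne_zero.2 (Finsupp.mem_support_iff.1 h)
    have hw : Finsupp.weight (fun _ => (1 : ℤ)) m
        = Finsupp.weight (fun _ => (1 : ℤ)) (m - Finsupp.single v 1) + 1 := by
      conv_lhs => rw [hm]
      rw [map_add, Finsupp.weight_single]; simp
    simp [h, hw]
  · simp [h]

theorem homComp_pderiv (j : ℤ) (v : Fin n ⊕ Fin n) (f : Poly n) :
    homComp (j - 1) (pderiv v f) = pderiv v (homComp j f) := by
  ext m
  rw [coeff_homComp, coeff_pderiv, coeff_pderiv, coeff_homComp, map_add, Finsupp.weight_single]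
  by_cases h : Finsupp.weight (fun _ => (1 : ℤ)) m = j - 1
  · have : Finsupp.weight (fun _ => (1 : ℤ)) m + 1 = j := by omega
    simp [h]
  · have : ¬ Finsupp.weight (fun _ => (1 : ℤ)) m + 1 = j := by omega
    simp [h, this]

/-- The homogeneous component of total degree `k` of a symbol; each `e_i` has degree one. -/
def comp (k : ℤ) : Module.End ℂ (Symb n) where
  toFun F S := homComp (k - S.card) (F S)
  map_add' F G := by funext S; simp
  map_smul' c F := by funext S; simp

theorem comp_apply (k : ℤ) (F : Symb n) (S : Finset (Fin n)) :
    comp k F S = homComp (k - S.card) (F S) := rfl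

theorem comp_of_neg {k : ℤ} (hk : k < 0) (F : Symb n) : comp k F = 0 := by
  funext S
  ext m
  rw [comp_apply, coeff_homComp, if_neg, Pi.zero_apply, coeff_zero]
  have := weight_one_nonneg m
  omega

theorem eq_zero_of_comp {F : Symb n} (h : ∀ k, comp k F = 0) : F = 0 := by
  funext S
  ext m
  have := congrArg (coeff m) (congrFun (h (Finsupp.weight (fun _ => (1 : ℤ)) m + S.card)) S)
  rw [comp_apply, coeff_homComp, if_pos (by ring)] at this
  simpa using this

theorem exists_comp_bound (F : Symb n) : ∃ d : ℕ, ∀ k : ℤ, d ≤ k → comp k F = 0 := by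
  have h (S : Finset (Fin n)) : ∃ d : ℕ, ∀ m ∈ (F S).support,
      Finsupp.weight (fun _ => (1 : ℤ)) m + S.card < d := by
    refine ⟨((F S).support.sup
      fun m => (Finsupp.weight (fun _ => (1 : ℤ)) m + S.card).toNat) + 1, fun m hm => ?_⟩
    have := Finset.le_sup (f := fun m => (Finsupp.weight (fun _ => (1 : ℤ)) m + S.card).toNat) hm
    omega
  choose d hd using h
  refine ⟨Finset.univ.sup d, fun k hk => funext fun S => ?_⟩
  ext m
  rw [comp_apply, coeff_homComp]
  split_ifs with hw
  · by_contra hne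
    have h1 := hd S m (mem_support_iff.2 (by simpa using hne))
    have h2 := Finset.le_sup (f := d) (Finset.mem_univ S)
    omega
  · simp

theorem card_symmDiff_singleton (i : Fin n) (S : Finset (Fin n)) :
    ((symmDiff S {i}).card : ℤ) = S.card + if i ∈ S then -1 else 1 := by
  by_cases h : i ∈ S
  · have : symmDiff S {i} = S.erase i := by
      ext k; rw [mem_symmDiff_singleton]; by_cases hk : k = i <;> simp [hk, h]
    have h2 := Finset.card_erase_add_one h
    rw [this, if_pos h]; omega
  · have : symmDiff S {i} = insert i S := by
      ext k; rw [mem_symmDiff_singleton]; by_cases hk : k = i <;> simp [hk, h]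
    rw [this, Finset.card_insert_of_notMem h, if_neg h]; push_cast; ring

/-! ### Homogeneous operators and leading parts of filtered operators. -/

/-- Homogeneous operators of degree `k`. -/
def IsHom (k : ℤ) (T : Module.End ℂ (Symb n)) : Prop :=
  ∀ (d : ℤ) (F : Symb n), comp (d + k) (T F) = T (comp d F)

theorem isHom_X (v : Fin n ⊕ Fin n) : IsHom 1 (mulOp (MvPolynomial.X v : Poly n)) := by
  intro d F
  funext S
  rw [comp_apply, mulOp_apply, mulOp_apply, comp_apply, ← homComp_X_mul]
  congr 1; ring_nf

theorem isHom_derOp (v : Fin n ⊕ Fin n) : IsHom (-1) (derOp v) := by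
  intro d F
  funext S
  rw [comp_apply, derOp_apply, derOp_apply, comp_apply, ← homComp_pderiv]
  congr 1; ring_nf

theorem isHom_wedge (i : Fin n) : IsHom 1 (wedge i) := by
  intro d F
  funext S
  rw [comp_apply, flipOp_apply, flipOp_apply]
  by_cases h : i ∈ S
  · have := card_symmDiff_singleton i S
    rw [if_pos h] at this
    simp only [h, if_true, map_smul, comp_apply, this]
    congr 3; ring
  · simp [h]

theorem isHom_contr (i : Fin n) : IsHom (-1) (contr i) := by
  intro d F
  funext S
  rw [comp_apply, flipOp_apply, flipOp_apply]
  by_cases h : i ∈ S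
  · simp [h]
  · have := card_symmDiff_singleton i S
    rw [if_neg h] at this
    simp only [h, map_smul, comp_apply, this, Bool.false_eq_true, if_true]
    congr 3; ring

theorem IsHom.mul {k l m : ℤ} {S T : Module.End ℂ (Symb n)} (hS : IsHom k S) (hT : IsHom l T)
    (h : k + l = m) : IsHom m (S * T) := by
  subst h
  intro d F
  rw [Module.End.mul_apply, Module.End.mul_apply, ← hT, ← hS]
  congr 1; ring_nf

theorem IsHom.add {k : ℤ} {S T : Module.End ℂ (Symb n)} (hS : IsHom k S) (hT : IsHom k T) :
    IsHom k (S + T) := by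
  intro d F
  rw [LinearMap.add_apply, LinearMap.add_apply, map_add, hS, hT]

theorem IsHom.smul {k : ℤ} {T : Module.End ℂ (Symb n)} (c : ℂ) (hT : IsHom k T) :
    IsHom k (c • T) := by
  intro d F
  rw [LinearMap.smul_apply, LinearMap.smul_apply, map_smul, hT]

theorem IsHom.sub {k : ℤ} {S T : Module.End ℂ (Symb n)} (hS : IsHom k S) (hT : IsHom k T) :
    IsHom k (S - T) := by
  intro d F
  rw [LinearMap.sub_apply, LinearMap.sub_apply, map_sub, hS, hT]

/-- `T` is an operator of order at most `k`, with leading part `T₀` of degree `k`. -/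
def IsSymb (k : ℤ) (T T₀ : Module.End ℂ (Symb n)) : Prop :=
  ∀ (d : ℤ) (F : Symb n), (∀ e, d < e → comp e F = 0) → ∀ e, d ≤ e →
    comp (e + k) (T F) = T₀ (comp e F)

theorem IsHom.isSymb {k : ℤ} {T : Module.End ℂ (Symb n)} (hT : IsHom k T) : IsSymb k T T :=
  fun _ F _ e _ => hT e F

theorem IsHom.isSymb_zero {j k : ℤ} {T : Module.End ℂ (Symb n)} (hT : IsHom j T) (hjk : j < k) :
    IsSymb k T 0 := by
  intro d F hF e he
  rw [show e + k = (e + k - j) + j by ring, hT, hF _ (by omega)]; simp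

theorem isSymb_one : IsSymb 0 (1 : Module.End ℂ (Symb n)) 1 := by
  intro d F _ e _; simp

/-- The degrees e > d in `IsSymb` say that T F has no component above d + l; this is the bound
needed to apply the hypothesis on S to T F. -/
theorem IsSymb.mul {k l : ℤ} {S S₀ T T₀ : Module.End ℂ (Symb n)} (hS : IsSymb k S S₀)
    (hT : IsSymb l T T₀) : IsSymb (k + l) (S * T) (S₀ * T₀) := by
  intro d F hF e he
  rw [Module.End.mul_apply, Module.End.mul_apply, ← hT d F hF e he,
    ← hS (d + l) (T F) _ (e + l) (by omega)]
  · congr 1; ring_nf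
  · intro e' he'
    have := hT d F hF (e' - l) (by omega)
    rw [sub_add_cancel] at this
    rw [this, hF _ (by omega), map_zero]

theorem IsSymb.add {k : ℤ} {S S₀ T T₀ : Module.End ℂ (Symb n)} (hS : IsSymb k S S₀)
    (hT : IsSymb k T T₀) : IsSymb k (S + T) (S₀ + T₀) := by
  intro d F hF e he
  rw [LinearMap.add_apply, LinearMap.add_apply, map_add, hS d F hF e he, hT d F hF e he]

theorem IsSymb.sub {k : ℤ} {S S₀ T T₀ : Module.End ℂ (Symb n)} (hS : IsSymb k S S₀)
    (hT : IsSymb k T T₀) : IsSymb k (S - T) (S₀ - T₀) := by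
  intro d F hF e he
  rw [LinearMap.sub_apply, LinearMap.sub_apply, map_sub, hS d F hF e he, hT d F hF e he]

theorem IsSymb.smul {k : ℤ} {T T₀ : Module.End ℂ (Symb n)} (c : ℂ) (hT : IsSymb k T T₀) :
    IsSymb k (c • T) (c • T₀) := by
  intro d F hF e he
  rw [LinearMap.smul_apply, LinearMap.smul_apply, map_smul, hT d F hF e he]

theorem IsSymb.sum {ι : Type*} {k : ℤ} (s : Finset ι) {T T₀ : ι → Module.End ℂ (Symb n)}
    (h : ∀ i ∈ s, IsSymb k (T i) (T₀ i)) : IsSymb k (∑ i ∈ s, T i) (∑ i ∈ s, T₀ i) := by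
  intro d F hF e he
  rw [LinearMap.sum_apply, LinearMap.sum_apply, map_sum]
  exact Finset.sum_congr rfl fun i hi => h i hi d F hF e he

theorem isSymb_yOp (i : Fin n) : IsSymb 1 (yOp i) (mulOp (py i)) := by
  simpa [yOp] using (isHom_X (Sum.inr i)).isSymb.add
    ((isHom_derOp (Sum.inl i)).isSymb_zero (k := 1) (by norm_num))

theorem isSymb_gam (i : Fin n) : IsSymb 1 (gam i) (wedge i) := by
  simpa [gam] using (isHom_wedge i).isSymb.add
    ((isHom_contr i).isSymb_zero (k := 1) (by norm_num))

/-- The classical angular momentum `x_i y_j - x_j y_i`. -/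
def pL (i j : Fin n) : Poly n := px i * py j - px j * py i

/-- Multiplication by the classical total angular momentum `x_i y_j - x_j y_i + ½ e_i e_j`. -/
def Z (i j : Fin n) : Module.End ℂ (Symb n) :=
  mulOp (pL i j) + (1 / 2 : ℂ) • (wedge i * wedge j)

theorem act_O (i j : Fin n) : act n (O i j) =
    (mulOp (px i) * yOp j - mulOp (px j) * yOp i) + (1 / 2 : ℂ) • (gam i * gam j) := by
  simp [O]

theorem isSymb_O (i j : Fin n) : IsSymb 2 (act n (O i j)) (Z i j) := by
  rw [act_O, Z, pL, mulOp_sub, ← mulOp_mul, ← mulOp_mul]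
  exact (((isHom_X (Sum.inl i)).isSymb.mul (isSymb_yOp j)).sub
    ((isHom_X (Sum.inl j)).isSymb.mul (isSymb_yOp i))).add
    (((isSymb_gam i).mul (isSymb_gam j)).smul _)

theorem isHom_Z (i j : Fin n) : IsHom 2 (Z i j) := by
  rw [Z, pL, mulOp_sub, ← mulOp_mul, ← mulOp_mul]
  exact (((isHom_X (Sum.inl i)).mul (isHom_X _) (by norm_num)).sub
    ((isHom_X (Sum.inl j)).mul (isHom_X _) (by norm_num))).add
    (((isHom_wedge i).mul (isHom_wedge j) (by norm_num)).smul _)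

/-! ### Right multiplications and the equations defining the centraliser -/

theorem act_commute (r : Module.End ℂ (Symb n)) (hx : ∀ i, Commute (mulOp (px i)) r)
    (hy : ∀ i, Commute (yOp i) r) (he : ∀ i, Commute (gam i) r) (a : WC n) :
    Commute (act n a) r := by
  induction a using TensorProduct.induction_on with
  | zero => rw [map_zero]; exact Commute.zero_left r
  | add a b ha hb => rw [map_add]; exact ha.add_left hb
  | tmul w c =>
    rw [act_tmul]
    refine (commute_of_adjoin_eq_top weyl_adjoin _ _ ?_ w).mul_left
      (commute_of_adjoin_eq_top cliff_adjoin _ _ ?_ c)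
    · rintro _ (⟨i, rfl⟩ | ⟨i, rfl⟩)
      · simpa using hx i
      · simpa using hy i
    · rintro _ ⟨i, rfl⟩
      simpa using he i

/-- Right multiplication by `x_i`. -/
def rightX (i : Fin n) : Module.End ℂ (Symb n) := mulOp (px i) + derOp (Sum.inr i)

/-- Right multiplication by `e_i`. -/
def rightE (i : Fin n) : Module.End ℂ (Symb n) := (wedge i - contr i) * parOp n

theorem pderiv_px_inr (i j : Fin n) : pderiv (Sum.inr j) (px i) = 0 := pderiv_X_of_ne (by simp)

theorem pderiv_py_inl (i j : Fin n) : pderiv (Sum.inl j) (py i) = 0 := pderiv_X_of_ne (by simp)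

theorem act_commute_rightX (a : WC n) (j : Fin n) : Commute (act n a) (rightX j) := by
  refine act_commute _ (fun i => ?_) (fun i => ?_) (fun i => ?_) a
  · refine (mulOp_comm _ _).add_right ?_
    rw [Commute, SemiconjBy, derOp_mulOp, pderiv_px_inr, mulOp_zero, add_zero]
  · rw [Commute, SemiconjBy, rightX, mul_add, add_mul, yOp_mulOp, add_assoc]
    congr 1
    -- Two terms δ_ij arise, from ∂/∂x_i meeting x_j and from ∂/∂y_j meeting y_i; they occur on
    -- opposite sides and cancel.
    have h : mulOp (pderiv (Sum.inl i) (px j)) = mulOp (pderiv (Sum.inr j) (py i)) := by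
      by_cases hij : i = j
      · subst hij; simp
      · rw [pderiv_X_of_ne (by simpa using Ne.symm hij), pderiv_X_of_ne (by simpa using hij)]
    rw [yOp, add_mul, mul_add, derOp_mulOp, ← (derOp_comm (Sum.inl i) (Sum.inr j)).eq, h]
    abel
  · exact ((flipOp_mulOp _ _ _).add_left (flipOp_mulOp _ _ _)).add_right
      ((flipOp_derOp _ _ _).add_left (flipOp_derOp _ _ _))

theorem parOp_gam (i : Fin n) : parOp n * gam i = - (gam i * parOp n) := by
  simp only [gam, mul_add, add_mul, flipOp_parOp]; abel

/-- The operator `wedge j - contr j` anticommutes with every `gam i`; the parity factor turns this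
into commutation. -/
theorem act_commute_rightE (a : WC n) (j : Fin n) : Commute (act n a) (rightE j) := by
  have hm (f : Poly n) : Commute (mulOp f) (rightE j) := by
    have h : Commute (mulOp f) (wedge j - contr j) :=
      Commute.sub_right (flipOp_mulOp j true f).symm (flipOp_mulOp j false f).symm
    exact h.mul_right (parOp_mulOp f).symm
  have hd (v) : Commute (derOp v) (rightE j) := by
    have h : Commute (derOp v) (wedge j - contr j) :=
      Commute.sub_right (flipOp_derOp j true v).symm (flipOp_derOp j false v).symm
    exact h.mul_right (parOp_derOp v).symm
  refine act_commute _ (fun i => hm _) (fun i => (hm _).add_left (hd _)) (fun i => ?_) a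
  have h1 : gam i * (wedge j - contr j) = - ((wedge j - contr j) * gam i) := by
    by_cases hij : i = j
    · subst hij
      have h1 := flipOp_sq i true
      have h2 := flipOp_sq i false
      simp only [gam, add_mul, mul_sub, sub_mul, mul_add, h1, h2]
      abel
    · simp only [gam, add_mul, mul_sub, sub_mul, mul_add, flipOp_anticomm hij]
      abel
  have h2 := parOp_gam i
  rw [Commute, SemiconjBy, rightE, ← mul_assoc, h1, mul_assoc _ (parOp n), h2]
  simp only [Module.End.mul_eq_comp, LinearMap.neg_comp, LinearMap.comp_neg, LinearMap.comp_assoc]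

/-- The bracket with the Dirac operator on classical symbols. -/
def diracOp (n : ℕ) : Module.End ℂ (Symb n) :=
  ∑ j : Fin n, ((2 : ℂ) • (mulOp (py j) * contr j) + derOp (Sum.inl j) * wedge j)

/-- The bracket with the vector variable on classical symbols. -/
def vecOp (n : ℕ) : Module.End ℂ (Symb n) :=
  ∑ j : Fin n, ((2 : ℂ) • (mulOp (px j) * contr j) - derOp (Sum.inr j) * wedge j)

theorem parOp_oneSymb : parOp n (oneSymb n) = oneSymb n := by
  funext S
  by_cases h : S = ∅
  · subst h; simp
  · simp [oneSymb, h]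

theorem contr_oneSymb (i : Fin n) : contr i (oneSymb n) = 0 := by
  funext S
  rw [flipOp_apply]
  have : i ∉ S → symmDiff S {i} ≠ ∅ := fun h h' => by
    have := mem_symmDiff_singleton (i := i) (j := i) (S := S)
    simp [h, h'] at this
  by_cases h : i ∈ S
  · simp [h]
  · simp [h, oneSymb, this h]

theorem derOp_flip_oneSymb (v) (i : Fin n) (b : Bool) : derOp v (flipOp i b (oneSymb n)) = 0 := by
  funext S
  rw [derOp_apply, flipOp_apply]
  split_ifs with h
  · by_cases h : symmDiff S {i} = ∅ <;> simp [oneSymb, h]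
  · simp

theorem rightE_oneSymb (j : Fin n) : rightE j (oneSymb n) = gam j (oneSymb n) := by
  simp [rightE, gam, parOp_oneSymb, contr_oneSymb]

/-- Right multiplications commute with the left action, so they may be applied to the symbol of a
instead of to 1. In normal order y stands rightmost, hence right multiplication by y_j is plain
multiplication. -/
theorem symbol_mul_dirac (a : WC n) :
    symbol n (a * dirac n) = ∑ j, mulOp (py j) (rightE j (symbol n a)) := by
  rw [symbol_apply, map_mul, Module.End.mul_apply, dirac, map_sum, LinearMap.sum_apply, map_sum]
  refine Finset.sum_congr rfl fun j _ => ?_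
  have hm : Commute (act n a) (mulOp (py j)) := by
    refine act_commute _ (fun i => mulOp_comm _ _) (fun i => ?_) (fun i => ?_) a
    · rw [Commute, SemiconjBy, yOp_mulOp, pderiv_py_inl, mulOp_zero, add_zero]
    · exact (flipOp_mulOp _ _ _).add_left (flipOp_mulOp _ _ _)
  have h1 : act n (wy j ⊗ₜ[ℂ] ce j) (oneSymb n) = (mulOp (py j) * rightE j) (oneSymb n) := by
    rw [act_tmul, Module.End.mul_apply, Module.End.mul_apply, rightE_oneSymb, weylAct_wy,
      cliffAct_ce, yOp, LinearMap.add_apply, gam, LinearMap.add_apply, contr_oneSymb, add_zero,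
      derOp_flip_oneSymb, add_zero]
  rw [h1, ← Module.End.mul_apply, (hm.mul_right (act_commute_rightE a j)).eq]
  rfl

theorem symbol_mul_vecVar (a : WC n) :
    symbol n (a * vecVar n) = ∑ j, rightX j (rightE j (symbol n a)) := by
  rw [symbol_apply, map_mul, Module.End.mul_apply, vecVar, map_sum, LinearMap.sum_apply, map_sum]
  refine Finset.sum_congr rfl fun j _ => ?_
  have h1 : act n (wx j ⊗ₜ[ℂ] ce j) (oneSymb n) = (rightX j * rightE j) (oneSymb n) := by
    rw [act_tmul, Module.End.mul_apply, Module.End.mul_apply, rightE_oneSymb, weylAct_wx,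
      cliffAct_ce, rightX, LinearMap.add_apply, gam, LinearMap.add_apply, contr_oneSymb, add_zero,
      derOp_flip_oneSymb, add_zero]
  rw [h1, ← Module.End.mul_apply, ((act_commute_rightX a j).mul_right (act_commute_rightE a j)).eq]
  rfl

/-- In the difference of left and right multiplication by y_j ⊗ e_j on an even symbol, the products
of y_j with wedges cancel and those with contractions double. The sum displayed next to `diracOp` is
the part of degree −2. -/
theorem diracOp_add_apply {a : WC n} (h : a * dirac n = dirac n * a)
    (hp : parOp n (symbol n a) = symbol n a) :
    (diracOp n + ∑ j : Fin n, derOp (Sum.inl j) * contr j : Module.End ℂ (Symb n)) (symbol n a) = 0 := by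
  have h1 := symbol_mul_dirac a
  rw [h, symbol_apply, map_mul, Module.End.mul_apply, ← symbol_apply, dirac, map_sum,
    LinearMap.sum_apply, ← sub_eq_zero, ← Finset.sum_sub_distrib] at h1
  rw [← h1, diracOp, ← Finset.sum_add_distrib, LinearMap.sum_apply]
  refine Finset.sum_congr rfl fun j _ => ?_
  simp only [act_tmul, weylAct_wy, cliffAct_ce, rightE, yOp, gam, Module.End.mul_apply, hp,
    LinearMap.add_apply, LinearMap.sub_apply, map_add, map_sub, two_smul]
  abel

theorem vecOp_add_apply {a : WC n} (h : a * vecVar n = vecVar n * a)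
    (hp : parOp n (symbol n a) = symbol n a) :
    (vecOp n + ∑ j : Fin n, derOp (Sum.inr j) * contr j : Module.End ℂ (Symb n)) (symbol n a) = 0 := by
  have h1 := symbol_mul_vecVar a
  rw [h, symbol_apply, map_mul, Module.End.mul_apply, ← symbol_apply, vecVar, map_sum,
    LinearMap.sum_apply, ← sub_eq_zero, ← Finset.sum_sub_distrib] at h1
  rw [← h1, vecOp, ← Finset.sum_add_distrib, LinearMap.sum_apply]
  refine Finset.sum_congr rfl fun j _ => ?_
  simp only [act_tmul, weylAct_wx, cliffAct_ce, rightE, rightX, gam, Module.End.mul_apply, hp,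
    LinearMap.add_apply, LinearMap.sub_apply, map_add, map_sub, two_smul]
  abel

theorem isSymb_diracOp_add :
    IsSymb 0 (diracOp n + ∑ j, derOp (Sum.inl j) * contr j) (diracOp n) := by
  have h1 : IsSymb 0 (diracOp n) (diracOp n) := by
    refine IsSymb.sum _ fun j _ => IsHom.isSymb ?_
    have h1 : IsHom 0 (mulOp (py j) * contr j) := (isHom_X (Sum.inr j)).mul (isHom_contr j) (by norm_num)
    have h2 : IsHom 0 (derOp (Sum.inl j) * wedge j) :=
      (isHom_derOp (Sum.inl j)).mul (isHom_wedge j) (by norm_num)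
    exact (h1.smul 2).add h2
  have h2 : IsSymb 0 (∑ j : Fin n, derOp (Sum.inl j) * contr j)
      (∑ j : Fin n, (0 : Module.End ℂ (Symb n))) :=
    IsSymb.sum _ fun j _ => ((isHom_derOp _).mul (isHom_contr j) rfl).isSymb_zero (by norm_num)
  simpa using h1.add h2

theorem isSymb_vecOp_add :
    IsSymb 0 (vecOp n + ∑ j, derOp (Sum.inr j) * contr j) (vecOp n) := by
  have h1 : IsSymb 0 (vecOp n) (vecOp n) := by
    refine IsSymb.sum _ fun j _ => IsHom.isSymb ?_
    have h1 : IsHom 0 (mulOp (px j) * contr j) := (isHom_X (Sum.inl j)).mul (isHom_contr j) (by norm_num)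
    have h2 : IsHom 0 (derOp (Sum.inr j) * wedge j) :=
      (isHom_derOp (Sum.inr j)).mul (isHom_wedge j) (by norm_num)
    exact (h1.smul 2).sub h2
  have h2 : IsSymb 0 (∑ j : Fin n, derOp (Sum.inr j) * contr j)
      (∑ j : Fin n, (0 : Module.End ℂ (Symb n))) :=
    IsSymb.sum _ fun j _ => ((isHom_derOp _).mul (isHom_contr j) rfl).isSymb_zero (by norm_num)
  simpa using h1.add h2

theorem parity_of_mem_evenWC {a : WC n} (ha : a ∈ evenWC n) : parity n a = a := by
  obtain ⟨b, rfl⟩ := ha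
  change parity n (Algebra.TensorProduct.map _ _ b) = Algebra.TensorProduct.map _ _ b
  induction b using TensorProduct.induction_on with
  | zero => simp
  | add a b ha hb => simp only [map_add, ha, hb]
  | tmul w c => simp [parity, CliffordAlgebra.involute_eq_of_mem_even c.2]

/-- The parity operator on symbols implements the parity automorphism, as it commutes with x and y
and anticommutes with the Clifford generators. -/
theorem parOp_act (a : WC n) : parOp n * act n a = act n (parity n a) * parOp n := by
  induction a using TensorProduct.induction_on with
  | zero => simp
  | add a b ha hb => simp only [map_add, mul_add, add_mul, ha, hb]
  | tmul w c =>
    have hw : Commute (weylAct n w) (parOp n) := by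
      refine commute_of_adjoin_eq_top weyl_adjoin _ _ ?_ w
      rintro _ (⟨i, rfl⟩ | ⟨i, rfl⟩)
      · simpa using (parOp_mulOp _).symm
      · simpa [yOp] using (parOp_mulOp _).symm.add_left (parOp_derOp _).symm
    have hc : parOp n * cliffAct n c = cliffAct n (CliffordAlgebra.involute c) * parOp n := by
      have hc : c ∈ Algebra.adjoin ℂ (Set.range ce) := cliff_adjoin ▸ Algebra.mem_top
      induction hc using Algebra.adjoin_induction with
      | mem x hx =>
        obtain ⟨i, rfl⟩ := hx
        have : CliffordAlgebra.involute (ce i) = - ce i := CliffordAlgebra.involute_ι _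
        rw [this, map_neg, cliffAct_ce, parOp_gam]
        rw [Module.End.mul_eq_comp, Module.End.mul_eq_comp, LinearMap.neg_comp]
      | algebraMap r => simp only [AlgHom.commutes]; exact (Algebra.commutes r _).symm
      | add x y _ _ hx hy => simp only [map_add, mul_add, add_mul, hx, hy]
      | mul x y _ _ hx hy => simp only [map_mul]; rw [← mul_assoc, hx, mul_assoc, hy, mul_assoc]
    rw [act_tmul, ← mul_assoc, ← hw.eq, mul_assoc, hc, parity, Algebra.TensorProduct.map_tmul,
      act_tmul, mul_assoc]
    rfl

theorem parOp_symbol {a : WC n} (ha : a ∈ evenWC n) : parOp n (symbol n a) = symbol n a := by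
  rw [symbol_apply, ← Module.End.mul_apply, parOp_act, parity_of_mem_evenWC ha,
    Module.End.mul_apply, parOp_oneSymb]

end TAMA

end

noncomputable section

namespace TAMA

open MvPolynomial

variable {n : ℕ}

/-! ### Polynomials in the classical total angular momenta -/

theorem wedge_wedge (i j : Fin n) (F : Symb n) : wedge i (wedge j F) = - wedge j (wedge i F) := by
  by_cases h : i = j
  · subst h
    have := LinearMap.congr_fun (flipOp_sq i true) F
    rw [Module.End.mul_apply, LinearMap.zero_apply] at this
    rw [this, neg_zero]
  · exact LinearMap.congr_fun (flipOp_anticomm h true true) F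

theorem contr_contr (i j : Fin n) (F : Symb n) : contr i (contr j F) = - contr j (contr i F) := by
  by_cases h : i = j
  · subst h
    have := LinearMap.congr_fun (flipOp_sq i false) F
    rw [Module.End.mul_apply, LinearMap.zero_apply] at this
    rw [this, neg_zero]
  · exact LinearMap.congr_fun (flipOp_anticomm h false false) F

theorem contr_wedge (i j : Fin n) (F : Symb n) :
    contr i (wedge j F) = (if i = j then F else 0) - wedge j (contr i F) := by
  by_cases h : i = j
  · subst h
    have := LinearMap.congr_fun (wedge_contr_add i) F
    rw [LinearMap.add_apply, Module.End.mul_apply, Module.End.mul_apply,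
      Module.End.one_apply] at this
    rw [if_pos rfl, eq_sub_iff_add_eq, add_comm, this]
  · rw [if_neg h, zero_sub]
    exact LinearMap.congr_fun (flipOp_anticomm h false true) F

theorem flipOp_mulOp_apply (i : Fin n) (b : Bool) (f : Poly n) (F : Symb n) :
    flipOp i b (mulOp f F) = mulOp f (flipOp i b F) := LinearMap.congr_fun (flipOp_mulOp i b f) F

theorem derOp_flipOp_apply (i : Fin n) (b : Bool) (v) (F : Symb n) :
    derOp v (flipOp i b F) = flipOp i b (derOp v F) :=
  (LinearMap.congr_fun (flipOp_derOp i b v) F).symm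

theorem derOp_mulOp_apply (v) (f : Poly n) (F : Symb n) :
    derOp v (mulOp f F) = mulOp f (derOp v F) + mulOp (pderiv v f) F :=
  LinearMap.congr_fun (derOp_mulOp v f) F

theorem mulOp_comm_apply (f g : Poly n) (F : Symb n) :
    mulOp f (mulOp g F) = mulOp g (mulOp f F) := LinearMap.congr_fun (mulOp_comm f g) F

theorem Z_apply (i j : Fin n) (F : Symb n) :
    Z i j F = mulOp (pL i j) F + (1 / 2 : ℂ) • wedge i (wedge j F) := rfl

theorem Z_comm (i j k l : Fin n) : Commute (Z i j) (Z k l) := by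
  have hw (i j k l : Fin n) (F : Symb n) :
      wedge i (wedge j (wedge k (wedge l F))) = wedge k (wedge l (wedge i (wedge j F))) := by
    rw [wedge_wedge j k, map_neg, wedge_wedge i k, neg_neg, wedge_wedge j l, map_neg,
      wedge_wedge i l, neg_neg]
  refine LinearMap.ext fun F => ?_
  simp only [Module.End.mul_apply, Z_apply, map_add, map_smul, flipOp_mulOp_apply]
  rw [hw i j k l, mulOp_comm_apply (pL i j)]
  module

/-- Evaluation of a polynomial at the commuting operators `Z`. -/
def polyZ (n : ℕ) : MvPolynomial (Chord n) ℂ →ₐ[ℂ] Module.End ℂ (Symb n) :=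
  commLift (fun c : Chord n => Z c.1.1 c.1.2) (fun _ _ => Z_comm _ _ _ _)

@[simp] theorem polyZ_X (c : Chord n) : polyZ n (MvPolynomial.X c) = Z c.1.1 c.1.2 :=
  commLift_X _ _ _

/-- Evaluation of a polynomial at the classical angular momenta. -/
def polyL (n : ℕ) : MvPolynomial (Chord n) ℂ →ₐ[ℂ] Poly n :=
  aeval (fun c : Chord n => pL c.1.1 c.1.2)

@[simp] theorem polyL_X (c : Chord n) : polyL n (MvPolynomial.X c) = pL c.1.1 c.1.2 :=
  aeval_X _ _

theorem wedge_wedge_empty (i j : Fin n) (F : Symb n) : wedge i (wedge j F) ∅ = 0 := by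
  simp [flipOp_apply]

theorem pair_symmDiff_left {i j : Fin n} (h : i ≠ j) : symmDiff {i, j} {i} = ({j} : Finset _) := by
  ext k; rw [mem_symmDiff_singleton]; grind

theorem pair_symmDiff_right {i j : Fin n} (h : i ≠ j) : symmDiff {i, j} {j} = ({i} : Finset _) := by
  ext k; rw [mem_symmDiff_singleton]; grind

theorem wedge_wedge_pair {a b i j : Fin n} (hab : a < b) (hij : i < j) (F : Symb n) :
    wedge a (wedge b F) {i, j} = if a = i ∧ b = j then F ∅ else 0 := by
  rw [flipOp_apply]
  have s1 : sgn i {i, j} = 1 := by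
    rw [sgn, Finset.filter_eq_empty_iff.2]
    · simp
    · intro k hk; simp only [Finset.mem_insert, Finset.mem_singleton] at hk
      rcases hk with rfl | rfl
      · exact lt_irrefl _
      · exact hij.not_gt
  have s2 : sgn j {j} = 1 := by
    rw [sgn, Finset.filter_eq_empty_iff.2]
    · simp
    · intro k hk; simp only [Finset.mem_singleton] at hk
      subst hk; exact lt_irrefl _
  by_cases h1 : a = i
  · subst h1
    rw [pair_symmDiff_left hij.ne, flipOp_apply, s1]
    by_cases h2 : b = j
    · subst h2; simp [s2]
    · simp [h2]
  · by_cases h2 : a = j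
    · subst h2
      rw [pair_symmDiff_right hij.ne, flipOp_apply]
      have : b ≠ i := by rintro rfl; exact absurd hab hij.not_gt
      simp [this, h1]
    · simp [h1, h2]

/-- The nilpotent part ½ e_i e_j of Z_ij never reaches the coefficient at ∅. -/
theorem polyZ_apply_empty (p : MvPolynomial (Chord n) ℂ) (F : Symb n) :
    polyZ n p F ∅ = polyL n p * F ∅ := by
  induction p using MvPolynomial.induction_on generalizing F with
  | C a =>
    rw [← algebraMap_eq, AlgHom.commutes, AlgHom.commutes]
    simp [Algebra.smul_def, Module.algebraMap_end_apply]
  | add p q hp hq => simp only [map_add, LinearMap.add_apply, Pi.add_apply, hp, hq, add_mul]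
  | mul_X p c hp =>
    rw [map_mul, Module.End.mul_apply, hp, map_mul, polyZ_X, polyL_X, Z_apply, Pi.add_apply,
      Pi.smul_apply, wedge_wedge_empty, mulOp_apply]
    simp [mul_assoc]

/-- This is the first-order Taylor expansion of p at L with increments ½ e_i e_j: a product of two
increments contains no single pair. -/
theorem polyZ_apply_pair (p : MvPolynomial (Chord n) ℂ) (F : Symb n) (c : Chord n) :
    polyZ n p F {c.1.1, c.1.2} = polyL n p * F {c.1.1, c.1.2}
      + (1 / 2 : ℂ) • (polyL n (pderiv c p) * F ∅) := by
  induction p using MvPolynomial.induction_on generalizing F with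
  | C a =>
    rw [pderiv_C, ← algebraMap_eq, AlgHom.commutes, AlgHom.commutes]
    simp [Algebra.smul_def, Module.algebraMap_end_apply]
  | add p q hp hq =>
    simp only [map_add, LinearMap.add_apply, Pi.add_apply, hp, hq, add_mul, smul_add]; abel
  | mul_X p d hp =>
    rw [map_mul, Module.End.mul_apply, hp, map_mul, polyZ_X, polyL_X, Z_apply, Pi.add_apply,
      Pi.smul_apply, wedge_wedge_pair d.2 c.2, mulOp_apply, pderiv_mul, map_add, map_mul, map_mul,
      polyL_X, Pi.add_apply, Pi.smul_apply, wedge_wedge_empty, mulOp_apply]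
    by_cases h : d = c
    · subst h
      simp only [and_self, if_true, pderiv_X_self, map_one, smul_zero, add_zero, mul_add, add_mul,
        smul_add, mul_smul_comm, mul_one, mul_assoc]
      rw [add_assoc, add_comm ((1 / 2 : ℂ) • _)]
    · have h' : ¬ (d.1.1 = c.1.1 ∧ d.1.2 = c.1.2) := fun h'' =>
        h (Subtype.ext (Prod.ext h''.1 h''.2))
      rw [if_neg h', pderiv_X_of_ne h]
      simp [mul_assoc]

theorem oneSymb_empty : oneSymb n ∅ = 1 := by simp [oneSymb]

theorem oneSymb_of_ne {S : Finset (Fin n)} (h : S ≠ ∅) : oneSymb n S = 0 := by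
  simp [oneSymb, h]

/-! ### Compatibility of the odd brackets with the operators `Z` -/

theorem contr_wedge_wedge (k i j : Fin n) (F : Symb n) :
    contr k (wedge i (wedge j F)) = wedge i (wedge j (contr k F))
      + ((if k = i then wedge j F else 0) - (if k = j then wedge i F else 0)) := by
  rw [contr_wedge, contr_wedge, map_sub, apply_ite (wedge i), map_zero]
  abel

theorem pderiv_inl_pL (k i j : Fin n) : pderiv (Sum.inl k) (pL i j)
    = (if k = i then py j else 0) - (if k = j then py i else 0) := by
  rw [pL, map_sub, pderiv_mul, pderiv_mul, pderiv_py_inl, pderiv_py_inl]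
  by_cases h1 : k = i <;> by_cases h2 : k = j <;>
    simp [h1, h2, pderiv_X, Pi.single_apply, eq_comm]

theorem pderiv_inr_pL (k i j : Fin n) : pderiv (Sum.inr k) (pL i j)
    = (if k = j then px i else 0) - (if k = i then px j else 0) := by
  rw [pL, map_sub, pderiv_mul, pderiv_mul, pderiv_px_inr, pderiv_px_inr]
  by_cases h1 : k = i <;> by_cases h2 : k = j <;>
    simp [h1, h2, pderiv_X, Pi.single_apply, eq_comm]

theorem diracOp_apply (F : Symb n) : diracOp n F = ∑ j : Fin n,
    ((2 : ℂ) • mulOp (py j) (contr j F) + derOp (Sum.inl j) (wedge j F)) := by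
  rw [diracOp, LinearMap.sum_apply]; rfl

theorem vecOp_apply (F : Symb n) : vecOp n F = ∑ j : Fin n,
    ((2 : ℂ) • mulOp (px j) (contr j F) - derOp (Sum.inr j) (wedge j F)) := by
  rw [vecOp, LinearMap.sum_apply]; rfl

theorem wedge_three (k i j : Fin n) (F : Symb n) :
    wedge k (wedge i (wedge j F)) = wedge i (wedge j (wedge k F)) := by
  rw [wedge_wedge k i, wedge_wedge k j, map_neg, neg_neg]

theorem diracOp_Z (i j : Fin n) : Commute (diracOp n) (Z i j) := by
  refine LinearMap.ext fun F => ?_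
  rw [Module.End.mul_apply, Module.End.mul_apply, diracOp_apply, diracOp_apply, map_sum,
    ← sub_eq_zero, ← Finset.sum_sub_distrib]
  -- The individual summands do not commute with Z_ij. Their defects at k = i and k = j cancel only
  -- in the sum, the factor 2 before the contraction being matched to the ½ in Z_ij.
  have h (k : Fin n) : (2 : ℂ) • mulOp (py k) (contr k (Z i j F)) + derOp (Sum.inl k) (wedge k (Z i j F))
      - Z i j ((2 : ℂ) • mulOp (py k) (contr k F) + derOp (Sum.inl k) (wedge k F))
      = ((if k = i then mulOp (py k) (wedge j F) else 0)
          - (if k = j then mulOp (py k) (wedge i F) else 0))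
        + ((if k = i then mulOp (py j) (wedge k F) else 0)
          - (if k = j then mulOp (py i) (wedge k F) else 0)) := by
    simp only [Z_apply, map_add, map_smul, flipOp_mulOp_apply, derOp_mulOp_apply,
      derOp_flipOp_apply, contr_wedge_wedge, wedge_three k i j, pderiv_inl_pL, mulOp_sub,
      LinearMap.sub_apply, mulOp_comm_apply (pL i j), smul_add, map_sub, apply_ite (mulOp (py k)),
      map_zero, apply_ite mulOp, mulOp_zero, smul_smul, smul_sub]
    norm_num
    split_ifs <;> simp <;> abel
  simp_rw [h]
  simp [Finset.sum_add_distrib, Finset.sum_sub_distrib]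

theorem vecOp_Z (i j : Fin n) : Commute (vecOp n) (Z i j) := by
  refine LinearMap.ext fun F => ?_
  rw [Module.End.mul_apply, Module.End.mul_apply, vecOp_apply, vecOp_apply, map_sum,
    ← sub_eq_zero, ← Finset.sum_sub_distrib]
  have h (k : Fin n) : (2 : ℂ) • mulOp (px k) (contr k (Z i j F)) - derOp (Sum.inr k) (wedge k (Z i j F))
      - Z i j ((2 : ℂ) • mulOp (px k) (contr k F) - derOp (Sum.inr k) (wedge k F))
      = ((if k = i then mulOp (px k) (wedge j F) else 0)
          - (if k = j then mulOp (px k) (wedge i F) else 0))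
        - ((if k = j then mulOp (px i) (wedge k F) else 0)
          - (if k = i then mulOp (px j) (wedge k F) else 0)) := by
    simp only [Z_apply, map_add, map_smul, flipOp_mulOp_apply, derOp_mulOp_apply,
      derOp_flipOp_apply, contr_wedge_wedge, wedge_three k i j, pderiv_inr_pL, mulOp_sub,
      LinearMap.sub_apply, mulOp_comm_apply (pL i j), smul_add, map_sub, apply_ite (mulOp (px k)),
      map_zero, apply_ite mulOp, mulOp_zero, smul_smul, smul_sub]
    norm_num
    split_ifs <;> simp <;> abel
  simp_rw [h]
  simp [Finset.sum_sub_distrib]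

theorem commute_polyZ {T : Module.End ℂ (Symb n)} (h : ∀ i j, Commute T (Z i j))
    (p : MvPolynomial (Chord n) ℂ) : Commute T (polyZ n p) := by
  induction p using MvPolynomial.induction_on with
  | C a => rw [← algebraMap_eq, AlgHom.commutes]; exact (Algebra.commutes a T).symm
  | add p q hp hq => rw [map_add]; exact hp.add_right hq
  | mul_X p c hp => rw [map_mul, polyZ_X]; exact hp.mul_right (h _ _)

theorem parOp_Z (i j : Fin n) : Commute (parOp n) (Z i j) := by
  refine (parOp_mulOp _).add_right (Commute.smul_right ?_ _)
  refine LinearMap.ext fun F => ?_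
  have h (i : Fin n) (F : Symb n) : parOp n (wedge i F) = - wedge i (parOp n F) :=
    LinearMap.congr_fun (flipOp_parOp i true) F
  simp only [Module.End.mul_apply, h, map_neg, neg_neg]

theorem diracOp_oneSymb : diracOp n (oneSymb n) = 0 := by
  rw [diracOp_apply]
  exact Finset.sum_eq_zero fun j _ => by rw [contr_oneSymb, derOp_flip_oneSymb]; simp

theorem vecOp_oneSymb : vecOp n (oneSymb n) = 0 := by
  rw [vecOp_apply]
  exact Finset.sum_eq_zero fun j _ => by rw [contr_oneSymb, derOp_flip_oneSymb]; simp

/-- Even symbols annihilated by both odd brackets. -/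
def invariants (n : ℕ) : Submodule ℂ (Symb n) :=
  LinearMap.ker (diracOp n) ⊓ LinearMap.ker (vecOp n) ⊓ LinearMap.ker (parOp n - 1)

theorem mem_invariants {F : Symb n} :
    F ∈ invariants n ↔ diracOp n F = 0 ∧ vecOp n F = 0 ∧ parOp n F = F := by
  simp [invariants, sub_eq_zero, and_assoc]

theorem polyZ_mem_invariants (p : MvPolynomial (Chord n) ℂ) {F : Symb n} (hF : F ∈ invariants n) :
    polyZ n p F ∈ invariants n := by
  rw [mem_invariants] at hF ⊢
  refine ⟨?_, ?_, ?_⟩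
  · rw [← Module.End.mul_apply, (commute_polyZ diracOp_Z p).eq, Module.End.mul_apply, hF.1, map_zero]
  · rw [← Module.End.mul_apply, (commute_polyZ vecOp_Z p).eq, Module.End.mul_apply, hF.2.1, map_zero]
  · rw [← Module.End.mul_apply, (commute_polyZ parOp_Z p).eq, Module.End.mul_apply, hF.2.2]

theorem oneSymb_mem_invariants : oneSymb n ∈ invariants n :=
  mem_invariants.2 ⟨diracOp_oneSymb, vecOp_oneSymb, parOp_oneSymb⟩

/-! ### Squares of the odd brackets. -/

theorem sum_sum_of_anticomm (t : Fin n → Module.End ℂ (Symb n)) (F : Symb n)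
    (h : ∀ i j, i ≠ j → t i (t j F) + t j (t i F) = 0) :
    ∑ i, t i (∑ j, t j F) = ∑ i, t i (t i F) := by
  have h1 : ∑ i, t i (∑ j, t j F) = ∑ i, ∑ j, t i (t j F) := by simp only [map_sum]
  have h2 : ∑ i, t i (∑ j, t j F) = ∑ i, ∑ j, t j (t i F) := by rw [h1, Finset.sum_comm]
  have h3 : (2 : ℂ) • ∑ i, t i (∑ j, t j F) = (2 : ℂ) • ∑ i, t i (t i F) := by
    rw [two_smul, Finset.smul_sum]
    nth_rw 1 [h1]
    rw [h2]
    simp_rw [← Finset.sum_add_distrib]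
    refine Finset.sum_congr rfl fun i _ => ?_
    rw [Finset.sum_eq_single i, two_smul]
    · intro j _ hj; exact h i j (Ne.symm hj)
    · simp
  exact smul_right_injective _ two_ne_zero h3

/-- The summands of `diracOp`. -/
def diracTerm (j : Fin n) : Module.End ℂ (Symb n) :=
  (2 : ℂ) • (mulOp (py j) * contr j) + derOp (Sum.inl j) * wedge j

theorem diracTerm_apply (j : Fin n) (G : Symb n) :
    diracTerm j G = (2 : ℂ) • mulOp (py j) (contr j G) + wedge j (derOp (Sum.inl j) G) := by
  rw [← derOp_flipOp_apply]; rfl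

theorem diracTerm_anticomm {i j : Fin n} (hij : i ≠ j) (F : Symb n) :
    diracTerm i (diracTerm j F) + diracTerm j (diracTerm i F) = 0 := by
  have hd : derOp (Sum.inl i) (derOp (Sum.inl j) F) = derOp (Sum.inl j) (derOp (Sum.inl i) F) :=
    LinearMap.congr_fun (derOp_comm (Sum.inl i) (Sum.inl j)).eq F
  simp only [diracTerm_apply, map_add, map_smul, flipOp_mulOp_apply, derOp_mulOp_apply,
    derOp_flipOp_apply, pderiv_py_inl, mulOp_zero, LinearMap.zero_apply, add_zero, contr_wedge, if_neg hij,
    if_neg hij.symm, zero_sub, map_neg]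
  rw [contr_contr i j, wedge_wedge i j, hd, mulOp_comm_apply (py i)]
  simp only [map_neg]
  module

theorem diracTerm_sq (i : Fin n) (F : Symb n) :
    diracTerm i (diracTerm i F) = (2 : ℂ) • mulOp (py i) (derOp (Sum.inl i) F) := by
  have hc : contr i (contr i F) = 0 := LinearMap.congr_fun (flipOp_sq i false) F
  have hw (G : Symb n) : wedge i (wedge i G) = 0 := LinearMap.congr_fun (flipOp_sq i true) G
  simp only [diracTerm_apply, map_add, map_sub, map_smul, flipOp_mulOp_apply, derOp_mulOp_apply,
    derOp_flipOp_apply, pderiv_py_inl, mulOp_zero, LinearMap.zero_apply, add_zero, contr_wedge, if_true,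
    hc, hw, map_zero, smul_zero]
  module

/-- The summands of `diracOp` anticommute, so its square is 2 ∑ y_j ∂/∂x_j. This operator acts on
each coefficient separately, and with its counterpart for `vecOp` it generates the infinitesimal
action of SL₂. -/
theorem sum_py_pderiv_eq_zero {F : Symb n} (hF : diracOp n F = 0) (S : Finset (Fin n)) :
    ∑ j, py j * pderiv (Sum.inl j) (F S) = 0 := by
  have hFt : ∑ j, diracTerm j F = 0 := by rw [← hF, diracOp, LinearMap.sum_apply]; rfl
  have h1 := sum_sum_of_anticomm diracTerm F (fun i j hij => diracTerm_anticomm hij F)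
  rw [hFt] at h1
  simp only [map_zero, Finset.sum_const_zero, diracTerm_sq, ← Finset.smul_sum] at h1
  have h3 := (smul_eq_zero.1 h1.symm).resolve_left (by norm_num)
  have h4 := congrFun h3 S
  rwa [Finset.sum_apply] at h4

/-- The summands of `vecOp`. -/
def vecTerm (j : Fin n) : Module.End ℂ (Symb n) :=
  (2 : ℂ) • (mulOp (px j) * contr j) - derOp (Sum.inr j) * wedge j

theorem vecTerm_apply (j : Fin n) (G : Symb n) :
    vecTerm j G = (2 : ℂ) • mulOp (px j) (contr j G) - wedge j (derOp (Sum.inr j) G) := by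
  rw [← derOp_flipOp_apply]; rfl

theorem vecTerm_anticomm {i j : Fin n} (hij : i ≠ j) (F : Symb n) :
    vecTerm i (vecTerm j F) + vecTerm j (vecTerm i F) = 0 := by
  have hd : derOp (Sum.inr i) (derOp (Sum.inr j) F) = derOp (Sum.inr j) (derOp (Sum.inr i) F) :=
    LinearMap.congr_fun (derOp_comm (Sum.inr i) (Sum.inr j)).eq F
  simp only [vecTerm_apply, map_sub, map_smul, flipOp_mulOp_apply, derOp_mulOp_apply,
    derOp_flipOp_apply, pderiv_px_inr, mulOp_zero, LinearMap.zero_apply, add_zero, contr_wedge, if_neg hij,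
    if_neg hij.symm, zero_sub, map_neg]
  rw [contr_contr i j, wedge_wedge i j, hd, mulOp_comm_apply (px i)]
  simp only [map_neg]
  module

theorem vecTerm_sq (i : Fin n) (F : Symb n) :
    vecTerm i (vecTerm i F) = (-2 : ℂ) • mulOp (px i) (derOp (Sum.inr i) F) := by
  have hc : contr i (contr i F) = 0 := LinearMap.congr_fun (flipOp_sq i false) F
  have hw (G : Symb n) : wedge i (wedge i G) = 0 := LinearMap.congr_fun (flipOp_sq i true) G
  simp only [vecTerm_apply, map_sub, map_smul, flipOp_mulOp_apply, derOp_mulOp_apply,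
    derOp_flipOp_apply, pderiv_px_inr, mulOp_zero, LinearMap.zero_apply, add_zero, contr_wedge, if_true,
    hc, hw, map_zero, smul_zero]
  module

theorem sum_px_pderiv_eq_zero {F : Symb n} (hF : vecOp n F = 0) (S : Finset (Fin n)) :
    ∑ j, px j * pderiv (Sum.inr j) (F S) = 0 := by
  have hFt : ∑ j, vecTerm j F = 0 := by rw [← hF, vecOp, LinearMap.sum_apply]; rfl
  have h1 := sum_sum_of_anticomm vecTerm F (fun i j hij => vecTerm_anticomm hij F)
  rw [hFt] at h1
  simp only [map_zero, Finset.sum_const_zero, vecTerm_sq, ← Finset.smul_sum] at h1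
  have h3 := (smul_eq_zero.1 h1.symm).resolve_left (by norm_num)
  have h4 := congrFun h3 S
  rwa [Finset.sum_apply] at h4

end TAMA

end

noncomputable section

namespace TAMA

open MvPolynomial

variable {n : ℕ}

/-! ### Invariant polynomials after inverting one angular momentum -/

theorem derivative_aeval (g : Fin n ⊕ Fin n → Polynomial ℂ) (f : Poly n) :
    Polynomial.derivative (aeval g f) = ∑ v, aeval g (pderiv v f) * Polynomial.derivative (g v) := by
  induction f using MvPolynomial.induction_on with
  | C a => simp
  | add p q hp hq => simp only [map_add, hp, hq, add_mul, Finset.sum_add_distrib]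
  | mul_X p w hp =>
    have h (v) : aeval g (pderiv v (p * MvPolynomial.X w)) * Polynomial.derivative (g v)
        = aeval g (pderiv v p) * Polynomial.derivative (g v) * g w
          + if v = w then aeval g p * Polynomial.derivative (g w) else 0 := by
      rw [pderiv_mul, map_add, map_mul (aeval g), map_mul (aeval g), aeval_X]
      split_ifs with hv
      · subst hv; rw [pderiv_X_self, map_one]; ring
      · rw [pderiv_X_of_ne (Ne.symm hv), map_zero]; ring
    rw [map_mul, aeval_X, Polynomial.derivative_mul, hp]
    simp only [h, Finset.sum_add_distrib, Finset.sum_mul, Finset.sum_ite_eq', Finset.mem_univ,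
      if_true]

/-- Restricted to the line u + t w, the polynomial f has zero derivative in t, hence is constant in
characteristic zero. -/
theorem eval_shear (f : Poly n) (u w : Fin n ⊕ Fin n → ℂ)
    (h : ∀ t : ℂ, ∑ v, w v * eval (fun v => u v + t * w v) (pderiv v f) = 0) (t : ℂ) :
    eval (fun v => u v + t * w v) f = eval u f := by
  let g : Fin n ⊕ Fin n → Polynomial ℂ := fun v =>
    Polynomial.C (u v) + Polynomial.X * Polynomial.C (w v)
  have hg (s : ℂ) (q : Poly n) :
      Polynomial.eval s (aeval g q) = eval (fun v => u v + s * w v) q := by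
    rw [← Polynomial.coe_aeval_eq_eval, ← AlgHom.comp_apply, comp_aeval, ← coe_aeval_eq_eval]
    simp only [g, Polynomial.coe_aeval_eq_eval, Polynomial.eval_add, Polynomial.eval_C,
      Polynomial.eval_mul, Polynomial.eval_X]
    rfl
  have hd : Polynomial.derivative (aeval g f) = 0 := by
    refine Polynomial.funext fun s => ?_
    rw [derivative_aeval, Polynomial.eval_finsetSum, Polynomial.eval_zero, ← h s]
    refine Finset.sum_congr rfl fun v _ => ?_
    have hgv : Polynomial.derivative (g v) = Polynomial.C (w v) := by simp [g]
    rw [Polynomial.eval_mul, hg, hgv, Polynomial.eval_C, mul_comm]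
  have hc := Polynomial.eq_C_of_natDegree_eq_zero
    (Polynomial.derivative_eq_zero.1 hd)
  have h0 : eval u f = Polynomial.eval 0 (aeval g f) := by rw [hg]; simp
  rw [h0, ← hg, hc, Polynomial.eval_C, Polynomial.eval_C]

theorem eval_shear_y {f : Poly n} (hf : ∑ j, px j * pderiv (Sum.inr j) f = 0)
    (x y : Fin n → ℂ) (t : ℂ) :
    eval (Sum.elim x (fun i => y i + t * x i)) f = eval (Sum.elim x y) f := by
  have hs (s : ℂ) : (fun v => Sum.elim x y v + s * Sum.elim (0 : Fin n → ℂ) x v)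
      = Sum.elim x (fun i => y i + s * x i) := by
    funext v; cases v <;> simp
  have := eval_shear f (Sum.elim x y) (Sum.elim (0 : Fin n → ℂ) x) (fun s => by
    rw [hs]
    have := congrArg (eval (Sum.elim x (fun i => y i + s * x i))) hf
    simpa [Fintype.sum_sum_type] using this) t
  rwa [hs] at this

theorem eval_shear_x {f : Poly n} (hf : ∑ j, py j * pderiv (Sum.inl j) f = 0)
    (x y : Fin n → ℂ) (t : ℂ) :
    eval (Sum.elim (fun i => x i + t * y i) y) f = eval (Sum.elim x y) f := by
  have hs (s : ℂ) : (fun v => Sum.elim x y v + s * Sum.elim y (0 : Fin n → ℂ) v)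
      = Sum.elim (fun i => x i + s * y i) y := by
    funext v; cases v <;> simp
  have := eval_shear f (Sum.elim x y) (Sum.elim y (0 : Fin n → ℂ)) (fun s => by
    rw [hs]
    have := congrArg (eval (Sum.elim (fun i => x i + s * y i) y)) hf
    simpa [Fintype.sum_sum_type] using this) t
  rwa [hs] at this

/-- The variable of the chord joining `i` and `j`, antisymmetric in `i` and `j`. -/
def chordX (i j : Fin n) : MvPolynomial (Chord n) ℂ :=
  if h : i < j then MvPolynomial.X ⟨(i, j), h⟩
  else if h : j < i then - MvPolynomial.X ⟨(j, i), h⟩ else 0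

theorem pL_self (i : Fin n) : pL i i = 0 := sub_self _

theorem pL_swap (i j : Fin n) : pL i j = - pL j i := by rw [pL, pL]; ring

@[simp] theorem polyL_chordX (i j : Fin n) : polyL n (chordX i j) = pL i j := by
  rw [chordX]
  split_ifs with h1 h2
  · simp
  · rw [map_neg, polyL_X, pL_swap i j]
  · rw [le_antisymm (not_lt.1 h2) (not_lt.1 h1), pL_self, map_zero]

theorem chordX_of_lt {i j : Fin n} (h : i < j) : chordX i j = MvPolynomial.X ⟨(i, j), h⟩ := by
  rw [chordX, dif_pos h]

/-- Clearing denominators: each x-variable is replaced by a fraction with denominator L_ab and costs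
one power of it, while the y-variables cost none. -/
theorem exists_homogenization (a b : Fin n) (f : Poly n) :
    ∃ (N : ℕ) (p : MvPolynomial (Chord n) ℂ), ∀ u : Fin n ⊕ Fin n → ℂ, eval u (pL a b) ≠ 0 →
      eval u (polyL n p) = eval u (pL a b) ^ N *
        eval (Sum.elim (fun i => eval u (pL i b) / eval u (pL a b)) (fun i => eval u (pL a i))) f := by
  induction f using MvPolynomial.induction_on with
  | C r => exact ⟨0, C r, fun u _ => by simp [← algebraMap_eq]⟩
  | add f g hf hg =>
    obtain ⟨N, p, hp⟩ := hf
    obtain ⟨K, q, hq⟩ := hg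
    refine ⟨N + K, chordX a b ^ K * p + chordX a b ^ N * q, fun u hu => ?_⟩
    simp only [map_add, map_mul, map_pow, polyL_chordX, hp u hu, hq u hu]
    ring
  | mul_X f v hf =>
    obtain ⟨N, p, hp⟩ := hf
    cases v with
    | inl i =>
      refine ⟨N + 1, p * chordX i b, fun u hu => ?_⟩
      simp only [map_mul, polyL_chordX, hp u hu, eval_X, Sum.elim_inl]
      field_simp
      ring
    | inr i =>
      refine ⟨N, p * chordX a i, fun u hu => ?_⟩
      simp only [map_mul, polyL_chordX, hp u hu, eval_X, Sum.elim_inr]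
      ring

/-- Three shears bring the columns (x_a, y_a) and (x_b, y_b) to (1, 0) and (0, L_ab). All other
entries then become expressions in the 2 × 2 minors, and f is unchanged by shears. -/
theorem eval_normal_form {f : Poly n} (hx : ∑ j, px j * pderiv (Sum.inr j) f = 0)
    (hy : ∑ j, py j * pderiv (Sum.inl j) f = 0) (a b : Fin n) (u : Fin n ⊕ Fin n → ℂ)
    (hu : eval u (pL a b) ≠ 0) (hya : u (Sum.inr a) ≠ 0) :
    eval (Sum.elim (fun i => eval u (pL i b) / eval u (pL a b)) (fun i => eval u (pL a i))) f
      = eval u f := by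
  obtain ⟨x, y, rfl⟩ : ∃ x y, u = Sum.elim x y :=
    ⟨u ∘ Sum.inl, u ∘ Sum.inr, (Sum.elim_comp_inl_inr u).symm⟩
  simp only [pL, map_sub, map_mul, eval_X, Sum.elim_inl, Sum.elim_inr] at hu hya ⊢
  -- This shear parameter makes the a-th entry of x equal to 1; it is the reason for assuming y_a ≠
  -- 0.
  set s := (1 - x a) / y a with hs
  have hsa : x a + s * y a = 1 := by rw [hs]; field_simp; ring
  set l := x a * y b - x b * y a with hl
  have e1 := eval_shear_x hy x y s
  have e2 := eval_shear_y hx (fun i => x i + s * y i) y (- y a)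
  -- After the second shear the b-th entry of y is l, so this parameter kills the b-th entry of x.
  have e3 := eval_shear_x hy (fun i => x i + s * y i) (fun i => y i + -y a * (x i + s * y i))
    (-(x b + s * y b) / l)
  have h1 : (fun i => y i + -y a * (x i + s * y i)) = fun i => x a * y i - x i * y a := by
    funext i; linear_combination (- y i) * hsa
  have h2 : (fun i => x i + s * y i + -(x b + s * y b) / l * (y i + -y a * (x i + s * y i)))
      = fun i => (x i * y b - x b * y i) / l := by
    funext i
    rw [congrFun h1 i]
    field_simp
    rw [hl]
    linear_combination (x i * y b - x b * y i) * hsa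
  rw [h2] at e3
  rw [← e1, ← e2, ← e3, h1]

theorem pL_ne_zero {a b : Fin n} (h : a ≠ b) : pL a b ≠ 0 := by
  intro h0
  have := congrArg (eval (Sum.elim (Pi.single a (1 : ℂ)) (Pi.single b 1))) h0
  simp [pL, h] at this

theorem exists_polyL_eq_pow_mul {f : Poly n} (hx : ∑ j, px j * pderiv (Sum.inr j) f = 0)
    (hy : ∑ j, py j * pderiv (Sum.inl j) f = 0) {a b : Fin n} (hab : a ≠ b) :
    ∃ (N : ℕ) (p : MvPolynomial (Chord n) ℂ), polyL n p = pL a b ^ N * f := by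
  obtain ⟨N, p, hp⟩ := exists_homogenization a b f
  refine ⟨N, p, ?_⟩
  -- The extra factor vanishes exactly where the normal form is unavailable, so the product can be
  -- shown to vanish at every point.
  have h : (polyL n p - pL a b ^ N * f) * (pL a b * py a) = 0 := by
    refine MvPolynomial.funext fun u => ?_
    rw [map_mul, map_zero]
    by_cases hu : eval u (pL a b) = 0
    · simp [hu]
    · by_cases hya : u (Sum.inr a) = 0
      · simp [hya]
      · rw [map_sub, hp u hu, eval_normal_form hx hy a b u hu hya]
        simp
  have h2 : pL a b * py a ≠ 0 := mul_ne_zero (pL_ne_zero hab) (X_ne_zero _)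
  exact sub_eq_zero.1 ((mul_eq_zero.1 h).resolve_right h2)

/-! ### Invariants after inverting one total angular momentum -/

theorem contr_apply_of_notMem {j : Fin n} {T : Finset (Fin n)} (h : j ∉ T) (G : Symb n) :
    contr j G T = sgn j T • G (insert j T) := by
  have : symmDiff T {j} = insert j T := by
    ext k; rw [mem_symmDiff_singleton]; by_cases hk : k = j <;> simp [hk, h]
  rw [flipOp_apply, this]; simp [h]

theorem contr_apply_of_mem {j : Fin n} {T : Finset (Fin n)} (h : j ∈ T) (G : Symb n) :
    contr j G T = 0 := by
  rw [flipOp_apply]; simp [h]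

theorem wedge_apply_eq_zero {j : Fin n} {T : Finset (Fin n)} {G : Symb n}
    (h : ∀ S : Finset (Fin n), S.card < T.card → G S = 0) : wedge j G T = 0 := by
  rw [flipOp_apply]
  split_ifs with hj
  · have hj : j ∈ T := hj.2 rfl
    have := card_symmDiff_singleton j T
    rw [if_pos hj] at this
    rw [h _ (by omega), smul_zero]
  · rfl

/-- At T the wedge terms only involve coefficients of G at smaller sets, which vanish, so the
equation reduces to its contraction part. -/
theorem sum_py_contr_eq_zero {G : Symb n} (hG : diracOp n G = 0) {T : Finset (Fin n)}
    (h : ∀ S : Finset (Fin n), S.card < T.card → G S = 0) : ∑ j, py j * contr j G T = 0 := by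
  have h1 := congrFun hG T
  rw [diracOp_apply, Finset.sum_apply] at h1
  simp only [Pi.add_apply, derOp_apply, wedge_apply_eq_zero h, map_zero, add_zero, Pi.smul_apply,
    mulOp_apply, ← Finset.smul_sum, Pi.zero_apply] at h1
  exact (smul_eq_zero.1 h1).resolve_left two_ne_zero

theorem sum_px_contr_eq_zero {G : Symb n} (hG : vecOp n G = 0) {T : Finset (Fin n)}
    (h : ∀ S : Finset (Fin n), S.card < T.card → G S = 0) : ∑ j, px j * contr j G T = 0 := by
  have h1 := congrFun hG T
  rw [vecOp_apply, Finset.sum_apply] at h1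
  simp only [Pi.sub_apply, derOp_apply, wedge_apply_eq_zero h, map_zero, sub_zero, Pi.smul_apply,
    mulOp_apply, ← Finset.smul_sum, Pi.zero_apply] at h1
  exact (smul_eq_zero.1 h1).resolve_left two_ne_zero

/-- Combining the two contraction equations with weights y_b and −x_b gives ∑ L_jb (contr j G)(T) =
0. The index b has dropped out, and L_ab is not a zero divisor. -/
theorem apply_insert_eq_zero {G : Symb n} (hd : diracOp n G = 0) (hv : vecOp n G = 0)
    {T : Finset (Fin n)} (h : ∀ S : Finset (Fin n), S.card < T.card → G S = 0) {a b : Fin n}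
    (hab : a ≠ b) (haT : a ∉ T) (h' : ∀ j, j ∉ T → j ≠ a → j ≠ b → G (insert j T) = 0) :
    G (insert a T) = 0 := by
  have h1 := sum_py_contr_eq_zero hd h
  have h2 := sum_px_contr_eq_zero hv h
  have h3 : ∑ j, pL j b * contr j G T = 0 := by
    have : ∑ j, pL j b * contr j G T
        = py b * ∑ j, px j * contr j G T - px b * ∑ j, py j * contr j G T := by
      rw [Finset.mul_sum, Finset.mul_sum, ← Finset.sum_sub_distrib]
      exact Finset.sum_congr rfl fun j _ => by rw [pL]; ring
    rw [this, h1, h2]; simp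
  rw [Finset.sum_eq_single a] at h3
  · rw [contr_apply_of_notMem haT] at h3
    have h4 := (mul_eq_zero.1 h3).resolve_left (pL_ne_zero hab)
    refine (smul_eq_zero.1 h4).resolve_left fun h5 => ?_
    have := sgn_mul_self a T
    simp [h5] at this
  · intro j _ hj
    by_cases hjb : j = b
    · subst hjb; rw [pL_self, zero_mul]
    · by_cases hjT : j ∈ T
      · rw [contr_apply_of_mem hjT, mul_zero]
      · rw [contr_apply_of_notMem hjT, h' j hjT hj hjb, smul_zero, mul_zero]
  · simp

/-- Induction on the cardinality of S. Sets avoiding a and b have at most three elements; the odd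
ones are excluded by parity and the others by hypothesis. The contraction equations then reach the
sets containing a, and finally those containing b. -/
theorem eq_zero_of_mem_invariants (hn : n ≤ 5) {G : Symb n} (hG : G ∈ invariants n) {a b : Fin n}
    (hab : a ≠ b) (h0 : G ∅ = 0)
    (h2 : ∀ c : Chord n, c.1.1 ≠ a → c.1.1 ≠ b → c.1.2 ≠ a → c.1.2 ≠ b →
      G {c.1.1, c.1.2} = 0) : G = 0 := by
  rw [mem_invariants] at hG
  obtain ⟨hd, hv, hp⟩ := hG
  suffices ∀ (k : ℕ) (S : Finset (Fin n)), S.card = k → G S = 0 from funext fun S => this _ S rfl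
  intro k
  induction k using Nat.strong_induction_on with
  | _ k ih =>
  have c1 : ∀ S : Finset (Fin n), S.card = k → a ∉ S → b ∉ S → G S = 0 := by
    intro S hS ha hb
    have hcard : k ≤ 3 := by
      have : S ⊆ (Finset.univ.erase a).erase b := fun j hj => by
        simp only [Finset.mem_erase, Finset.mem_univ, and_true]
        exact ⟨fun h => hb (h ▸ hj), fun h => ha (h ▸ hj)⟩
      have := Finset.card_le_card this
      rw [Finset.card_erase_of_mem (by simp [hab.symm]), Finset.card_erase_of_mem (by simp),
        Finset.card_univ, Fintype.card_fin] at this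
      omega
    have hodd : Odd k → G S = 0 := by
      intro hk
      have := congrFun hp S
      rw [parOp_apply, hS, hk.neg_one_pow, neg_one_smul] at this
      exact self_eq_neg.1 this.symm
    interval_cases k
    · rw [Finset.card_eq_zero.1 hS, h0]
    · exact hodd (by decide)
    · obtain ⟨i, j, hij, rfl⟩ := Finset.card_eq_two.1 hS
      simp only [Finset.mem_insert, Finset.mem_singleton, not_or] at ha hb
      rcases lt_or_gt_of_ne hij with h | h
      · exact h2 ⟨(i, j), h⟩ (Ne.symm ha.1) (Ne.symm hb.1) (Ne.symm ha.2) (Ne.symm hb.2)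
      · rw [Finset.pair_comm]
        exact h2 ⟨(j, i), h⟩ (Ne.symm ha.2) (Ne.symm hb.2) (Ne.symm ha.1) (Ne.symm hb.1)
    · exact hodd (by decide)
  have c2 : ∀ S : Finset (Fin n), S.card = k → b ∉ S → G S = 0 := by
    intro S hS hb
    by_cases ha : a ∈ S
    · have hc := Finset.card_erase_add_one ha
      rw [← Finset.insert_erase ha]
      refine apply_insert_eq_zero hd hv (fun T hT => ih T.card (by omega) T rfl) hab (by simp) ?_
      intro j hj hja hjb
      refine c1 _ ?_ ?_ ?_
      · rw [Finset.card_insert_of_notMem hj]; omega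
      · simp [Ne.symm hja]
      · simp [Ne.symm hjb, hb]
    · exact c1 S hS ha hb
  intro S hS
  by_cases hb : b ∈ S
  · have hc := Finset.card_erase_add_one hb
    rw [← Finset.insert_erase hb]
    refine apply_insert_eq_zero hd hv (fun T hT => ih T.card (by omega) T rfl) hab.symm (by simp) ?_
    intro j hj hjb hja
    refine c2 _ ?_ ?_
    · rw [Finset.card_insert_of_notMem hj]; omega
    · simp [Ne.symm hjb]
  · exact c2 S hS hb

/-- The Pfaffian of four indices. -/
def pfaff (i j k l : Fin n) : MvPolynomial (Chord n) ℂ :=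
  chordX i j * chordX k l - chordX i k * chordX j l + chordX i l * chordX j k

theorem polyL_pfaff (i j k l : Fin n) : polyL n (pfaff i j k l) = 0 := by
  simp only [pfaff, map_add, map_sub, map_mul, polyL_chordX, pL]; ring

theorem pderiv_chordX_eq_zero {c : Chord n} {i j : Fin n} (hi : c.1.1 ≠ i) (hi' : c.1.2 ≠ i) :
    pderiv c (chordX i j) = 0 := by
  rw [chordX]
  split_ifs with h1 h2
  · exact pderiv_X_of_ne fun h => hi (by rw [← h])
  · rw [map_neg, pderiv_X_of_ne (fun h => hi' (by rw [← h])), neg_zero]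
  · exact map_zero _

/-- With the Plücker relation `polyL_pfaff`, this shows that the Pfaffian of a, b and d, evaluated
at Z and applied to 1, has no coefficient at ∅ and, among the pairs avoiding a and b, only the
coefficient ½ L_ab at d. -/
theorem pderiv_pfaff {c d : Chord n} {a b : Fin n} (h1 : c.1.1 ≠ a) (h2 : c.1.1 ≠ b)
    (h3 : c.1.2 ≠ a) (h4 : c.1.2 ≠ b) :
    pderiv c (pfaff a b d.1.1 d.1.2) = if c = d then chordX a b else 0 := by
  have : pderiv c (chordX d.1.1 d.1.2) = if c = d then 1 else 0 := by
    rw [chordX_of_lt d.2]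
    split_ifs with h
    · subst h; exact pderiv_X_self _
    · exact pderiv_X_of_ne (Ne.symm h)
  simp only [pfaff, map_add, map_sub, pderiv_mul, pderiv_chordX_eq_zero h1 h3,
    pderiv_chordX_eq_zero h2 h4, this]
  split_ifs <;> simp

/-- Up to powers of L_ab every coefficient of F is a polynomial in the L_ij. One polynomial in Z
matches the coefficient at ∅, Pfaffians match those at the pairs avoiding a and b, and an invariant
with these coefficients zero vanishes. -/
theorem exists_polyZ_eq_pow {F : Symb n} (hn : n ≤ 5) (hF : F ∈ invariants n) {a b : Fin n}
    (hab : a ≠ b) : ∃ (N : ℕ) (p : MvPolynomial (Chord n) ℂ),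
      polyZ n (chordX a b ^ N) F = polyZ n p (oneSymb n) := by
  have hB {F : Symb n} (hF : F ∈ invariants n) (S : Finset (Fin n)) :
      ∃ (N : ℕ) (p : MvPolynomial (Chord n) ℂ), polyL n p = pL a b ^ N * F S :=
    exists_polyL_eq_pow_mul (sum_px_pderiv_eq_zero (mem_invariants.1 hF).2.1 S)
      (sum_py_pderiv_eq_zero (mem_invariants.1 hF).1 S) hab
  obtain ⟨N, p, hp⟩ := hB hF ∅
  set F' := polyZ n (chordX a b ^ N) F - polyZ n p (oneSymb n) with hF'
  have hF'inv : F' ∈ invariants n := Submodule.sub_mem _ (polyZ_mem_invariants _ hF)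
    (polyZ_mem_invariants _ oneSymb_mem_invariants)
  have hF'0 : F' ∅ = 0 := by
    rw [hF', Pi.sub_apply, polyZ_apply_empty, polyZ_apply_empty, oneSymb_empty, hp, map_pow,
      polyL_chordX, mul_one, sub_self]
  choose K q hq using fun c : Chord n => hB hF'inv {c.1.1, c.1.2}
  set s : Finset (Chord n) := Finset.univ.filter
    fun c => c.1.1 ≠ a ∧ c.1.1 ≠ b ∧ c.1.2 ≠ a ∧ c.1.2 ≠ b with hs
  -- A common exponent for all pairs. One more power of `chordX a b` is needed below, because each
  -- Pfaffian contributes a factor L_ab.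
  set k := ∑ c, K c with hk
  set r : MvPolynomial (Chord n) ℂ :=
    ∑ c ∈ s, (2 : ℂ) • (chordX a b ^ (k - K c) * q c * pfaff a b c.1.1 c.1.2) with hr
  have hone (c : Chord n) : oneSymb n {c.1.1, c.1.2} = 0 := oneSymb_of_ne (by simp)
  have key : polyZ n (chordX a b ^ (k + 1)) F' - polyZ n r (oneSymb n) = 0 := by
    refine eq_zero_of_mem_invariants hn (Submodule.sub_mem _ (polyZ_mem_invariants _ hF'inv)
      (polyZ_mem_invariants _ oneSymb_mem_invariants)) hab ?_ ?_
    · rw [Pi.sub_apply, polyZ_apply_empty, polyZ_apply_empty, hF'0, mul_zero, zero_sub, hr, map_sum]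
      simp [polyL_pfaff]
    · intro c h1 h2 h3 h4
      have hc : c ∈ s := by simp [hs, h1, h2, h3, h4]
      have hr' : polyL n (pderiv c r) = (2 : ℂ) • (pL a b ^ (k - K c) * polyL n (q c) * pL a b) := by
        rw [hr, map_sum, map_sum, Finset.sum_eq_single c]
        · rw [Derivation.map_smul, pderiv_mul, pderiv_pfaff h1 h2 h3 h4, if_pos rfl, map_smul,
            map_add, map_mul (polyL n), map_mul (polyL n), polyL_pfaff]
          simp
        · intro d _ hdc
          rw [Derivation.map_smul, pderiv_mul, pderiv_pfaff h1 h2 h3 h4, if_neg (Ne.symm hdc),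
            map_smul, map_add, map_mul (polyL n), map_mul (polyL n), polyL_pfaff]
          simp
        · exact fun h => absurd hc h
      rw [Pi.sub_apply, polyZ_apply_pair, polyZ_apply_pair, hF'0, hone, oneSymb_empty, hr', hq,
        map_pow, polyL_chordX, mul_zero, mul_zero, smul_zero, add_zero, zero_add, mul_one, smul_smul,
        ← mul_assoc, ← pow_add, Nat.sub_add_cancel
          (Finset.single_le_sum (fun _ _ => Nat.zero_le _) (Finset.mem_univ c))]
      rw [← hk]
      norm_num
      ring
  refine ⟨k + 1 + N, r + chordX a b ^ (k + 1) * p, ?_⟩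
  rw [sub_eq_zero, hF', map_sub, sub_eq_iff_eq_add] at key
  rw [pow_add, map_mul, Module.End.mul_apply, key, map_add, map_mul]
  rfl

end TAMA

end

noncomputable section

namespace TAMA

open MvPolynomial

variable {n : ℕ}

/-! ### Diagrams, crossings and weights -/

/-- The chord `(i, j)` as an element of the type of chords. -/
abbrev chord {i j : Fin n} (h : i < j) : Chord n := ⟨(i, j), h⟩

theorem Uncrossed.mono {m m' : Diagram n} (h : Uncrossed m) (hle : m' ≤ m) : Uncrossed m' := by
  intro i j k l hij hjk hkl
  refine (h i j k l hij hjk hkl).imp (fun h0 => ?_) (fun h0 => ?_)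
  · exact Nat.le_zero.1 (h0 ▸ hle _)
  · exact Nat.le_zero.1 (h0 ▸ hle _)

/-- If the added chord is absent from m', then m' lies below the uncrossed part; otherwise one copy
of it can be removed from m'. -/
theorem Uncrossable.mono {m m' : Diagram n} (h : Uncrossable m) (hle : m' ≤ m) :
    Uncrossable m' := by
  rcases h with h | ⟨m₁, c, h, rfl⟩
  · exact Or.inl (h.mono hle)
  · by_cases hc : m' c = 0
    · refine Or.inl (h.mono fun d => ?_)
      by_cases hd : d = c
      · subst hd; rw [hc]; exact Nat.zero_le _
      · simpa [hd] using hle d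
    · refine Or.inr ⟨m' - Pi.single c 1, c, h.mono fun d => ?_, ?_⟩
      · have := hle d
        simp only [Pi.add_apply, Pi.sub_apply] at this ⊢
        omega
      · funext d
        by_cases hd : d = c
        · subst hd; simp; omega
        · simp [hd]

/-- A weight for which two crossing chords are heavier than the two ways of uncrossing them. -/
def chordWt (c : Chord n) : ℕ := (c.1.2.1 - c.1.1.1) * (n - (c.1.2.1 - c.1.1.1))

theorem chordWt_uncross {i j k l : Fin n} (hij : i < j) (hjk : j < k) (hkl : k < l) :
    chordWt (chord hij) + chordWt (chord hkl)
      < chordWt (chord (hij.trans hjk)) + chordWt (chord (hjk.trans hkl)) ∧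
    chordWt (chord (hij.trans (hjk.trans hkl))) + chordWt (chord hjk)
      < chordWt (chord (hij.trans hjk)) + chordWt (chord (hjk.trans hkl)) := by
  obtain ⟨i, hi⟩ := i
  obtain ⟨j, hj⟩ := j
  obtain ⟨k, hk⟩ := k
  obtain ⟨l, hl⟩ := l
  simp only [Fin.mk_lt_mk] at hij hjk hkl
  simp only [chordWt]
  obtain ⟨p, rfl⟩ := Nat.exists_eq_add_of_lt hij
  obtain ⟨q, rfl⟩ := Nat.exists_eq_add_of_lt hjk
  obtain ⟨r, rfl⟩ := Nat.exists_eq_add_of_lt hkl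
  obtain ⟨s, rfl⟩ := Nat.exists_eq_add_of_lt hl
  have e1 : i + p + 1 - i = p + 1 := by omega
  have e2 : i + p + 1 + q + 1 + r + 1 - (i + p + 1 + q + 1) = r + 1 := by omega
  have e3 : i + p + 1 + q + 1 - i = p + q + 2 := by omega
  have e4 : i + p + 1 + q + 1 + r + 1 - (i + p + 1) = q + r + 2 := by omega
  have e5 : i + p + 1 + q + 1 + r + 1 - i = p + q + r + 3 := by omega
  have e6 : i + p + 1 + q + 1 - (i + p + 1) = q + 1 := by omega
  rw [e1, e2, e3, e4, e5, e6]
  have f1 : i + p + 1 + q + 1 + r + 1 + s + 1 - (p + 1) = i + q + r + s + 3 := by omega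
  have f2 : i + p + 1 + q + 1 + r + 1 + s + 1 - (r + 1) = i + p + q + s + 3 := by omega
  have f3 : i + p + 1 + q + 1 + r + 1 + s + 1 - (p + q + 2) = i + r + s + 2 := by omega
  have f4 : i + p + 1 + q + 1 + r + 1 + s + 1 - (q + r + 2) = i + p + s + 2 := by omega
  have f5 : i + p + 1 + q + 1 + r + 1 + s + 1 - (p + q + r + 3) = i + s + 1 := by omega
  have f6 : i + p + 1 + q + 1 + r + 1 + s + 1 - (q + 1) = i + p + r + s + 3 := by omega
  rw [f1, f2, f3, f4, f5, f6]
  constructor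
  -- The four points cut the n-gon into arcs of lengths p + 1, q + 1, r + 1 and i + s + 1. For t ↦ t
  -- (n − t), each resolution lowers the weight by twice the product of two opposite arcs.
  · exact lt_of_lt_of_eq (Nat.lt_add_of_pos_right (k := 2 * ((q + 1) * (i + s + 1))) (by positivity))
      (by ring)
  · exact lt_of_lt_of_eq (Nat.lt_add_of_pos_right (k := 2 * ((p + 1) * (r + 1))) (by positivity))
      (by ring)

/-- The total weight of a diagram. -/
def diagWt (m : Chord n →₀ ℕ) : ℕ := Finsupp.weight chordWt m

theorem diagWt_add (m m' : Chord n →₀ ℕ) : diagWt (m + m') = diagWt m + diagWt m' := map_add _ _ _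

theorem diagWt_single (c : Chord n) : diagWt (Finsupp.single c 1) = chordWt c := by
  rw [diagWt, Finsupp.weight_single, one_smul]

/-- The non-crossing diagrams without the chord `c₀`. -/
def StdDiag (c₀ : Chord n) (m : Chord n →₀ ℕ) : Prop := Uncrossed (⇑m) ∧ m c₀ = 0

/-- A Pfaffian relation replaces a crossing by its two resolutions, both of smaller weight, so the
process terminates. The last two clauses record triangularity: standard diagrams stay fixed, all
others acquire only terms of strictly smaller weight. -/
theorem exists_straightening {B : Type*} [CommRing B] [Algebra ℂ B]
    (ρ : MvPolynomial (Chord n) ℂ →ₐ[ℂ] B) (hρ : ∀ i j k l, ρ (pfaff i j k l) = 0) {c₀ : Chord n}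
    (h₀ : ρ (MvPolynomial.X c₀) = 0) (m : Chord n →₀ ℕ) :
    ∃ q : MvPolynomial (Chord n) ℂ, ρ q = ρ (MvPolynomial.monomial m 1) ∧
      (∀ μ ∈ q.support, StdDiag c₀ μ) ∧ (StdDiag c₀ m → q = MvPolynomial.monomial m 1) ∧
      (¬ StdDiag c₀ m → ∀ μ ∈ q.support, diagWt μ < diagWt m) := by
  induction hw : diagWt m using Nat.strong_induction_on generalizing m with
  | _ w ih =>
  subst hw
  by_cases hstd : StdDiag c₀ m
  · refine ⟨MvPolynomial.monomial m 1, rfl, fun μ hμ => ?_, fun _ => rfl, fun h => absurd hstd h⟩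
    rw [Finset.mem_singleton.1 (support_monomial_subset hμ)]; exact hstd
  by_cases hm : m c₀ = 0
  swap
  · refine ⟨0, ?_, by simp, fun h => absurd h hstd, by simp⟩
    have : m = (m - Finsupp.single c₀ 1) + Finsupp.single c₀ 1 := by
      rw [tsub_add_cancel_of_le]
      rw [Finsupp.single_le_iff]; exact Nat.one_le_iff_ne_zero.2 hm
    rw [this, monomial_add_single, pow_one, map_mul, h₀, mul_zero, map_zero]
  have hcr : ¬ Uncrossed (⇑m) := fun h => hstd ⟨h, hm⟩
  simp only [Uncrossed, not_forall, not_or] at hcr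
  obtain ⟨i, j, k, l, hij, hjk, hkl, h1, h2⟩ := hcr
  set c := chord (hij.trans hjk)
  set d := chord (hjk.trans hkl)
  have hcd : c ≠ d := fun h => hij.ne (congrArg (fun c => c.1.1) h)
  obtain ⟨m', hm'⟩ : ∃ m', m = m' + Finsupp.single c 1 + Finsupp.single d 1 := by
    refine ⟨m - Finsupp.single c 1 - Finsupp.single d 1, ?_⟩
    ext e
    simp only [Finsupp.add_apply, Finsupp.tsub_apply, Finsupp.single_apply]
    have h1 : 0 < m c := Nat.pos_of_ne_zero h1
    have h2 : 0 < m d := Nat.pos_of_ne_zero h2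
    split_ifs with h3 h4 h4
    · exact absurd (h3.trans h4.symm) hcd
    · subst h3; omega
    · subst h4; omega
    · omega
  obtain ⟨w1, w2⟩ := chordWt_uncross hij hjk hkl
  have hwm : diagWt m = diagWt m' + (chordWt c + chordWt d) := by
    rw [hm', diagWt_add, diagWt_add, diagWt_single, diagWt_single, add_assoc]
  have hm1 : diagWt (m' + Finsupp.single (chord hij) 1 + Finsupp.single (chord hkl) 1)
      < diagWt m := by
    rw [hwm, diagWt_add, diagWt_add, diagWt_single, diagWt_single, add_assoc]
    exact Nat.add_lt_add_left w1 _
  have hm2 : diagWt (m' + Finsupp.single (chord (hij.trans (hjk.trans hkl))) 1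
      + Finsupp.single (chord hjk) 1) < diagWt m := by
    rw [hwm, diagWt_add, diagWt_add, diagWt_single, diagWt_single, add_assoc]
    exact Nat.add_lt_add_left w2 _
  obtain ⟨q1, a1, b1, c1, d1⟩ := ih _ hm1 _ rfl
  obtain ⟨q2, a2, b2, c2, d2⟩ := ih _ hm2 _ rfl
  have le {q : MvPolynomial (Chord n) ℂ} {m₁ : Chord n →₀ ℕ} (hlt : diagWt m₁ < diagWt m)
      (c1 : StdDiag c₀ m₁ → q = MvPolynomial.monomial m₁ 1)
      (d1 : ¬ StdDiag c₀ m₁ → ∀ μ ∈ q.support, diagWt μ < diagWt m₁) :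
      ∀ μ ∈ q.support, diagWt μ < diagWt m := by
    intro μ hμ
    by_cases h : StdDiag c₀ m₁
    · rw [c1 h] at hμ
      rwa [Finset.mem_singleton.1 (support_monomial_subset hμ)]
    · exact (d1 h μ hμ).trans hlt
  refine ⟨q1 + q2, ?_, fun μ hμ => ?_, fun h => absurd h hstd, fun _ μ hμ => ?_⟩
  · have hpf := hρ i j k l
    rw [pfaff, chordX_of_lt hij, chordX_of_lt hkl, chordX_of_lt (hij.trans hjk),
      chordX_of_lt (hjk.trans hkl), chordX_of_lt (hij.trans (hjk.trans hkl)), chordX_of_lt hjk,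
      map_add, map_sub, map_mul, map_mul, map_mul] at hpf
    rw [map_add, a1, a2, hm']
    simp only [monomial_add_single, pow_one, map_mul]
    linear_combination (ρ (MvPolynomial.monomial m' 1)) * hpf
  · rcases Finset.mem_union.1 (support_add hμ) with h | h
    · exact b1 μ h
    · exact b2 μ h
  · rcases Finset.mem_union.1 (support_add hμ) with h | h
    · exact le hm1 c1 d1 μ h
    · exact le hm2 c2 d2 μ h

/-- `ρ` separates the standard diagrams. -/
def Separates {B : Type*} [CommRing B] [Algebra ℂ B] (ρ : MvPolynomial (Chord n) ℂ →ₐ[ℂ] B)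
    (c₀ : Chord n) : Prop :=
  ∀ q : MvPolynomial (Chord n) ℂ, (∀ μ ∈ q.support, StdDiag c₀ μ) → ρ q = 0 → q = 0

/-- Straightening r gives a combination of standard diagrams in the kernel, hence zero. By
triangularity nothing but μ₀ itself contributes to its coefficient at the maximal weight. -/
theorem coeff_eq_zero_of_separates {B : Type*} [CommRing B] [Algebra ℂ B]
    {ρ : MvPolynomial (Chord n) ℂ →ₐ[ℂ] B} (hρ : ∀ i j k l, ρ (pfaff i j k l) = 0) {c₀ : Chord n}
    (h₀ : ρ (MvPolynomial.X c₀) = 0) (hsep : Separates ρ c₀) {r : MvPolynomial (Chord n) ℂ}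
    (hr : ρ r = 0) {μ₀ : Chord n →₀ ℕ} (hμ₀ : StdDiag c₀ μ₀)
    (hwt : ∀ μ ∈ r.support, diagWt μ ≤ diagWt μ₀) : coeff μ₀ r = 0 := by
  choose q h1 h2 h3 h4 using exists_straightening ρ hρ h₀
  have hq : ∑ m ∈ r.support, coeff m r • q m = 0 := by
    refine hsep _ (fun μ hμ => ?_) ?_
    · obtain ⟨m, -, hm⟩ := Finset.mem_biUnion.1 (support_sum hμ)
      exact h2 m μ (support_smul hm)
    · rw [map_sum, ← hr]
      conv_rhs => rw [r.as_sum, map_sum]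
      refine Finset.sum_congr rfl fun m _ => ?_
      rw [map_smul, h1, ← map_smul, smul_monomial, smul_eq_mul, mul_one]
  have h5 := congrArg (coeff μ₀) hq
  rw [coeff_sum, coeff_zero] at h5
  by_contra hne
  rw [Finset.sum_eq_single μ₀] at h5
  · rw [coeff_smul, h3 μ₀ hμ₀, coeff_monomial, if_pos rfl, smul_eq_mul, mul_one] at h5
    exact hne h5
  · intro m hm hmμ
    rw [coeff_smul]
    by_cases hstd : StdDiag c₀ m
    · rw [h3 m hstd, coeff_monomial, if_neg hmμ, smul_zero]
    · by_cases hs : μ₀ ∈ (q m).support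
      · exact absurd (h4 m hstd μ₀ hs) (hwt m hm).not_gt
      · rw [notMem_support_iff.1 hs, smul_zero]
  · intro h; exact absurd (mem_support_iff.2 hne) h

/-- A diagram of maximal weight in p is either uncrossed, where ρ p = 0 excludes it, or an uncrossed
diagram plus one chord c, where ρ (∂p/∂c) = 0 excludes it. -/
theorem eq_zero_of_separates {B : Type*} [CommRing B] [Algebra ℂ B]
    {ρ : MvPolynomial (Chord n) ℂ →ₐ[ℂ] B} (hρ : ∀ i j k l, ρ (pfaff i j k l) = 0) {c₀ : Chord n}
    (h₀ : ρ (MvPolynomial.X c₀) = 0) (hsep : Separates ρ c₀) {p : MvPolynomial (Chord n) ℂ}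
    (hp : ∀ μ ∈ p.support, Uncrossable (⇑μ) ∧ μ c₀ = 0) (h : ρ p = 0)
    (hd : ∀ c, c ≠ c₀ → ρ (pderiv c p) = 0) : p = 0 := by
  by_contra hne
  obtain ⟨m, hm, hmax⟩ := p.support.exists_max_image diagWt (support_nonempty.2 hne)
  obtain ⟨hunc, hm0⟩ := hp m hm
  rcases hunc with hunc | ⟨m', c, hunc, hmm⟩
  · exact mem_support_iff.1 hm (coeff_eq_zero_of_separates hρ h₀ hsep h ⟨hunc, hm0⟩ hmax)
  · let μ : Chord n →₀ ℕ := Finsupp.equivFunOnFinite.symm m'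
    have hmμ : m = μ + Finsupp.single c 1 := by
      ext d
      rw [hmm, Pi.add_apply, Finsupp.add_apply, Finsupp.single_eq_pi_single]
      rfl
    have hc : c ≠ c₀ := by rintro rfl; rw [hmμ] at hm0; simp at hm0
    have hμ0 : μ c₀ = 0 := by
      rw [hmμ, Finsupp.add_apply] at hm0; omega
    -- Each exponent of ∂p/∂c is one of p with a copy of c removed. All weights shift by the same
    -- amount, so μ is maximal for the derivative.
    have := coeff_eq_zero_of_separates hρ h₀ hsep (hd c hc) (μ₀ := μ) ⟨hunc, hμ0⟩ (fun ν hν => by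
      have h1 : ν + Finsupp.single c 1 ∈ p.support := by
        rw [mem_support_iff, coeff_pderiv] at hν
        exact mem_support_iff.2 (left_ne_zero_of_mul hν)
      have h2 := hmax _ h1
      rw [hmμ, diagWt_add, diagWt_add] at h2
      omega)
    rw [coeff_pderiv, ← hmμ] at this
    exact mem_support_iff.1 hm ((mul_eq_zero.1 this).resolve_right (Nat.cast_add_one_ne_zero _))

end TAMA

end

noncomputable section

namespace TAMA

open MvPolynomial

variable {n : ℕ}

/-! ### Leading terms after specialising to parallel vectors -/

/-- The specialisation `(x_b, y_b) ↦ x_b (x_a, y_a)`, followed by `y_j ↦ t ^ j y_j`. -/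
def degen (a b : Fin n) : Poly n →ₐ[ℂ] Polynomial (Poly n) :=
  aeval (Sum.elim
    (fun i => Polynomial.C (if i = b then px b * px a else px i))
    (fun j => if j = b then Polynomial.C (px b * py a) else Polynomial.C (py j) * Polynomial.X ^ j.1))

theorem degen_px (a b i : Fin n) :
    degen a b (px i) = Polynomial.C (if i = b then px b * px a else px i) := by
  rw [degen, aeval_X, Sum.elim_inl]

theorem degen_py (a b j : Fin n) : degen a b (py j) =
    if j = b then Polynomial.C (px b * py a) else Polynomial.C (py j) * Polynomial.X ^ j.1 := by
  rw [degen, aeval_X, Sum.elim_inr]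

/-- The exponent of the leading coefficient of the specialised angular momentum. -/
def leadExp (a b : Fin n) (c : Chord n) : Fin n ⊕ Fin n →₀ ℕ :=
  Finsupp.single (Sum.inl c.1.1) 1 + (if c.1.1 = b then Finsupp.single (Sum.inl a) 1 else 0)
    + Finsupp.single (Sum.inr c.1.2) 1

theorem natDegree_leadingCoeff_sub {R : Type*} [CommRing R] {A B : R} (hA : A ≠ 0) {i j : ℕ}
    (hij : i < j) :
    (Polynomial.C A * Polynomial.X ^ j - Polynomial.C B * Polynomial.X ^ i).natDegree = j ∧
    (Polynomial.C A * Polynomial.X ^ j - Polynomial.C B * Polynomial.X ^ i).leadingCoeff = A := by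
  have h1 : (Polynomial.C A * Polynomial.X ^ j).degree = (j : WithBot ℕ) := Polynomial.degree_C_mul_X_pow j hA
  have h2 : (Polynomial.C B * Polynomial.X ^ i).degree < (Polynomial.C A * Polynomial.X ^ j).degree :=
    h1 ▸ lt_of_le_of_lt (Polynomial.degree_C_mul_X_pow_le i B) (by exact_mod_cast hij)
  constructor
  · rw [Polynomial.natDegree_eq_of_degree_eq_some]
    rw [Polynomial.degree_sub_eq_left_of_degree_lt h2, h1]
  · rw [Polynomial.leadingCoeff_sub_of_degree_lt h2, Polynomial.leadingCoeff_C_mul_X_pow]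

theorem degen_pL_self {a b : Fin n} (ha : a.1 = 0) (hab : a ≠ b) : degen a b (pL a b) = 0 := by
  rw [pL, map_sub, map_mul, map_mul, degen_px, degen_px, degen_py, degen_py, if_pos rfl, if_pos rfl,
    if_neg hab, if_neg hab, ha, pow_zero, mul_one, ← map_mul, ← map_mul, ← map_sub]
  rw [show px a * (px b * py a) - px b * px a * py a = 0 by ring, map_zero]

/-- For a chord (i, j) the term x_i y_j carries t^j and dominates the other one. If i = b, the b-th
vector is x_b times the a-th, which produces the additional factor x_a. -/
theorem degen_pL {a b : Fin n} (ha : a.1 = 0) (hb : b.1 = 1) {c : Chord n} (hc : c.1 ≠ (a, b)) :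
    (degen a b (pL c.1.1 c.1.2)).natDegree = c.1.2.1 ∧
    (degen a b (pL c.1.1 c.1.2)).leadingCoeff = MvPolynomial.monomial (leadExp a b c) 1 := by
  obtain ⟨⟨i, j⟩, hij⟩ := c
  simp only at hij hc ⊢
  have hij' : i.1 < j.1 := hij
  have hjb : j ≠ b := by
    rintro rfl
    exact hc (Prod.ext (Fin.ext (by simp only; omega)) rfl)
  have hX (i : Fin n ⊕ Fin n) : (MvPolynomial.X i : Poly n)
    = MvPolynomial.monomial (Finsupp.single i 1) 1 := rfl
  rw [pL, map_sub, map_mul, map_mul, degen_px, degen_px, degen_py, degen_py, if_neg hjb, if_neg hjb]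
  by_cases hib : i = b
  · subst hib
    have e : MvPolynomial.monomial (leadExp a i ⟨(i, j), hij⟩) 1 = px i * px a * py j := by
      simp only [leadExp, hX, monomial_mul, mul_one, if_true]
    rw [if_pos rfl, if_pos rfl, e, ← mul_assoc, ← map_mul, ← map_mul]
    have := natDegree_leadingCoeff_sub (A := px i * px a * py j) (B := px j * (px i * py a))
      (mul_ne_zero (mul_ne_zero (X_ne_zero _) (X_ne_zero _)) (X_ne_zero _)) (i := 0) (j := j.1)
      (by omega)
    rwa [pow_zero, mul_one] at this
  · have e : MvPolynomial.monomial (leadExp a b ⟨(i, j), hij⟩) 1 = px i * py j := by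
      simp only [leadExp, hX, monomial_mul, mul_one, if_neg hib, add_zero]
    rw [if_neg hib, if_neg hib, e, ← mul_assoc, ← mul_assoc, ← map_mul, ← map_mul]
    exact natDegree_leadingCoeff_sub (mul_ne_zero (X_ne_zero _) (X_ne_zero _)) hij'

/-- The exponent of the leading coefficient attached to a diagram. -/
def diagExp (a b : Fin n) (m : Chord n →₀ ℕ) : Fin n ⊕ Fin n →₀ ℕ := ∑ c, m c • leadExp a b c

theorem degen_monomial {a b : Fin n} (ha : a.1 = 0) (hb : b.1 = 1) (hab : a < b)
    {m : Chord n →₀ ℕ} (hm : m (chord hab) = 0) :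
    (degen a b (polyL n (MvPolynomial.monomial m 1))).natDegree = ∑ c : Chord n, m c * c.1.2.1 ∧
    (degen a b (polyL n (MvPolynomial.monomial m 1))).leadingCoeff
      = MvPolynomial.monomial (diagExp a b m) 1 := by
  have e : degen a b (polyL n (MvPolynomial.monomial m 1))
      = ∏ c : Chord n, degen a b (pL c.1.1 c.1.2) ^ m c := by
    rw [monomial_eq, map_one, one_mul, Finsupp.prod_fintype _ _ (fun _ => pow_zero _), map_prod,
      map_prod]
    simp
  have hne (c : Chord n) : degen a b (pL c.1.1 c.1.2) ^ m c ≠ 0 := by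
    by_cases hc : c = chord hab
    · subst hc; rw [hm, pow_zero]; exact one_ne_zero
    · refine pow_ne_zero _ fun h0 => ?_
      have := (degen_pL ha hb (c := c) (fun h => hc (Subtype.ext h))).2
      rw [h0, Polynomial.leadingCoeff_zero] at this
      exact one_ne_zero (monomial_eq_zero.1 this.symm)
  rw [e]
  constructor
  · rw [Polynomial.natDegree_prod _ _ fun c _ => hne c]
    refine Finset.sum_congr rfl fun c _ => ?_
    by_cases hc : c = chord hab
    · subst hc; rw [hm, pow_zero, zero_mul]; exact Polynomial.natDegree_one
    · rw [Polynomial.natDegree_pow, (degen_pL ha hb (c := c) (fun h => hc (Subtype.ext h))).1]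
  · rw [Polynomial.leadingCoeff_prod, diagExp]
    have hs : MvPolynomial.monomial (∑ c, m c • leadExp a b c) (1 : ℂ)
        = ∏ c, MvPolynomial.monomial (m c • leadExp a b c) 1 := by
      rw [monomial_sum_one]
    rw [hs]
    refine Finset.prod_congr rfl fun c _ => ?_
    by_cases hc : c = chord hab
    · subst hc; rw [hm, pow_zero, zero_smul, Polynomial.leadingCoeff_one]; rfl
    · rw [Polynomial.leadingCoeff_pow, (degen_pL ha hb (c := c) (fun h => hc (Subtype.ext h))).2,
        monomial_pow, one_pow]

/-- Among the diagrams of q choose one of maximal t-degree. The coefficient of its leading monomial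
at that degree receives no other contribution, since distinct standard diagrams have distinct
leading exponents. -/
theorem separates_degen {a b : Fin n} (ha : a.1 = 0) (hb : b.1 = 1) (hab : a < b)
    (hinj : ∀ m m', StdDiag (chord hab) m → StdDiag (chord hab) m' →
      diagExp a b m = diagExp a b m' → m = m') :
    Separates ((degen a b).comp (polyL n)) (chord hab) := by
  intro q hq h0
  by_contra hne
  obtain ⟨m, hm, hmax⟩ := q.support.exists_max_image (fun m => ∑ c : Chord n, m c * c.1.2.1)
    (support_nonempty.2 hne)
  have h1 := congrArg (fun f => coeff (diagExp a b m)
    (Polynomial.coeff f (∑ c : Chord n, m c * c.1.2.1))) h0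
  simp only [Polynomial.coeff_zero, coeff_zero] at h1
  conv_lhs at h1 => rw [q.as_sum, map_sum, Polynomial.finsetSum_coeff, coeff_sum]
  have hterm (μ : Chord n →₀ ℕ) : ((degen a b).comp (polyL n)) (MvPolynomial.monomial μ (coeff μ q))
      = coeff μ q • degen a b (polyL n (MvPolynomial.monomial μ 1)) := by
    rw [← map_smul, ← map_smul, smul_monomial, smul_eq_mul, mul_one]; rfl
  rw [Finset.sum_eq_single m] at h1
  · obtain ⟨d1, d2⟩ := degen_monomial ha hb hab (hq m hm).2
    rw [hterm, Polynomial.coeff_smul, coeff_smul, ← d1, Polynomial.coeff_natDegree, d2,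
      coeff_monomial, if_pos rfl, smul_eq_mul, mul_one] at h1
    exact mem_support_iff.1 hm h1
  · intro μ hμ hμm
    obtain ⟨d1, d2⟩ := degen_monomial ha hb hab (hq μ hμ).2
    rw [hterm, Polynomial.coeff_smul, coeff_smul]
    rcases (hmax μ hμ).lt_or_eq with h | h
    · rw [Polynomial.coeff_eq_zero_of_natDegree_lt (by rw [d1]; exact h), coeff_zero, smul_zero]
    · rw [← h, ← d1, Polynomial.coeff_natDegree, d2, coeff_monomial, if_neg, smul_zero]
      exact fun h' => hμm (hinj _ _ (hq μ hμ) (hq m hm) h')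
  · exact fun h => absurd hm h

theorem univ_chord_four : (Finset.univ : Finset (Chord 4)) =
    {⟨(0, 1), by decide⟩, ⟨(0, 2), by decide⟩, ⟨(0, 3), by decide⟩, ⟨(1, 2), by decide⟩,
      ⟨(1, 3), by decide⟩, ⟨(2, 3), by decide⟩} := by decide

theorem univ_chord_five : (Finset.univ : Finset (Chord 5)) =
    {⟨(0, 1), by decide⟩, ⟨(0, 2), by decide⟩, ⟨(0, 3), by decide⟩, ⟨(0, 4), by decide⟩,
      ⟨(1, 2), by decide⟩, ⟨(1, 3), by decide⟩, ⟨(1, 4), by decide⟩, ⟨(2, 3), by decide⟩,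
      ⟨(2, 4), by decide⟩, ⟨(3, 4), by decide⟩} := by decide

/-- The exponents of the leading monomial count the chords that begin or end at a vertex. These
linear equations, and the absence of a crossing of the two diagonals, determine the multiplicities.
-/
theorem diagExp_inj_four (m m' : Chord 4 →₀ ℕ) (hab : (0 : Fin 4) < 1)
    (h : StdDiag (chord hab) m) (h' : StdDiag (chord hab) m')
    (he : diagExp 0 1 m = diagExp 0 1 m') : m = m' := by
  have e (v) := DFunLike.congr_fun he v
  simp only [diagExp, Finsupp.finsetSum_apply, Finsupp.smul_apply, univ_chord_four] at e
  have x0 := e (Sum.inl 0)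
  have x1 := e (Sum.inl 1)
  have x2 := e (Sum.inl 2)
  have y2 := e (Sum.inr 2)
  have y3 := e (Sum.inr 3)
  simp [leadExp, Finsupp.single_apply, h.2, h'.2] at x0 x1 x2 y2 y3
  have c := h.1 0 1 2 3 (by decide) (by decide) (by decide)
  have c' := h'.1 0 1 2 3 (by decide) (by decide) (by decide)
  have h0 : m ⟨(0, 1), by decide⟩ = 0 := h.2
  have h0' : m' ⟨(0, 1), by decide⟩ = 0 := h'.2
  have key : ∀ c ∈ (Finset.univ : Finset (Chord 4)), m c = m' c := by
    rw [univ_chord_four]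
    simp only [Finset.forall_mem_insert, Finset.mem_singleton, forall_eq]
    omega
  ext c; exact key c (Finset.mem_univ c)

/-- The five cases are the triangulations of the pentagon; each lists the three diagonals that do
not belong to it. -/
theorem pentagon_cases {p02 p03 p13 p14 p24 : ℕ}
    (c1 : p02 = 0 ∨ p13 = 0) (c2 : p02 = 0 ∨ p14 = 0) (c3 : p03 = 0 ∨ p14 = 0)
    (c4 : p03 = 0 ∨ p24 = 0) (c5 : p13 = 0 ∨ p24 = 0) :
    (p13 = 0 ∧ p14 = 0 ∧ p24 = 0) ∨ (p13 = 0 ∧ p14 = 0 ∧ p03 = 0) ∨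
    (p02 = 0 ∧ p03 = 0 ∧ p24 = 0) ∨ (p02 = 0 ∧ p14 = 0 ∧ p24 = 0) ∨
    (p02 = 0 ∧ p03 = 0 ∧ p13 = 0) := by
  omega

theorem pentagon_inj {p02 p03 p04 p12 p13 p14 p23 p24 p34 q02 q03 q04 q12 q13 q14 q23 q24 q34 : ℕ}
    (c1 : p02 = 0 ∨ p13 = 0) (c2 : p02 = 0 ∨ p14 = 0) (c3 : p03 = 0 ∨ p14 = 0)
    (c4 : p03 = 0 ∨ p24 = 0) (c5 : p13 = 0 ∨ p24 = 0)
    (d1 : q02 = 0 ∨ q13 = 0) (d2 : q02 = 0 ∨ q14 = 0) (d3 : q03 = 0 ∨ q14 = 0)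
    (d4 : q03 = 0 ∨ q24 = 0) (d5 : q13 = 0 ∨ q24 = 0)
    (x1 : p12 + p13 + p14 = q12 + q13 + q14) (y2 : p02 + p12 = q02 + q12)
    (x0 : p02 + p03 + p04 = q02 + q03 + q04) (x2 : p23 + p24 = q23 + q24)
    (x3 : p34 = q34) (y3 : p03 + p13 + p23 = q03 + q13 + q23)
    (y4 : p04 + p14 + p24 + p34 = q04 + q14 + q24 + q34) :
    p02 = q02 ∧ p03 = q03 ∧ p04 = q04 ∧ p12 = q12 ∧ p13 = q13 ∧ p14 = q14 ∧ p23 = q23 ∧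
      p24 = q24 ∧ p34 = q34 := by
  rcases pentagon_cases c1 c2 c3 c4 c5 with c | c | c | c | c <;>
  rcases pentagon_cases d1 d2 d3 d4 d5 with d | d | d | d | d <;>
  obtain ⟨c, c', c''⟩ := c <;> obtain ⟨d, d', d''⟩ := d <;> subst c c' c'' d d' d'' <;>
  clear c1 c2 c3 c4 c5 d1 d2 d3 d4 d5 <;>
  refine ⟨?_, ?_, ?_, ?_, ?_, ?_, ?_, ?_, ?_⟩ <;> omega

theorem diagExp_inj_five (m m' : Chord 5 →₀ ℕ) (hab : (0 : Fin 5) < 1)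
    (h : StdDiag (chord hab) m) (h' : StdDiag (chord hab) m')
    (he : diagExp 0 1 m = diagExp 0 1 m') : m = m' := by
  have e (v) := DFunLike.congr_fun he v
  simp only [diagExp, Finsupp.finsetSum_apply, Finsupp.smul_apply, univ_chord_five] at e
  have x0 := e (Sum.inl 0)
  have x1 := e (Sum.inl 1)
  have x2 := e (Sum.inl 2)
  have x3 := e (Sum.inl 3)
  have y2 := e (Sum.inr 2)
  have y3 := e (Sum.inr 3)
  have y4 := e (Sum.inr 4)
  simp [leadExp, Finsupp.single_apply, h.2, h'.2] at x0 x1 x2 x3 y2 y3 y4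
  have c1 := h.1 0 1 2 3 (by decide) (by decide) (by decide)
  have c2 := h.1 0 1 2 4 (by decide) (by decide) (by decide)
  have c3 := h.1 0 1 3 4 (by decide) (by decide) (by decide)
  have c4 := h.1 0 2 3 4 (by decide) (by decide) (by decide)
  have c5 := h.1 1 2 3 4 (by decide) (by decide) (by decide)
  have d1 := h'.1 0 1 2 3 (by decide) (by decide) (by decide)
  have d2 := h'.1 0 1 2 4 (by decide) (by decide) (by decide)
  have d3 := h'.1 0 1 3 4 (by decide) (by decide) (by decide)
  have d4 := h'.1 0 2 3 4 (by decide) (by decide) (by decide)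
  have d5 := h'.1 1 2 3 4 (by decide) (by decide) (by decide)
  have h0 : m ⟨(0, 1), by decide⟩ = 0 := h.2
  have h0' : m' ⟨(0, 1), by decide⟩ = 0 := h'.2
  have key : ∀ c ∈ (Finset.univ : Finset (Chord 5)), m c = m' c := by
    rw [univ_chord_five]
    simp only [Finset.forall_mem_insert, Finset.mem_singleton, forall_eq]
    exact ⟨h0.trans h0'.symm, pentagon_inj c1 c2 c3 c4 c5 d1 d2 d3 d4 d5 (by omega) y2 (by omega) (by omega)
      (by omega) (by omega) (by omega)⟩
  ext c; exact key c (Finset.mem_univ c)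

end TAMA

end

noncomputable section

namespace TAMA

open MvPolynomial

variable {n : ℕ}

/-! ### Cancelling a chord, and independence of the uncrossable monomials of symbols -/

/-- With respect to the cardinality of S, the operator is triangular with diagonal entry L_ab, a
nonzero element of a domain. -/
theorem Z_injective {a b : Fin n} (hab : a ≠ b) : Function.Injective (Z a b) := by
  rw [injective_iff_map_eq_zero]
  intro F hF
  funext S
  induction h : S.card using Nat.strong_induction_on generalizing S with
  | _ k ih =>
  subst h
  have h1 := congrFun hF S
  rw [Z_apply, Pi.add_apply, Pi.smul_apply, wedge_apply_eq_zero, smul_zero, add_zero, mulOp_apply,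
    Pi.zero_apply] at h1
  · exact (mul_eq_zero.1 h1).resolve_left (pL_ne_zero hab)
  · exact fun S' hS' => wedge_apply_eq_zero fun S'' hS'' => ih _ (hS''.trans hS') _ rfl

/-- Polynomials all of whose monomials are uncrossable diagrams. -/
def UncrossableSupport (p : MvPolynomial (Chord n) ℂ) : Prop :=
  ∀ μ ∈ p.support, Uncrossable (⇑μ)

/-- Write p = X_ab q + r with r free of X_ab. Then r(Z) · 1 is a multiple of Z_ab, so r and its
derivatives along the other chords vanish where L_ab = 0, read off at ∅ and at pairs. Hence r = 0,
and Z_ab can be cancelled. -/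
theorem exists_eq_X_mul {a b : Fin n} (ha : a.1 = 0) (hab : a < b)
    (hsep : Separates ((degen a b).comp (polyL n)) (chord hab)) {F : Symb n}
    {p : MvPolynomial (Chord n) ℂ} (hp : UncrossableSupport p)
    (h : Z a b F = polyZ n p (oneSymb n)) :
    ∃ q, UncrossableSupport q ∧ p = MvPolynomial.X (chord hab) * q
      ∧ F = polyZ n q (oneSymb n) := by
  set c₀ := chord hab with hc₀
  set q := p.divMonomial (Finsupp.single c₀ 1) with hq
  set r := p.modMonomial (Finsupp.single c₀ 1) with hr
  have hpqr : MvPolynomial.X c₀ * q + r = p := divMonomial_add_modMonomial_single p c₀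
  have hqs : UncrossableSupport q := by
    intro μ hμ
    rw [mem_support_iff, hq, coeff_divMonomial] at hμ
    exact (hp _ (mem_support_iff.2 hμ)).mono fun d => by simp
  have hrs : ∀ μ ∈ r.support, Uncrossable (⇑μ) ∧ μ c₀ = 0 := by
    intro μ hμ
    by_cases hle : Finsupp.single c₀ 1 ≤ μ
    · rw [mem_support_iff, hr, coeff_modMonomial_of_le _ hle] at hμ
      exact absurd rfl hμ
    · rw [mem_support_iff, hr, coeff_modMonomial_of_not_le _ hle] at hμ
      refine ⟨hp _ (mem_support_iff.2 hμ), ?_⟩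
      rw [Finsupp.single_le_iff] at hle
      omega
  have hZ : Z a b = polyZ n (MvPolynomial.X c₀) := (polyZ_X c₀).symm
  have hG : polyZ n (MvPolynomial.X c₀) (F - polyZ n q (oneSymb n)) = polyZ n r (oneSymb n) := by
    rw [map_sub, ← hZ, h, hZ, ← Module.End.mul_apply, ← map_mul, ← LinearMap.sub_apply, ← map_sub,
      ← hpqr, add_sub_cancel_left]
  set G := F - polyZ n q (oneSymb n)
  have hL : degen a b (polyL n (MvPolynomial.X c₀)) = 0 := by
    have : polyL n (MvPolynomial.X c₀) = pL a b := by rw [← chordX_of_lt hab, polyL_chordX]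
    rw [this, degen_pL_self ha hab.ne]
  have hr0 : r = 0 := by
    refine eq_zero_of_separates (ρ := (degen a b).comp (polyL n)) (fun i j k l => ?_) hL hsep hrs
      ?_ fun c hc => ?_
    · rw [AlgHom.comp_apply, polyL_pfaff, map_zero]
    · have h1 := congrFun hG ∅
      rw [polyZ_apply_empty, polyZ_apply_empty, oneSymb_empty, mul_one] at h1
      rw [AlgHom.comp_apply, ← h1, map_mul, hL, zero_mul]
    · have h1 := congrFun hG {c.1.1, c.1.2}
      rw [polyZ_apply_pair, polyZ_apply_pair, oneSymb_empty, mul_one,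
        oneSymb_of_ne (Finset.insert_ne_empty _ _), mul_zero, zero_add,
        pderiv_X_of_ne (Ne.symm hc), map_zero, zero_mul, smul_zero, add_zero] at h1
      have h2 : polyL n (pderiv c r) = (2 : ℂ) • (polyL n (MvPolynomial.X c₀) * G {c.1.1, c.1.2}) := by
        rw [h1, smul_smul]; norm_num
      rw [AlgHom.comp_apply, h2, map_smul, map_mul, hL, zero_mul, smul_zero]
  refine ⟨q, hqs, ?_, ?_⟩
  · rw [← hpqr, hr0, add_zero]
  · rw [hr0, map_zero, LinearMap.zero_apply, ← hZ] at hG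
    exact sub_eq_zero.1 (Z_injective hab.ne (hG.trans (map_zero _).symm))

/-- Division with F = 0 gives p = X_ab q with q again in the kernel, and q has smaller degree. -/
theorem polyZ_injective_of_separates {a b : Fin n} (ha : a.1 = 0) (hab : a < b)
    (hsep : Separates ((degen a b).comp (polyL n)) (chord hab)) {p : MvPolynomial (Chord n) ℂ}
    (hp : UncrossableSupport p) (h : polyZ n p (oneSymb n) = 0) : p = 0 := by
  induction hd : p.totalDegree using Nat.strong_induction_on generalizing p with
  | _ d ih =>
  obtain ⟨q, hq, hpq, h0⟩ := exists_eq_X_mul ha hab hsep hp (F := 0) (by rw [h, map_zero])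
  by_cases hq0 : q = 0
  · rw [hpq, hq0, mul_zero]
  · rw [hpq, ih q.totalDegree ?_ hq h0.symm rfl, mul_zero]
    rw [← hd, hpq, totalDegree_mul_of_isDomain (X_ne_zero _) hq0, totalDegree_X]
    omega

theorem exists_of_polyZ_pow {a b : Fin n} (ha : a.1 = 0) (hab : a < b)
    (hsep : Separates ((degen a b).comp (polyL n)) (chord hab)) {F : Symb n} (N : ℕ)
    {p : MvPolynomial (Chord n) ℂ} (hp : UncrossableSupport p)
    (h : polyZ n (chordX a b ^ N) F = polyZ n p (oneSymb n)) :
    ∃ q, UncrossableSupport q ∧ F = polyZ n q (oneSymb n) := by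
  induction N generalizing p with
  | zero => exact ⟨p, hp, by rw [← h, pow_zero, map_one, Module.End.one_apply]⟩
  | succ N ih =>
    rw [pow_succ', map_mul, Module.End.mul_apply, chordX_of_lt hab, polyZ_X] at h
    obtain ⟨q, hq, -, h'⟩ := exists_eq_X_mul ha hab hsep hp h
    rw [← chordX_of_lt hab] at h'
    exact ih hq h'

theorem exists_separates (hn : n = 4 ∨ n = 5) : ∃ (a b : Fin n) (_ : a.1 = 0) (hab : a < b),
    Separates ((degen a b).comp (polyL n)) (chord hab) := by
  rcases hn with rfl | rfl
  · exact ⟨0, 1, rfl, by decide, separates_degen rfl rfl _ fun m m' => diagExp_inj_four m m' _⟩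
  · exact ⟨0, 1, rfl, by decide, separates_degen rfl rfl _ fun m m' => diagExp_inj_five m m' _⟩

/-- The symbols of the uncrossable monomials are linearly independent. -/
theorem eq_zero_of_polyZ_eq_zero (hn : n = 4 ∨ n = 5) {p : MvPolynomial (Chord n) ℂ}
    (hp : UncrossableSupport p) (h : polyZ n p (oneSymb n) = 0) : p = 0 := by
  obtain ⟨a, b, ha, hab, hsep⟩ := exists_separates hn
  exact polyZ_injective_of_separates ha hab hsep hp h

end TAMA

end

noncomputable section

namespace TAMA

open MvPolynomial

variable {n : ℕ}

/-! ### The homomorphism from the enveloping algebra -/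

attribute [local instance] LieRing.ofAssociativeRing

section Quadratic

variable {R : Type*} [Ring R] [Algebra ℂ R]

/-- The element `∑ B_{kl} f_k g_l`. -/
def quadElt (f g : Fin n → R) (B : Matrix (Fin n) (Fin n) ℂ) : R := ∑ k, ∑ l, B k l • (f k * g l)

theorem quadElt_add (f g : Fin n → R) (A B : Matrix (Fin n) (Fin n) ℂ) :
    quadElt f g (A + B) = quadElt f g A + quadElt f g B := by
  simp only [quadElt, Matrix.add_apply, add_smul, Finset.sum_add_distrib]

theorem quadElt_smul (f g : Fin n → R) (c : ℂ) (B : Matrix (Fin n) (Fin n) ℂ) :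
    quadElt f g (c • B) = c • quadElt f g B := by
  simp only [quadElt, Matrix.smul_apply, smul_eq_mul, mul_smul, Finset.smul_sum]

theorem quadElt_single (f g : Fin n → R) (i j : Fin n) :
    quadElt f g (Matrix.single i j 1) = f i * g j := by
  rw [quadElt, Finset.sum_eq_single i, Finset.sum_eq_single j]
  · simp
  · intro l _ hl; simp [hl.symm]
  · simp
  · intro k _ hk; exact Finset.sum_eq_zero fun l _ => by simp [hk.symm]
  · simp

/-- The commutator with S is a derivation acting on the f_k through A and on the g_k through the
dual action, hence on the coefficient matrix B as the commutator with A. -/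
theorem lie_quadElt {S : R} {f g : Fin n → R} {A : Matrix (Fin n) (Fin n) ℂ}
    (hf : ∀ k, S * f k - f k * S = ∑ i, A i k • f i)
    (hg : ∀ k, S * g k - g k * S = - ∑ j, A k j • g j) (B : Matrix (Fin n) (Fin n) ℂ) :
    S * quadElt f g B - quadElt f g B * S = quadElt f g (A * B - B * A) := by
  have h1 (k l : Fin n) : S * (f k * g l) - f k * g l * S
      = ∑ i, A i k • (f i * g l) - ∑ j, A l j • (f k * g j) := by
    have : S * (f k * g l) - f k * g l * S
        = (S * f k - f k * S) * g l + f k * (S * g l - g l * S) := by noncomm_ring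
    rw [this, hf, hg, Finset.sum_mul, mul_neg, Finset.mul_sum, sub_eq_add_neg]
    simp only [smul_mul_assoc, mul_smul_comm]
  have h2 : S * quadElt f g B - quadElt f g B * S
      = ∑ k, ∑ l, B k l • (S * (f k * g l) - f k * g l * S) := by
    simp only [quadElt, Finset.mul_sum, Finset.sum_mul, mul_smul_comm, smul_mul_assoc, smul_sub,
      Finset.sum_sub_distrib]
  rw [h2]
  simp only [h1, smul_sub, Finset.smul_sum, Finset.sum_sub_distrib]
  simp only [quadElt, Matrix.sub_apply, sub_smul, Finset.sum_sub_distrib, Matrix.mul_apply,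
    Finset.sum_smul, smul_smul]
  congr 1
  · rw [Finset.sum_comm]
    conv_rhs => rw [Finset.sum_comm]
    refine Finset.sum_congr rfl fun l _ => ?_
    rw [Finset.sum_comm]
    exact Finset.sum_congr rfl fun i _ => Finset.sum_congr rfl fun k _ => by rw [mul_comm]
  · exact Finset.sum_congr rfl fun k _ => Finset.sum_comm

/-- Families satisfying the relations between the generators of the Weyl–Clifford algebra. -/
structure IsWeylClifford (x y e : Fin n → R) : Prop where
  xx : ∀ i j, x i * x j = x j * x i
  yy : ∀ i j, y i * y j = y j * y i
  yx : ∀ i j, y i * x j = x j * y i + if i = j then 1 else 0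
  ex : ∀ i j, e i * x j = x j * e i
  ey : ∀ i j, e i * y j = y j * e i
  ee : ∀ i j, e i * e j = - (e j * e i) + if i = j then 2 else 0

variable {x y e : Fin n → R}

/-- The image of a matrix in the Weyl–Clifford algebra. -/
def soOp (x y e : Fin n → R) (A : Matrix (Fin n) (Fin n) ℂ) : R :=
  quadElt x y A + (1 / 4 : ℂ) • quadElt e e A

theorem soOp_tx (h : IsWeylClifford x y e) (A : Matrix (Fin n) (Fin n) ℂ) (k : Fin n) :
    soOp x y e A * x k - x k * soOp x y e A = ∑ i, A i k • x i := by
  have h1 (i j : Fin n) : x i * y j * x k - x k * (x i * y j) = if j = k then x i else 0 := by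
    rw [mul_assoc, h.yx, mul_add, ← mul_assoc, ← mul_assoc, h.xx i k, add_sub_cancel_left]
    split_ifs <;> simp
  have h2 (i j : Fin n) : e i * e j * x k - x k * (e i * e j) = 0 := by
    rw [mul_assoc, h.ex, ← mul_assoc, h.ex, mul_assoc, sub_self]
  have hs : soOp x y e A * x k - x k * soOp x y e A
      = ∑ i, ∑ j, A i j • (x i * y j * x k - x k * (x i * y j))
      + (1 / 4 : ℂ) • ∑ i, ∑ j, A i j • (e i * e j * x k - x k * (e i * e j)) := by
    simp only [soOp, quadElt, add_mul, mul_add, Finset.mul_sum, Finset.sum_mul, mul_smul_comm,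
      smul_mul_assoc, smul_sub, Finset.sum_sub_distrib]
    abel
  rw [hs]
  simp [h1, h2]

theorem soOp_ty (h : IsWeylClifford x y e) (A : Matrix (Fin n) (Fin n) ℂ) (k : Fin n) :
    soOp x y e A * y k - y k * soOp x y e A = - ∑ j, A k j • y j := by
  have h1 (i j : Fin n) : x i * y j * y k - y k * (x i * y j)
      = - if k = i then y j else 0 := by
    rw [mul_assoc, h.yy j k, ← mul_assoc, ← mul_assoc, h.yx, add_mul]
    split_ifs <;> simp
  have h2 (i j : Fin n) : e i * e j * y k - y k * (e i * e j) = 0 := by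
    rw [mul_assoc, h.ey, ← mul_assoc, h.ey, mul_assoc, sub_self]
  have hs : soOp x y e A * y k - y k * soOp x y e A
      = ∑ i, ∑ j, A i j • (x i * y j * y k - y k * (x i * y j))
      + (1 / 4 : ℂ) • ∑ i, ∑ j, A i j • (e i * e j * y k - y k * (e i * e j)) := by
    simp only [soOp, quadElt, add_mul, mul_add, Finset.mul_sum, Finset.sum_mul, mul_smul_comm,
      smul_mul_assoc, smul_sub, Finset.sum_sub_distrib]
    abel
  rw [hs]
  simp only [h1, h2, smul_zero, Finset.sum_const_zero, add_zero]
  rw [Finset.sum_eq_single k]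
  · simp
  · intro b _ hb; simp [hb.symm]
  · simp

/-- Moving e_k through e_i e_j leaves two contractions. By skewness of A each contributes 2 ∑ A_ik
e_i, which explains the factor ¼ in `soOp`. -/
theorem soOp_te (h : IsWeylClifford x y e) {A : Matrix (Fin n) (Fin n) ℂ} (hA : A.transpose = -A) (k : Fin n) :
    soOp x y e A * e k - e k * soOp x y e A = ∑ i, A i k • e i := by
  have h1 (i j : Fin n) : x i * y j * e k - e k * (x i * y j) = 0 := by
    rw [mul_assoc, ← h.ey, ← mul_assoc, ← h.ex, mul_assoc, sub_self]
  have h2 (i j : Fin n) : e i * e j * e k - e k * (e i * e j)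
      = (if j = k then (2 : ℂ) • e i else 0) - if k = i then (2 : ℂ) • e j else 0 := by
    have a1 := h.ee j k
    have a2 := h.ee k i
    rw [mul_assoc, a1, ← mul_assoc, a2, mul_add, add_mul, mul_neg, neg_mul, mul_assoc]
    split_ifs <;> simp [two_smul, mul_two, two_mul]
  have hs : soOp x y e A * e k - e k * soOp x y e A
      = ∑ i, ∑ j, A i j • (x i * y j * e k - e k * (x i * y j))
      + (1 / 4 : ℂ) • ∑ i, ∑ j, A i j • (e i * e j * e k - e k * (e i * e j)) := by
    simp only [soOp, quadElt, add_mul, mul_add, Finset.mul_sum, Finset.sum_mul, mul_smul_comm,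
      smul_mul_assoc, smul_sub, Finset.sum_sub_distrib]
    abel
  rw [hs]
  simp only [h1, h2, smul_zero, Finset.sum_const_zero, zero_add, smul_sub, Finset.sum_sub_distrib]
  have s1 : ∑ i, ∑ j, A i j • (if j = k then (2 : ℂ) • e i else 0 : R)
      = ∑ i, (2 : ℂ) • (A i k • e i) := by
    refine Finset.sum_congr rfl fun i _ => ?_
    simp [smul_comm (2 : ℂ)]
  have s2 : ∑ i, ∑ j, A i j • (if k = i then (2 : ℂ) • e j else 0 : R)
      = - ∑ i, (2 : ℂ) • (A i k • e i) := by
    rw [Finset.sum_eq_single k, ← Finset.sum_neg_distrib]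
    · refine Finset.sum_congr rfl fun i _ => ?_
      have : A k i = - A i k := by
        have := congrFun (congrFun hA i) k
        simpa using this
      rw [if_pos rfl, this, neg_smul, smul_comm (2 : ℂ)]
    · intro b _ hb; simp [hb.symm]
    · simp
  rw [s1, s2, ← Finset.smul_sum]
  module

theorem soOp_lie (h : IsWeylClifford x y e) {A : Matrix (Fin n) (Fin n) ℂ} (hA : A.transpose = -A)
    (B : Matrix (Fin n) (Fin n) ℂ) :
    soOp x y e A * soOp x y e B - soOp x y e B * soOp x y e A = soOp x y e (A * B - B * A) := by
  have h1 := lie_quadElt (soOp_tx h A) (soOp_ty h A) B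
  have h2 := lie_quadElt (S := soOp x y e A) (f := e) (g := e) (soOp_te h hA) (fun k => by
    rw [soOp_te h hA, ← Finset.sum_neg_distrib]
    refine Finset.sum_congr rfl fun i _ => ?_
    have := congrFun (congrFun hA k) i
    rw [← neg_smul, ← Matrix.neg_apply, ← hA, Matrix.transpose_apply]) B
  conv_rhs => rw [soOp, ← h1, ← h2]
  rw [soOp.eq_def x y e B]
  simp only [mul_add, add_mul, mul_smul_comm, smul_mul_assoc]
  module

theorem soOp_commute_sum_ye (h : IsWeylClifford x y e) {A : Matrix (Fin n) (Fin n) ℂ}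
    (hA : A.transpose = -A) :
    soOp x y e A * ∑ j, y j * e j = (∑ j, y j * e j) * soOp x y e A := by
  have hj (j : Fin n) : soOp x y e A * (y j * e j) - y j * e j * soOp x y e A
      = ∑ i, A i j • (y j * e i) - ∑ i, A j i • (y i * e j) := by
    have : soOp x y e A * (y j * e j) - y j * e j * soOp x y e A
        = (soOp x y e A * y j - y j * soOp x y e A) * e j
          + y j * (soOp x y e A * e j - e j * soOp x y e A) := by
      noncomm_ring
    rw [this, soOp_ty h, soOp_te h hA, neg_mul, Finset.sum_mul, Finset.mul_sum]
    simp only [smul_mul_assoc, mul_smul_comm]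
    abel
  rw [← sub_eq_zero, Finset.mul_sum, Finset.sum_mul, ← Finset.sum_sub_distrib]
  simp only [hj, Finset.sum_sub_distrib]
  rw [sub_eq_zero, Finset.sum_comm]

/-- The families x and e both rotate under A, and their pairing ∑ x_j e_j is invariant since A is
skew. -/
theorem soOp_commute_sum_xe (h : IsWeylClifford x y e) {A : Matrix (Fin n) (Fin n) ℂ}
    (hA : A.transpose = -A) :
    soOp x y e A * ∑ j, x j * e j = (∑ j, x j * e j) * soOp x y e A := by
  have hj (j : Fin n) : soOp x y e A * (x j * e j) - x j * e j * soOp x y e A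
      = ∑ i, A i j • (x i * e j) + ∑ i, A i j • (x j * e i) := by
    have : soOp x y e A * (x j * e j) - x j * e j * soOp x y e A
        = (soOp x y e A * x j - x j * soOp x y e A) * e j
          + x j * (soOp x y e A * e j - e j * soOp x y e A) := by
      noncomm_ring
    rw [this, soOp_tx h, soOp_te h hA, Finset.sum_mul, Finset.mul_sum]
    simp only [smul_mul_assoc, mul_smul_comm]
  rw [← sub_eq_zero, Finset.mul_sum, Finset.sum_mul, ← Finset.sum_sub_distrib]
  simp only [hj, Finset.sum_add_distrib]
  rw [Finset.sum_comm, ← Finset.sum_add_distrib]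
  refine Finset.sum_eq_zero fun j _ => ?_
  rw [← Finset.sum_add_distrib]
  refine Finset.sum_eq_zero fun i _ => ?_
  have : A i j = - A j i := by
    have := congrFun (congrFun hA j) i
    simpa using this
  rw [this, neg_smul]
  abel

/-- The Lie algebra homomorphism `A ↦ ∑ A_{ij} (x_i y_j + e_i e_j / 4)`. -/
def soHom (h : IsWeylClifford x y e) : LieAlgebra.Orthogonal.so (Fin n) ℂ →ₗ⁅ℂ⁆ R where
  toFun A := soOp x y e A.1
  map_add' A B := by
    change soOp x y e (A.1 + B.1) = _
    simp only [soOp, quadElt_add]; module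
  map_smul' c A := by
    change soOp x y e (c • A.1) = _
    simp only [soOp, quadElt_smul, RingHom.id_apply]; module
  map_lie' {A B} := by
    rw [Ring.lie_def, soOp_lie h ((LieAlgebra.Orthogonal.mem_so _ _ _).1 A.2)]
    rfl

theorem soOp_single_sub (h : IsWeylClifford x y e) {i j : Fin n} (hij : i ≠ j) :
    soOp x y e (Matrix.single i j 1 - Matrix.single j i 1)
      = (x i * y j - x j * y i) + (1 / 2 : ℂ) • (e i * e j) := by
  have hs : (Matrix.single i j 1 - Matrix.single j i 1 : Matrix (Fin n) (Fin n) ℂ)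
      = Matrix.single i j 1 + (-1 : ℂ) • Matrix.single j i 1 := by
    rw [neg_one_smul, sub_eq_add_neg]
  have hji := h.ee j i
  rw [if_neg hij.symm, add_zero] at hji
  rw [hs, soOp, quadElt_add, quadElt_add, quadElt_smul, quadElt_smul]
  simp only [quadElt_single]
  rw [hji]
  module

end Quadratic

theorem isWeylClifford_WC : IsWeylClifford (R := WC n) (fun i => wx i ⊗ₜ[ℂ] 1)
    (fun i => wy i ⊗ₜ[ℂ] 1) (fun i => 1 ⊗ₜ[ℂ] ce i) where
  xx i j := by simp only [Algebra.TensorProduct.tmul_mul_tmul, (wx_comm i j).eq]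
  yy i j := by simp only [Algebra.TensorProduct.tmul_mul_tmul, (wy_comm i j).eq]
  yx i j := by
    simp only [Algebra.TensorProduct.tmul_mul_tmul, wy_mul_wx, TensorProduct.add_tmul, mul_one]
    split_ifs <;> simp [Algebra.TensorProduct.one_def]
  ex i j := by simp only [Algebra.TensorProduct.tmul_mul_tmul, one_mul, mul_one]
  ey i j := by simp only [Algebra.TensorProduct.tmul_mul_tmul, one_mul, mul_one]
  ee i j := by
    refine eq_neg_add_of_add_eq ?_
    rw [Algebra.TensorProduct.tmul_mul_tmul, Algebra.TensorProduct.tmul_mul_tmul, mul_one,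
      ← TensorProduct.tmul_add, ce_mul_add]
    by_cases hij : i = j
    · rw [if_pos hij, if_pos hij.symm]; rw [← one_add_one_eq_two, ← one_add_one_eq_two, TensorProduct.tmul_add]; rfl
    · rw [if_neg hij, if_neg (Ne.symm hij)]; exact TensorProduct.tmul_zero _ _

/-- The action of a matrix in the Weyl–Clifford algebra. -/
def soWC (A : Matrix (Fin n) (Fin n) ℂ) : WC n :=
  soOp (R := WC n) (fun i => wx i ⊗ₜ[ℂ] 1) (fun i => wy i ⊗ₜ[ℂ] 1) (fun i => 1 ⊗ₜ[ℂ] ce i) A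

/-- The homomorphism `U(𝔰𝔬(n)) → 𝒲 ⊗ 𝒞`. -/
def usoHom (n : ℕ) : Uso n →ₐ[ℂ] WC n :=
  UniversalEnvelopingAlgebra.lift ℂ (A := WC n) (soHom isWeylClifford_WC)

theorem soWC_single_sub {i j : Fin n} (hij : i ≠ j) :
    soWC (Matrix.single i j 1 - Matrix.single j i 1) = O i j := by
  refine (soOp_single_sub isWeylClifford_WC hij).trans ?_
  simp only [O, Algebra.TensorProduct.tmul_mul_tmul, mul_one]
  congr 1
  exact (TensorProduct.sub_tmul _ _ _).symm

theorem usoHom_X {i j : Fin n} (hij : i ≠ j) : usoHom n (X i j) = O i j := by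
  rw [usoHom, X, UniversalEnvelopingAlgebra.lift_ι_apply]
  exact soWC_single_sub hij

theorem soWC_commute_dirac {A : Matrix (Fin n) (Fin n) ℂ} (hA : A.transpose = -A) :
    soWC A * dirac n = dirac n * soWC A := by
  have hd : dirac n = ∑ j : Fin n, (wy j ⊗ₜ[ℂ] 1) * (1 ⊗ₜ[ℂ] ce j) := by
    simp only [dirac, Algebra.TensorProduct.tmul_mul_tmul, one_mul, mul_one]
  rw [hd]
  exact soOp_commute_sum_ye isWeylClifford_WC hA

theorem soWC_commute_vecVar {A : Matrix (Fin n) (Fin n) ℂ} (hA : A.transpose = -A) :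
    soWC A * vecVar n = vecVar n * soWC A := by
  have hd : vecVar n = ∑ j : Fin n, (wx j ⊗ₜ[ℂ] 1) * (1 ⊗ₜ[ℂ] ce j) := by
    simp only [vecVar, Algebra.TensorProduct.tmul_mul_tmul, one_mul, mul_one]
  rw [hd]
  exact soOp_commute_sum_xe isWeylClifford_WC hA

theorem O_mem_evenTama {i j : Fin n} (hij : i ≠ j) : O i j ∈ evenTama n := by
  have he : O i j ∈ evenWC n := by
    have h1 : (wx i * wy j - wx j * wy i) ⊗ₜ[ℂ] (1 : Cliff n) ∈ evenWC n :=
      ⟨(wx i * wy j - wx j * wy i) ⊗ₜ[ℂ] 1, by simp⟩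
    have h2 : (1 : Weyl n) ⊗ₜ[ℂ] (ce i * ce j) ∈ evenWC n :=
      ⟨1 ⊗ₜ[ℂ] ⟨ce i * ce j, CliffordAlgebra.ι_mul_ι_mem_evenOdd_zero _ _ _⟩, by simp⟩
    exact Subalgebra.add_mem _ h1 (Subalgebra.smul_mem _ h2 _)
  have hA : (soElt i j).1.transpose = -(soElt i j).1 :=
    (LieAlgebra.Orthogonal.mem_so _ _ _).1 (soElt i j).2
  have hd : O i j * dirac n = dirac n * O i j := by
    rw [← soWC_single_sub hij]; exact soWC_commute_dirac hA
  have hv : O i j * vecVar n = vecVar n * O i j := by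
    rw [← soWC_single_sub hij]; exact soWC_commute_vecVar hA
  have hdd : Commute (O i j) (dirac n) := hd
  have hvv : Commute (O i j) (vecVar n) := hv
  refine ⟨⟨fun s hs => ?_, fun s hs => ?_⟩, he⟩
  · change Commute (O i j) s
    induction hs using Submodule.span_induction with
    | mem x hx =>
      rcases hx with rfl | rfl | rfl
      · exact hdd.mul_right hdd
      · exact hvv.mul_right hvv
      · exact (hdd.mul_right hvv).add_right (hvv.mul_right hdd)
    | zero => exact Commute.zero_right _
    | add x y _ _ hx hy => exact hx.add_right hy
    | smul c x _ hx => exact hx.smul_right c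
  · rw [parity_of_mem_evenWC he]
    change Commute (O i j) s
    induction hs using Submodule.span_induction with
    | mem x hx =>
      rcases hx with rfl | rfl
      · exact hdd
      · exact hvv
    | zero => exact Commute.zero_right _
    | add x y _ _ hx hy => exact hx.add_right hy
    | smul c x _ hx => exact hx.smul_right c

end TAMA

end

noncomputable section

namespace TAMA

variable {n : ℕ}

/-! ### Families with the commutation relations of `𝔰𝔬(n)` -/

section Family

variable {R : Type*} [Ring R]

/-- The family satisfies the commutation relations of the elements `E_{ij} - E_{ji}`. -/
structure IsSoFamily (g : Fin n → Fin n → R) : Prop where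
  swap : ∀ {i j}, i ≠ j → g j i = - g i j
  comm : ∀ {i j k l}, i ≠ j → k ≠ l → i ≠ k → i ≠ l → j ≠ k → j ≠ l → g i j * g k l = g k l * g i j
  bracket : ∀ {i j k}, i ≠ j → j ≠ k → i ≠ k → g i j * g j k - g j k * g i j = g i k

/-- The Pfaffian `g_{12} g_{34} + g_{13} g_{42} + g_{14} g_{23}`. -/
def pf (g : Fin n → Fin n → R) (A : Fin 4 → Fin n) : R :=
  g (A 0) (A 1) * g (A 2) (A 3) + g (A 0) (A 2) * g (A 3) (A 1) + g (A 0) (A 3) * g (A 1) (A 2)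

theorem IsSoFamily.map {S : Type*} [Ring S] {g : Fin n → Fin n → R} (hg : IsSoFamily g)
    (f : R →+* S) {g' : Fin n → Fin n → S} (hf : ∀ i j, i ≠ j → f (g i j) = g' i j) :
    IsSoFamily g' where
  swap {i j} h := by rw [← hf _ _ h, ← hf _ _ h.symm, hg.swap h, map_neg]
  comm {i j k l} h h' a b c d := by
    rw [← hf _ _ h, ← hf _ _ h', ← map_mul, hg.comm h h' a b c d, map_mul]
  bracket {i j k} h h' h'' := by
    rw [← hf _ _ h, ← hf _ _ h', ← hf _ _ h'', ← map_mul, ← map_mul, ← map_sub, hg.bracket h h' h'']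

theorem pf_swap {g : Fin n → Fin n → R} (hg : IsSoFamily g) {A : Fin 4 → Fin n}
    (hA : Function.Injective A) {p q : Fin 4} (hpq : p ≠ q) :
    pf g (A ∘ Equiv.swap p q) = - pf g A := by
  have ne {p q : Fin 4} (h : p ≠ q) : A p ≠ A q := hA.ne h
  have s10 := hg.swap (ne (show (0 : Fin 4) ≠ 1 by decide))
  have s20 := hg.swap (ne (show (0 : Fin 4) ≠ 2 by decide))
  have s30 := hg.swap (ne (show (0 : Fin 4) ≠ 3 by decide))
  have s21 := hg.swap (ne (show (1 : Fin 4) ≠ 2 by decide))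
  have s31 := hg.swap (ne (show (1 : Fin 4) ≠ 3 by decide))
  have s32 := hg.swap (ne (show (2 : Fin 4) ≠ 3 by decide))
  have c1 := hg.comm (ne (show (2 : Fin 4) ≠ 3 by decide)) (ne (show (0 : Fin 4) ≠ 1 by decide))
    (ne (by decide)) (ne (by decide)) (ne (by decide)) (ne (by decide))
  have c2 := hg.comm (ne (show (1 : Fin 4) ≠ 3 by decide)) (ne (show (0 : Fin 4) ≠ 2 by decide))
    (ne (by decide)) (ne (by decide)) (ne (by decide)) (ne (by decide))
  have c3 := hg.comm (ne (show (1 : Fin 4) ≠ 2 by decide)) (ne (show (0 : Fin 4) ≠ 3 by decide))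
    (ne (by decide)) (ne (by decide)) (ne (by decide)) (ne (by decide))
  have sw (x : Fin 4) : Equiv.swap p q x = if x = p then q else if x = q then p else x :=
    Equiv.swap_apply_def p q x
  simp only [pf, Function.comp_apply, sw]
  clear sw
  fin_cases p <;> fin_cases q <;> first
    | exact absurd rfl hpq
    | (simp [s10, s20, s30, s21, s31, s32, c1, c2, c3]; try abel)

/-- The sign is left unspecified, since the result serves only for membership in a linear subspace.
-/
theorem pf_perm {g : Fin n → Fin n → R} (hg : IsSoFamily g) (σ : Equiv.Perm (Fin 4))
    {A : Fin 4 → Fin n} (hA : Function.Injective A) :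
    pf g (A ∘ σ) = pf g A ∨ pf g (A ∘ σ) = - pf g A := by
  induction σ using Equiv.Perm.swap_induction_on' with
  | one => exact Or.inl rfl
  | mul_swap σ p q hpq ih =>
    have : pf g (A ∘ ⇑(σ * Equiv.swap p q)) = - pf g (A ∘ σ) :=
      pf_swap hg (hA.comp σ.injective) hpq
    rw [this]
    rcases ih with h | h
    · right; rw [h]
    · left; rw [h, neg_neg]

/-- Two sequences which differ in the position `p` only. -/
def DifferAt (p : Fin 4) (A B : Fin 4 → Fin n) : Prop :=
  (∀ q, A p ≠ B q) ∧ (∀ q, B p ≠ A q) ∧ ∀ q, q ≠ p → A q = B q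

theorem DifferAt.symm {p : Fin 4} {A B : Fin 4 → Fin n} (h : DifferAt p A B) : DifferAt p B A :=
  ⟨h.2.1, h.1, fun q hq => (h.2.2 q hq).symm⟩

/-- The rotation generator in the plane of A_p and B_p acts on the letters with indices in A by
substituting B_p for A_p. -/
theorem bracket_of_differAt {g : Fin n → Fin n → R} (hg : IsSoFamily g) {A B : Fin 4 → Fin n}
    (hA : Function.Injective A) {p : Fin 4} (h : DifferAt p A B) {r s : Fin 4} (hrs : r ≠ s) :
    g (B p) (A p) * g (A r) (A s) = g (A r) (A s) * g (B p) (A p)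
      + if r = p ∨ s = p then g (B r) (B s) else 0 := by
  have hne : B p ≠ A p := h.2.1 p
  by_cases hr : r = p
  · subst hr
    have hs : s ≠ r := hrs.symm
    have hb := hg.bracket hne (hA.ne hrs) (h.2.1 s)
    rw [if_pos (Or.inl rfl), ← h.2.2 s hs, ← hb]; abel
  · by_cases hs : s = p
    · subst hs
      have hb := hg.bracket hne (hA.ne hrs.symm) (h.2.1 r)
      rw [if_pos (Or.inr rfl), ← h.2.2 r hr, hg.swap (hA.ne hrs.symm), hg.swap (h.2.1 r), ← hb]
      noncomm_ring
    · rw [if_neg (by tauto), add_zero]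
      exact hg.comm hne (hA.ne hrs) (h.2.1 r) (h.2.1 s) (hA.ne (Ne.symm hr)) (hA.ne (Ne.symm hs))

theorem pf_of_differAt {g : Fin n → Fin n → R} (hg : IsSoFamily g) {A B : Fin 4 → Fin n}
    (hA : Function.Injective A) {p : Fin 4} (h : DifferAt p A B) :
    g (B p) (A p) * pf g A = pf g A * g (B p) (A p) + pf g B := by
  have hb {r s : Fin 4} (hrs : r ≠ s) := bracket_of_differAt hg hA h hrs
  have key (a b c d : Fin 4) (hab : a ≠ b) (hcd : c ≠ d) :
      g (B p) (A p) * (g (A a) (A b) * g (A c) (A d))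
      = g (A a) (A b) * g (A c) (A d) * g (B p) (A p)
        + ((if a = p ∨ b = p then g (B a) (B b) * g (A c) (A d) else 0)
        + if c = p ∨ d = p then g (A a) (A b) * g (B c) (B d) else 0) := by
    rw [← mul_assoc, hb hab, add_mul, mul_assoc, hb hcd]
    split_ifs <;> noncomm_ring
  rw [pf, mul_add, mul_add, key _ _ _ _ (by decide) (by decide), key _ _ _ _ (by decide) (by decide),
    key _ _ _ _ (by decide) (by decide), pf]
  have e := h.2.2
  have e0 := e 0
  have e1 := e 1
  have e2 := e 2
  have e3 := e 3
  clear key hb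
  fin_cases p <;> simp at e0 e1 e2 e3 <;> simp [*] <;> noncomm_ring

/-- The left-hand side of the quadratic relations between Pfaffians. -/
def tabTerm (g : Fin n → Fin n → R) (A B : Fin 4 → Fin n) : R :=
  (2 * pf g A) * (2 * pf g B) +
    ∑ q : Fin 4 × Fin 4 with q.1 < q.2 ∧ ∀ p, p ≠ q.1 → p ≠ q.2 → A p = B p,
      g (A q.1) (A q.2) * g (B q.1) (B q.2)

/-- The same substitution, applied as a derivation to a quadratic expression in A, produces its
polarisation. The common pairs of A and B are those whose removal leaves the position p, so only the
summands containing p survive. -/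
theorem tabTerm_of_differAt {g : Fin n → Fin n → R} (hg : IsSoFamily g) {A B : Fin 4 → Fin n}
    (hA : Function.Injective A) {p : Fin 4} (h : DifferAt p A B) :
    g (B p) (A p) * tabTerm g A A = tabTerm g A A * g (B p) (A p) + (tabTerm g A B + tabTerm g B A) := by
  have hpf := pf_of_differAt hg hA h
  have hf (q : Fin 4 × Fin 4) : (q.1 < q.2 ∧ ∀ r, r ≠ q.1 → r ≠ q.2 → A r = B r) ↔
      (q.1 < q.2 ∧ (q.1 = p ∨ q.2 = p)) := by
    refine and_congr_right fun _ => ⟨fun hr => ?_, fun hr r h1 h2 => ?_⟩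
    · by_contra hc
      rw [not_or] at hc
      exact h.1 p (hr p (Ne.symm hc.1) (Ne.symm hc.2))
    · refine h.2.2 r ?_
      rintro rfl
      rcases hr with hr | hr
      · exact h1 hr.symm
      · exact h2 hr.symm
  have hf' (q : Fin 4 × Fin 4) : (q.1 < q.2 ∧ ∀ r, r ≠ q.1 → r ≠ q.2 → B r = A r) ↔
      (q.1 < q.2 ∧ (q.1 = p ∨ q.2 = p)) := by
    rw [← hf]; simp only [eq_comm]
  simp only [tabTerm, hf, hf', implies_true, and_true]
  have hs : g (B p) (A p) * ∑ q : Fin 4 × Fin 4 with q.1 < q.2, g (A q.1) (A q.2) * g (A q.1) (A q.2)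
      = (∑ q : Fin 4 × Fin 4 with q.1 < q.2, g (A q.1) (A q.2) * g (A q.1) (A q.2)) * g (B p) (A p)
      + (∑ q : Fin 4 × Fin 4 with q.1 < q.2 ∧ (q.1 = p ∨ q.2 = p),
          g (A q.1) (A q.2) * g (B q.1) (B q.2)
        + ∑ q : Fin 4 × Fin 4 with q.1 < q.2 ∧ (q.1 = p ∨ q.2 = p),
          g (B q.1) (B q.2) * g (A q.1) (A q.2)) := by
    rw [← Finset.sum_add_distrib, Finset.mul_sum, Finset.sum_mul, ← Finset.filter_filter,
      Finset.sum_filter (fun q : Fin 4 × Fin 4 => q.1 = p ∨ q.2 = p), ← Finset.sum_add_distrib]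
    refine Finset.sum_congr rfl fun q hq => ?_
    rw [← mul_assoc, bracket_of_differAt hg hA h (Finset.mem_filter.1 hq).2.ne, add_mul, mul_assoc,
      bracket_of_differAt hg hA h (Finset.mem_filter.1 hq).2.ne]
    split_ifs <;> noncomm_ring
  rw [mul_add, hs, add_mul]
  have hp : g (B p) (A p) * (2 * pf g A * (2 * pf g A))
      = 2 * pf g A * (2 * pf g A) * g (B p) (A p) + (2 * pf g A * (2 * pf g B) + 2 * pf g B * (2 * pf g A)) := by
    have : g (B p) (A p) * (2 * pf g A * (2 * pf g A))
      = 4 * ((g (B p) (A p) * pf g A) * pf g A) := by noncomm_ring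
    rw [this, hpf, add_mul, mul_assoc, hpf]
    noncomm_ring
  rw [hp]
  abel

/-- A central element has zero bracket with the rotation generator. The relations with A ≠ B
therefore follow from those with A = B. -/
theorem tabTerm_add_eq_zero {g : Fin n → Fin n → R} (hg : IsSoFamily g) {A B : Fin 4 → Fin n}
    (hA : Function.Injective A) {p : Fin 4} (h : DifferAt p A B)
    (hc : ∀ a, a * tabTerm g A A = tabTerm g A A * a) : tabTerm g A B + tabTerm g B A = 0 :=
  left_eq_add.1 ((hc _).symm.trans (tabTerm_of_differAt hg hA h))

theorem pf_eq {g : Fin n → Fin n → R} (hg : IsSoFamily g) {A : Fin 4 → Fin n}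
    (hA : Function.Injective A) : pf g A = g (A 0) (A 1) * g (A 2) (A 3)
      - g (A 0) (A 2) * g (A 1) (A 3) + g (A 0) (A 3) * g (A 1) (A 2) := by
  rw [pf, hg.swap (hA.ne (show (1 : Fin 4) ≠ 3 by decide)), mul_neg, ← sub_eq_add_neg]

end Family

/-- Differing in two positions would require six distinct indices. -/
theorem aligned_cases (hn : n ≤ 5) {A B : Fin 4 → Fin n} (h : Aligned A B) :
    A = B ∨ ∃ p, DifferAt p A B := by
  obtain ⟨hA, hB, hAB⟩ := h
  by_cases hall : ∀ p, A p = B p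
  · exact Or.inl (funext hall)
  · right
    push Not at hall
    obtain ⟨p, hp⟩ := hall
    have ne {p : Fin 4} (hp : A p ≠ B p) (q : Fin 4) : A p ≠ B q := by
      intro h
      have := hAB p q h
      subst this
      exact hp h
    have ne' {p : Fin 4} (hp : A p ≠ B p) (q : Fin 4) : B p ≠ A q := by
      intro h
      have := hAB q p h.symm
      subst this
      exact hp h.symm
    refine ⟨p, ne hp, ne' hp, fun q hq => ?_⟩
    by_contra hqp
    have h1 : (insert (B p) (insert (B q) (Finset.univ.image A))).card = 6 := by
      rw [Finset.card_insert_of_notMem, Finset.card_insert_of_notMem,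
        Finset.card_image_of_injective _ hA, Finset.card_univ, Fintype.card_fin]
      · simp only [Finset.mem_image, Finset.mem_univ, true_and, not_exists]
        exact fun r => (ne' hqp r).symm
      · simp only [Finset.mem_insert, Finset.mem_image, Finset.mem_univ, true_and, not_or, not_exists]
        exact ⟨hB.ne hq.symm, fun r => (ne' hp r).symm⟩
    have h2 := Finset.card_le_univ (insert (B p) (insert (B q) (Finset.univ.image A)))
    rw [h1, Fintype.card_fin] at h2
    omega

theorem tableauTerm_eq (A B : Fin 4 → Fin n) : tableauTerm A B = tabTerm X A B := rfl

theorem tableauRel_self (A : Fin 4 → Fin n) : tableauRel A A = 16 * tabTerm X A A - 12 := by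
  have : ∀ S, exchange S A A = A := fun S => funext fun p => by simp [exchange]
  rw [tableauRel, if_pos rfl]
  simp only [this, Finset.sum_const, ← tableauTerm_eq]
  rw [show (Finset.univ : Finset (Finset (Fin 4))).card = 16 by simp, nsmul_eq_mul]
  norm_num

/-- An exchange changes something only at p, and eight of the sixteen subsets contain p. -/
theorem tableauRel_of_differAt {A B : Fin 4 → Fin n} {p : Fin 4} (h : DifferAt p A B) :
    tableauRel A B = 8 * (tabTerm X A B + tabTerm X B A) := by
  have hne : A ≠ B := fun hAB => h.1 p (congrFun hAB p)
  have e1 (S : Finset (Fin 4)) : tableauTerm (exchange S A B) (exchange S B A)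
      = if p ∈ S then tabTerm X B A else tabTerm X A B := by
    have f (A B : Fin 4 → Fin n) (h : DifferAt p A B) : exchange S A B = if p ∈ S then B else A := by
      funext q
      by_cases hq : q = p
      · subst hq; by_cases hS : q ∈ S <;> simp [exchange, hS]
      · have := h.2.2 q hq
        by_cases hS : p ∈ S <;> simp [exchange, hS, this]
    rw [f A B h, f B A h.symm]
    split_ifs <;> rfl
  rw [tableauRel, if_neg hne, sub_zero]
  simp only [e1]
  rw [Finset.sum_ite, Finset.sum_const, Finset.sum_const]
  have c1 : (Finset.univ.filter fun S : Finset (Fin 4) => p ∈ S).card = 8 := by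
    clear h e1; revert p; decide
  have c2 : (Finset.univ.filter fun S : Finset (Fin 4) => p ∉ S).card = 8 := by
    clear h e1 c1; revert p; decide
  rw [c1, c2, nsmul_eq_mul, nsmul_eq_mul, mul_add, add_comm]
  norm_num

end TAMA

end

noncomputable section

namespace TAMA

variable {n : ℕ}

/-! ### The square of a Pfaffian -/

section Chirality

set_option linter.unusedSimpArgs false

variable {R : Type*} [Ring R]

theorem mul_left_swap {a b c : R} (h : a * b = b * a + c) (z : R) :
    a * (b * z) = b * (a * z) + c * z := by
  rw [← mul_assoc, h, add_mul, mul_assoc]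

theorem mul_left_anti {a b : R} (h : a * b = - (b * a)) (z : R) : a * (b * z) = - (b * (a * z)) := by
  rw [← mul_assoc, h, neg_mul, mul_assoc]

theorem mul_left_one {a : R} (h : a * a = 1) (z : R) : a * (a * z) = z := by
  rw [← mul_assoc, h, one_mul]

/-- Four anticommuting square roots of one. -/
structure IsClifford (e₀ e₁ e₂ e₃ : R) : Prop where
  s0 : e₀ * e₀ = 1
  s1 : e₁ * e₁ = 1
  s2 : e₂ * e₂ = 1
  s3 : e₃ * e₃ = 1
  a10 : e₁ * e₀ = - (e₀ * e₁)
  a20 : e₂ * e₀ = - (e₀ * e₂)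
  a30 : e₃ * e₀ = - (e₀ * e₃)
  a21 : e₂ * e₁ = - (e₁ * e₂)
  a31 : e₃ * e₁ = - (e₁ * e₃)
  a32 : e₃ * e₂ = - (e₂ * e₃)

/-- The commutation relations of `𝔰𝔬(4)` and the Plücker relation. -/
structure IsPlucker (l01 l02 l03 l12 l13 l23 : R) : Prop where
  r1 : l02 * l01 = l01 * l02 + l12
  r2 : l03 * l01 = l01 * l03 + l13
  r3 : l03 * l02 = l02 * l03 + l23
  r4 : l12 * l01 = l01 * l12 - l02
  r5 : l13 * l01 = l01 * l13 - l03
  r6 : l12 * l02 = l02 * l12 + l01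
  r7 : l23 * l02 = l02 * l23 - l03
  r8 : l13 * l03 = l03 * l13 + l01
  r9 : l23 * l03 = l03 * l23 + l02
  r10 : l13 * l12 = l12 * l13 + l23
  r11 : l23 * l12 = l12 * l23 - l13
  r12 : l23 * l13 = l13 * l23 + l12
  c1 : l23 * l01 = l01 * l23
  c2 : l13 * l02 = l02 * l13
  c3 : l12 * l03 = l02 * l13 - l01 * l23
  c4 : l03 * l12 = l02 * l13 - l01 * l23

/-- In the square of the spin-orbit element, equal pairs give −∑ L², pairs sharing one index give
commutators of the L's that reassemble to twice the element, and disjoint pairs give a multiple of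
the Pfaffian of the L's, which is zero. -/
theorem gamma_sq {e₀ e₁ e₂ e₃ l01 l02 l03 l12 l13 l23 : R} (he : IsClifford e₀ e₁ e₂ e₃)
    (hl : IsPlucker l01 l02 l03 l12 l13 l23)
    (h : ∀ l ∈ ({l01, l02, l03, l12, l13, l23} : Set R), ∀ e ∈ ({e₀, e₁, e₂, e₃} : Set R),
      e * l = l * e) :
    (l01 * (e₀ * e₁) + l02 * (e₀ * e₂) + l03 * (e₀ * e₃) + l12 * (e₁ * e₂) + l13 * (e₁ * e₃)
      + l23 * (e₂ * e₃)) * (l01 * (e₀ * e₁) + l02 * (e₀ * e₂) + l03 * (e₀ * e₃) + l12 * (e₁ * e₂)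
      + l13 * (e₁ * e₃) + l23 * (e₂ * e₃))
      = 2 * (l01 * (e₀ * e₁) + l02 * (e₀ * e₂) + l03 * (e₀ * e₃) + l12 * (e₁ * e₂)
      + l13 * (e₁ * e₃) + l23 * (e₂ * e₃))
      - (l01 * l01 + l02 * l02 + l03 * l03 + l12 * l12 + l13 * l13 + l23 * l23) := by
  have key (l l' a b c d : R) (hl : l' ∈ ({l01, l02, l03, l12, l13, l23} : Set R))
      (ha : a ∈ ({e₀, e₁, e₂, e₃} : Set R)) (hb : b ∈ ({e₀, e₁, e₂, e₃} : Set R)) :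
      l * (a * b) * (l' * (c * d)) = (l * l') * (a * (b * (c * d))) := by
    have h1 := h l' hl a ha
    have h2 := h l' hl b hb
    calc l * (a * b) * (l' * (c * d)) = l * (a * (b * l') * (c * d)) := by noncomm_ring
      _ = l * ((a * l') * b * (c * d)) := by rw [h2]; noncomm_ring
      _ = _ := by rw [h1]; noncomm_ring
  have k (l l' a b c d : R) (hl : l' = l01 ∨ l' = l02 ∨ l' = l03 ∨ l' = l12 ∨ l' = l13 ∨ l' = l23)
      (ha : a = e₀ ∨ a = e₁ ∨ a = e₂ ∨ a = e₃) (hb : b = e₀ ∨ b = e₁ ∨ b = e₂ ∨ b = e₃) :=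
    key l l' a b c d hl ha hb
  simp only [mul_add, add_mul, k, true_or, or_true,
    hl.r1, hl.r2, hl.r3, hl.r4, hl.r5, hl.r6, hl.r7, hl.r8, hl.r9, hl.r10, hl.r11, hl.r12, hl.c1,
    hl.c2, hl.c3, hl.c4, sub_mul,
    he.s0, he.s1, he.s2, he.s3, he.a10, he.a20, he.a30, he.a21, he.a31, he.a32,
    mul_left_one he.s0, mul_left_one he.s1, mul_left_one he.s2, mul_left_one he.s3,
    mul_left_anti he.a10, mul_left_anti he.a20, mul_left_anti he.a30, mul_left_anti he.a21,
    mul_left_anti he.a31, mul_left_anti he.a32, mul_neg, neg_neg, mul_one]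
  noncomm_ring

/-- Let w = e₀e₁e₂e₃, so that w² = 1, and let Γ be the spin-orbit element, which commutes with w.
The Pfaffian is w (3/4 − Γ/2), so four times its square is 9/4 − 3Γ + Γ² = 9/4 − Γ − ∑ L². The sum
of the squares of the o's is ∑ L² + Γ − 3/2, and the total is 3/4. -/
theorem four_mul_pf_sq [Algebra ℂ R] {e₀ e₁ e₂ e₃ l01 l02 l03 l12 l13 l23 : R}
    (he : IsClifford e₀ e₁ e₂ e₃) (hl : IsPlucker l01 l02 l03 l12 l13 l23)
    (h : ∀ l ∈ ({l01, l02, l03, l12, l13, l23} : Set R), ∀ e ∈ ({e₀, e₁, e₂, e₃} : Set R),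
      e * l = l * e) {o01 o02 o03 o12 o13 o23 : R}
    (h01 : o01 = l01 + (1 / 2 : ℂ) • (e₀ * e₁)) (h02 : o02 = l02 + (1 / 2 : ℂ) • (e₀ * e₂))
    (h03 : o03 = l03 + (1 / 2 : ℂ) • (e₀ * e₃)) (h12 : o12 = l12 + (1 / 2 : ℂ) • (e₁ * e₂))
    (h13 : o13 = l13 + (1 / 2 : ℂ) • (e₁ * e₃)) (h23 : o23 = l23 + (1 / 2 : ℂ) • (e₂ * e₃)) :
    (4 : ℂ) • ((o01 * o23 - o02 * o13 + o03 * o12) * (o01 * o23 - o02 * o13 + o03 * o12))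
      + (o01 * o01 + o02 * o02 + o03 * o03 + o12 * o12 + o13 * o13 + o23 * o23)
      = (3 / 4 : ℂ) • (1 : R) := by
  have hc (l a b : R) (hl : l = l01 ∨ l = l02 ∨ l = l03 ∨ l = l12 ∨ l = l13 ∨ l = l23)
      (ha : a = e₀ ∨ a = e₁ ∨ a = e₂ ∨ a = e₃) (hb : b = e₀ ∨ b = e₁ ∨ b = e₂ ∨ b = e₃) :
      a * b * l = l * (a * b) := by
    rw [mul_assoc, h l hl b hb, ← mul_assoc, h l hl a ha, mul_assoc]
  have hcl (l a b z : R) (hl : l = l01 ∨ l = l02 ∨ l = l03 ∨ l = l12 ∨ l = l13 ∨ l = l23)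
      (ha : a = e₀ ∨ a = e₁ ∨ a = e₂ ∨ a = e₃) (hb : b = e₀ ∨ b = e₁ ∨ b = e₂ ∨ b = e₃) :
      a * (b * (l * z)) = l * (a * (b * z)) := by
    rw [← mul_assoc, ← mul_assoc, hc l a b hl ha hb, mul_assoc, mul_assoc]
  have hcr (l a b : R) (hl : l = l01 ∨ l = l02 ∨ l = l03 ∨ l = l12 ∨ l = l13 ∨ l = l23)
      (ha : a = e₀ ∨ a = e₁ ∨ a = e₂ ∨ a = e₃) (hb : b = e₀ ∨ b = e₁ ∨ b = e₂ ∨ b = e₃) :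
      a * (b * l) = l * (a * b) := by
    rw [← mul_assoc, hc l a b hl ha hb]
  have hg := gamma_sq he hl h
  set Γ := l01 * (e₀ * e₁) + l02 * (e₀ * e₂) + l03 * (e₀ * e₃) + l12 * (e₁ * e₂) + l13 * (e₁ * e₃)
      + l23 * (e₂ * e₃) with hΓ
  set w := e₀ * (e₁ * (e₂ * e₃)) with hw
  have hww : w * w = 1 := by
    simp only [hw, mul_assoc,
      he.s0, he.s1, he.s2, he.s3, he.a10, he.a20, he.a30, he.a21, he.a31, he.a32,
      mul_left_one he.s0, mul_left_one he.s1, mul_left_one he.s2, mul_left_one he.s3,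
      mul_left_anti he.a10, mul_left_anti he.a20, mul_left_anti he.a30, mul_left_anti he.a21,
      mul_left_anti he.a31, mul_left_anti he.a32, mul_neg, neg_neg, mul_one]
  have hwΓ : w * Γ = Γ * w := by
    simp only [hw, hΓ, mul_assoc, mul_add, add_mul, hcl l01, hcl l02, hcl l03, hcl l12, hcl l13, hcl l23, hcr l23, true_or, or_true,
      he.s0, he.s1, he.s2, he.s3, he.a10, he.a20, he.a30, he.a21, he.a31, he.a32,
      mul_left_one he.s0, mul_left_one he.s1, mul_left_one he.s2, mul_left_one he.s3,
      mul_left_anti he.a10, mul_left_anti he.a20, mul_left_anti he.a30, mul_left_anti he.a21,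
      mul_left_anti he.a31, mul_left_anti he.a32, mul_neg, neg_neg, mul_one]
  have hP : o01 * o23 - o02 * o13 + o03 * o12 = (3 / 4 : ℂ) • w - (1 / 2 : ℂ) • (w * Γ) := by
    simp only [h01, h02, h03, h12, h13, h23, hw, hΓ, mul_assoc, mul_add, add_mul, hcl l01, hcl l02, hcl l03, hcl l12, hcl l13, hcl l23,
      hcr l01, hcr l02, hcr l03, hcr l12, hcr l13, hcr l23, true_or,
      or_true, mul_smul_comm, smul_mul_assoc, hl.c4,
      he.s0, he.s1, he.s2, he.s3, he.a10, he.a20, he.a30, he.a21, he.a31, he.a32,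
      mul_left_one he.s0, mul_left_one he.s1, mul_left_one he.s2, mul_left_one he.s3,
      mul_left_anti he.a10, mul_left_anti he.a20, mul_left_anti he.a30, mul_left_anti he.a21,
      mul_left_anti he.a31, mul_left_anti he.a32, mul_neg, neg_neg, mul_one]
    module
  have hS : o01 * o01 + o02 * o02 + o03 * o03 + o12 * o12 + o13 * o13 + o23 * o23
      = (l01 * l01 + l02 * l02 + l03 * l03 + l12 * l12 + l13 * l13 + l23 * l23) + Γ
        - (3 / 2 : ℂ) • (1 : R) := by
    simp only [h01, h02, h03, h12, h13, h23, hΓ, mul_assoc, mul_add, add_mul, hcl l01, hcl l02, hcl l03, hcl l12, hcl l13, hcl l23,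
      hcr l01, hcr l02, hcr l03, hcr l12, hcr l13, hcr l23, true_or,
      or_true, mul_smul_comm, smul_mul_assoc,
      he.s0, he.s1, he.s2, he.s3, he.a10, he.a20, he.a30, he.a21, he.a31, he.a32,
      mul_left_one he.s0, mul_left_one he.s1, mul_left_one he.s2, mul_left_one he.s3,
      mul_left_anti he.a10, mul_left_anti he.a20, mul_left_anti he.a30, mul_left_anti he.a21,
      mul_left_anti he.a31, mul_left_anti he.a32, mul_neg, neg_neg, mul_one]
    module
  have h1 : w * (w * Γ) = Γ := mul_left_one hww Γ
  have h2 : w * Γ * w = Γ := by rw [mul_assoc, ← hwΓ, h1]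
  have h3 : w * Γ * (w * Γ) = Γ * Γ := by rw [← mul_assoc, h2]
  rw [hP, hS]
  simp only [mul_sub, sub_mul, mul_smul_comm, smul_mul_assoc, hww, h1, h2, h3, hg]
  rw [two_mul]
  module

end Chirality

end TAMA

end

noncomputable section

namespace TAMA

variable {n : ℕ}

/-! ### The tableau relations hold in the Weyl–Clifford algebra -/

theorem IsSoFamily.isPlucker {R : Type*} [Ring R] {g : Fin n → Fin n → R} (hg : IsSoFamily g)
    {A : Fin 4 → Fin n} (hA : Function.Injective A) (h : pf g A = 0) :
    IsPlucker (g (A 0) (A 1)) (g (A 0) (A 2)) (g (A 0) (A 3)) (g (A 1) (A 2)) (g (A 1) (A 3))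
      (g (A 2) (A 3)) := by
  have ne {p q : Fin 4} (h : p ≠ q) : A p ≠ A q := hA.ne h
  have s10 := hg.swap (ne (show (0 : Fin 4) ≠ 1 by decide))
  have s20 := hg.swap (ne (show (0 : Fin 4) ≠ 2 by decide))
  have s30 := hg.swap (ne (show (0 : Fin 4) ≠ 3 by decide))
  have s21 := hg.swap (ne (show (1 : Fin 4) ≠ 2 by decide))
  have s31 := hg.swap (ne (show (1 : Fin 4) ≠ 3 by decide))
  have s32 := hg.swap (ne (show (2 : Fin 4) ≠ 3 by decide))
  have c1 := hg.comm (ne (show (2 : Fin 4) ≠ 3 by decide)) (ne (show (0 : Fin 4) ≠ 1 by decide))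
    (ne (by decide)) (ne (by decide)) (ne (by decide)) (ne (by decide))
  have c2 := hg.comm (ne (show (1 : Fin 4) ≠ 3 by decide)) (ne (show (0 : Fin 4) ≠ 2 by decide))
    (ne (by decide)) (ne (by decide)) (ne (by decide)) (ne (by decide))
  have c3 := hg.comm (ne (show (1 : Fin 4) ≠ 2 by decide)) (ne (show (0 : Fin 4) ≠ 3 by decide))
    (ne (by decide)) (ne (by decide)) (ne (by decide)) (ne (by decide))
  have hb {p q r : Fin 4} (h1 : p ≠ q) (h2 : q ≠ r) (h3 : p ≠ r) :
      g (A p) (A q) * g (A q) (A r) = g (A q) (A r) * g (A p) (A q) + g (A p) (A r) := by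
    rw [← hg.bracket (ne h1) (ne h2) (ne h3)]; abel
  have b1 := hb (p := 2) (q := 0) (r := 1) (by decide) (by decide) (by decide)
  have b2 := hb (p := 3) (q := 0) (r := 1) (by decide) (by decide) (by decide)
  have b3 := hb (p := 3) (q := 0) (r := 2) (by decide) (by decide) (by decide)
  have b4 := hb (p := 0) (q := 1) (r := 2) (by decide) (by decide) (by decide)
  have b5 := hb (p := 0) (q := 1) (r := 3) (by decide) (by decide) (by decide)
  have b6 := hb (p := 1) (q := 2) (r := 0) (by decide) (by decide) (by decide)
  have b7 := hb (p := 0) (q := 2) (r := 3) (by decide) (by decide) (by decide)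
  have b8 := hb (p := 1) (q := 3) (r := 0) (by decide) (by decide) (by decide)
  have b9 := hb (p := 2) (q := 3) (r := 0) (by decide) (by decide) (by decide)
  have b10 := hb (p := 3) (q := 1) (r := 2) (by decide) (by decide) (by decide)
  have b11 := hb (p := 1) (q := 2) (r := 3) (by decide) (by decide) (by decide)
  have b12 := hb (p := 2) (q := 3) (r := 1) (by decide) (by decide) (by decide)
  simp only [s10, s20, s30, s21, s31, s32, neg_mul, mul_neg] at b1 b2 b3 b4 b5 b6 b7 b8 b9 b10 b11 b12
  have hp : g (A 0) (A 3) * g (A 1) (A 2)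
      = g (A 0) (A 2) * g (A 1) (A 3) - g (A 0) (A 1) * g (A 2) (A 3) := by
    rw [pf, s31, mul_neg] at h
    rw [← sub_eq_zero, ← h]; abel
  have aux {a b c : R} (h : -a = -b + -c) : a = b + c := by
    rw [← neg_inj, h]; abel
  refine ⟨aux b1, aux b2, aux b3, by rw [b4]; abel, by rw [b5]; abel, aux b6, by rw [b7]; abel, aux b8,
    aux b9, aux b10, by rw [b11]; abel, aux b12, c1, c2, c3.trans hp, hp⟩

/-- The angular momentum `x_i y_j - x_j y_i` in the Weyl algebra. -/
def angMom (i j : Fin n) : Weyl n := wx i * wy j - wx j * wy i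

theorem wy_mul_wx_of_ne {i j : Fin n} (h : i ≠ j) : Commute (wy i) (wx j) := by
  rw [Commute, SemiconjBy, wy_mul_wx, if_neg h, add_zero]

theorem isSoFamily_angMom : IsSoFamily (angMom (n := n)) where
  swap _ := (neg_sub _ _).symm
  comm {i j k l} hij hkl hik hil hjk hjl := by
    have h {i j k l : Fin n} (hil : i ≠ l) (hjk : j ≠ k) :
        Commute (wx i * wy j) (wx k * wy l) := by
      refine Commute.mul_left (Commute.mul_right (wx_comm _ _) (wy_mul_wx_of_ne hil.symm).symm)
        (Commute.mul_right (wy_mul_wx_of_ne hjk) (wy_comm _ _))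
    exact (Commute.sub_left (Commute.sub_right (h hil hjk) (h hik hjl))
      (Commute.sub_right (h hjl hik) (h hjk hil)))
  bracket {i j k} hij hjk hik := by
    have y1 := (wy_comm j i).eq
    have y2 := (wy_comm k i).eq
    have y3 := (wy_comm k j).eq
    have d := wy_mul_wx j j
    rw [if_pos rfl] at d
    have cl {a b : Fin n} (h : a ≠ b) := (wy_mul_wx_of_ne h).left_comm
    simp only [angMom, mul_sub, sub_mul, mul_assoc, mul_left_swap d, cl hij, cl hjk, cl hik,
      cl hij.symm, cl hjk.symm, cl hik.symm, (wx_comm j i).left_comm, (wx_comm k i).left_comm,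
      (wx_comm k j).left_comm, y1, y2, y3, mul_add, one_mul]
    abel

/-- Each product involves four distinct indices, so normal ordering creates no corrections and the
classical Plücker relation applies. -/
theorem pf_angMom {A : Fin 4 → Fin n} (hA : Function.Injective A) : pf angMom A = 0 := by
  have h {a b c d : Fin n} (h : b ≠ c) : wx a * wy b * (wx c * wy d) = wx a * (wx c * (wy b * wy d)) := by
    rw [mul_assoc, (wy_mul_wx_of_ne h).left_comm]
  have ne {p q : Fin 4} (h : p ≠ q) : A p ≠ A q := hA.ne h
  have hx (p q : Fin 4) := (wx_comm (A p) (A q)).left_comm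
  have hy (p q : Fin 4) := (wy_comm (A p) (A q)).eq
  have e (a b c d : Fin 4) (hbc : b ≠ c) (hbd : b ≠ d) (hac : a ≠ c) (had : a ≠ d) :
      angMom (A a) (A b) * angMom (A c) (A d)
      = wx (A a) * (wx (A c) * (wy (A b) * wy (A d))) - wx (A a) * (wx (A d) * (wy (A b) * wy (A c)))
      - wx (A b) * (wx (A c) * (wy (A a) * wy (A d)))
      + wx (A b) * (wx (A d) * (wy (A a) * wy (A c))) := by
    rw [angMom, angMom, mul_sub, sub_mul, sub_mul, h (ne hbc), h (ne hbd), h (ne hac), h (ne had)]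
    abel
  rw [pf, e _ _ _ _ (by decide) (by decide) (by decide) (by decide),
    e _ _ _ _ (by decide) (by decide) (by decide) (by decide),
    e _ _ _ _ (by decide) (by decide) (by decide) (by decide)]
  simp only [hx 2 1, hx 3 1, hx 3 2, hy 2 1, hy 3 1,
    hy 3 2]
  abel

attribute [local instance] LieRing.ofAssociativeRing

theorem X_isSoFamily : IsSoFamily (X (n := n)) := by
  have hs (i j : Fin n) : soElt j i = - soElt i j := Subtype.ext (by simp [soElt])
  have hb (i j k l : Fin n) : X i j * X k l - X k l * X i j
      = UniversalEnvelopingAlgebra.ι ℂ ⁅soElt i j, soElt k l⁆ := by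
    rw [LieHom.map_lie]; rfl
  refine ⟨fun {i j} _ => ?_, fun {i j k l} hij hkl hik hil hjk hjl => ?_, fun {i j k} hij hjk hik => ?_⟩
  · rw [X, hs, map_neg]; rfl
  · rw [← sub_eq_zero, hb]
    have : ⁅soElt i j, soElt k l⁆ = 0 := by
      refine Subtype.ext ?_
      simp [soElt, Ring.lie_def, mul_sub, sub_mul, hik, hil, hjk, hjl, hik.symm, hil.symm, hjk.symm, hjl.symm]
    rw [this, map_zero]
  · rw [hb, X]
    congr 1
    refine Subtype.ext ?_
    simp [soElt, Ring.lie_def, mul_sub, sub_mul, hij, hjk, hik, hij.symm, hjk.symm, hik.symm]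

theorem includeLeft_mul_te (a : Weyl n) (c : Cliff n) :
    (1 ⊗ₜ[ℂ] c : WC n) * (a ⊗ₜ[ℂ] 1) = (a ⊗ₜ[ℂ] 1) * (1 ⊗ₜ[ℂ] c) := by
  simp only [Algebra.TensorProduct.tmul_mul_tmul, one_mul, mul_one]

theorem O_isSoFamily : IsSoFamily (R := WC n) O :=
  X_isSoFamily.map (S := WC n) (usoHom n : Uso n →+* WC n) fun _ _ h => usoHom_X h

theorem isClifford_te {A : Fin 4 → Fin n} (hA : Function.Injective A) :
    IsClifford (R := WC n) (1 ⊗ₜ[ℂ] ce (A 0)) (1 ⊗ₜ[ℂ] ce (A 1)) (1 ⊗ₜ[ℂ] ce (A 2))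
      (1 ⊗ₜ[ℂ] ce (A 3)) := by
  have hs (i : Fin n) : (1 ⊗ₜ[ℂ] ce i : WC n) * (1 ⊗ₜ[ℂ] ce i) = 1 := by
    rw [Algebra.TensorProduct.tmul_mul_tmul, ce_sq, mul_one, Algebra.TensorProduct.one_def]
  have ha {p q : Fin 4} (h : p ≠ q) : (1 ⊗ₜ[ℂ] ce (A p) : WC n) * (1 ⊗ₜ[ℂ] ce (A q))
      = - ((1 ⊗ₜ[ℂ] ce (A q) : WC n) * (1 ⊗ₜ[ℂ] ce (A p))) := by
    have := isWeylClifford_WC.ee (A p) (A q)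
    rw [if_neg (hA.ne h)] at this
    exact this.trans (add_zero _)
  exact ⟨hs _, hs _, hs _, hs _, ha (by decide), ha (by decide), ha (by decide), ha (by decide),
    ha (by decide), ha (by decide)⟩

theorem tabTerm_O_self {A : Fin 4 → Fin n} (hA : Function.Injective A) :
    tabTerm (R := WC n) O A A = (3 / 4 : ℂ) • (1 : WC n) := by
  have hg : IsSoFamily (R := WC n) fun i j => angMom i j ⊗ₜ[ℂ] (1 : Cliff n) :=
    isSoFamily_angMom.map (S := WC n)
      (Algebra.TensorProduct.includeLeft (R := ℂ) (S := ℂ) (A := Weyl n) (B := Cliff n) : Weyl n →+* WC n)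
      fun _ _ _ => rfl
  have hp : pf (R := WC n) (fun i j => angMom i j ⊗ₜ[ℂ] (1 : Cliff n)) A = 0 := by
    have := congrArg (Algebra.TensorProduct.includeLeft (R := ℂ) (S := ℂ) (A := Weyl n) (B := Cliff n))
      (pf_angMom hA)
    rw [map_zero] at this
    rw [← this, pf, pf]
    simp only [map_add, map_mul]
    rfl
  have h := four_mul_pf_sq (R := WC n) (isClifford_te hA) (hg.isPlucker hA hp) (by
    rintro _ (rfl | rfl | rfl | rfl | rfl | rfl) _ (rfl | rfl | rfl | rfl) <;>
    exact includeLeft_mul_te _ _) rfl rfl rfl rfl rfl rfl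
  have hO (i j : Fin n) : O i j = angMom i j ⊗ₜ[ℂ] (1 : Cliff n)
      + (1 / 2 : ℂ) • ((1 ⊗ₜ[ℂ] ce i) * (1 ⊗ₜ[ℂ] ce j)) := by
    rw [O, angMom, Algebra.TensorProduct.tmul_mul_tmul, mul_one]
  simp only [← hO] at h
  rw [← h, tabTerm]
  -- For A = B every pair of positions is admissible, so the sum is over all six squares.
  have hf : (Finset.univ.filter fun q : Fin 4 × Fin 4 => q.1 < q.2 ∧ ∀ p, p ≠ q.1 → p ≠ q.2 → A p = A p)
      = {(0, 1), (0, 2), (0, 3), (1, 2), (1, 3), (2, 3)} := by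
    simp only [implies_true, and_true]; decide
  rw [hf]
  have hpf := pf_eq (R := WC n) O_isSoFamily hA
  rw [← hpf]
  have h4 (a : WC n) : 2 * a * (2 * a) = (4 : ℂ) • (a * a) := by
    rw [two_mul, ← two_smul ℂ, smul_mul_smul_comm]; norm_num
  rw [h4]
  rw [Finset.sum_insert (by decide), Finset.sum_insert (by decide), Finset.sum_insert (by decide),
    Finset.sum_insert (by decide), Finset.sum_insert (by decide), Finset.sum_singleton]
  simp only [← add_assoc]

theorem usoHom_tabTerm {A B : Fin 4 → Fin n} (hA : Function.Injective A) (hB : Function.Injective B) :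
    usoHom n (tabTerm X A B) = tabTerm (R := WC n) O A B := by
  have ha {p q : Fin 4} (h : p ≠ q) : usoHom n (X (A p) (A q)) = O (A p) (A q) := usoHom_X (hA.ne h)
  have hb {p q : Fin 4} (h : p ≠ q) : usoHom n (X (B p) (B q)) = O (B p) (B q) := usoHom_X (hB.ne h)
  simp only [tabTerm, pf, map_add, map_mul, map_sum, map_ofNat]
  rw [ha (by decide), ha (by decide), ha (by decide), ha (by decide), ha (by decide), ha (by decide),
    hb (by decide), hb (by decide), hb (by decide), hb (by decide), hb (by decide), hb (by decide)]
  congr 1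
  refine Finset.sum_congr rfl fun q hq => ?_
  have := (Finset.mem_filter.1 hq).2.1.ne
  rw [ha this, hb this]

theorem usoHom_tableauRel (hn : n ≤ 5) {A B : Fin 4 → Fin n} (h : Aligned A B) :
    usoHom n (tableauRel A B) = 0 := by
  rcases aligned_cases hn h with rfl | ⟨p, hp⟩
  · rw [tableauRel_self, map_sub, map_mul, usoHom_tabTerm h.1 h.1, tabTerm_O_self h.1, map_ofNat,
      map_ofNat, sub_eq_zero]
    rw [show (16 : WC n) = (16 : ℂ) • 1 by rw [← Algebra.algebraMap_eq_smul_one]; exact (map_ofNat _ _).symm,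
      show (12 : WC n) = (12 : ℂ) • 1 by rw [← Algebra.algebraMap_eq_smul_one]; exact (map_ofNat _ _).symm,
      smul_mul_smul_comm, mul_one]
    norm_num
  · rw [tableauRel_of_differAt hp, map_mul, map_add, usoHom_tabTerm h.1 h.2.1, usoHom_tabTerm h.2.1 h.1]
    have h1 := tabTerm_add_eq_zero (R := WC n) O_isSoFamily h.1 hp fun a => by
      rw [tabTerm_O_self h.1, mul_smul_comm, smul_mul_assoc, mul_one, one_mul]
    exact (congrArg (usoHom n 8 * ·) h1).trans (mul_zero _)

end TAMA

end

noncomputable section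

namespace TAMA

variable {n : ℕ}

/-! ### Diagrams which are not uncrossable contain two crossings -/

/-- The chords `c = (i, k)` and `d = (j, l)` satisfy `i < j < k < l`. -/
def CrossLT (c d : Chord n) : Prop := c.1.1 < d.1.1 ∧ d.1.1 < c.1.2 ∧ c.1.2 < d.1.2

/-- Two chords which cross. -/
def Cross (c d : Chord n) : Prop := CrossLT c d ∨ CrossLT d c

theorem Cross.symm {c d : Chord n} (h : Cross c d) : Cross d c := Or.symm h

theorem Cross.ne {c d : Chord n} (h : Cross c d) : c ≠ d := by
  rintro rfl
  rcases h with h | h <;> exact lt_irrefl _ h.1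

theorem not_uncrossed_iff {m : Diagram n} :
    ¬ Uncrossed m ↔ ∃ c d, Cross c d ∧ m c ≠ 0 ∧ m d ≠ 0 := by
  constructor
  · intro h
    simp only [Uncrossed, not_forall, not_or] at h
    obtain ⟨i, j, k, l, hij, hjk, hkl, h1, h2⟩ := h
    exact ⟨_, _, Or.inl ⟨hij, hjk, hkl⟩, h1, h2⟩
  · rintro ⟨c, d, h, h1, h2⟩ hm
    rcases h with h | h
    · exact (hm c.1.1 d.1.1 c.1.2 d.1.2 h.1 h.2.1 h.2.2).elim h1 h2
    · exact (hm d.1.1 c.1.1 d.1.2 c.1.2 h.1 h.2.1 h.2.2).elim h2 h1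

/-- Three pairwise crossing chords have six distinct end points. -/
theorem not_three_cross (hn : n ≤ 5) {c d e : Chord n} (h1 : Cross c d) (h2 : Cross c e) :
    ¬ Cross d e := by
  obtain ⟨⟨⟨c1, _⟩, ⟨c2, _⟩⟩, _⟩ := c
  obtain ⟨⟨⟨d1, _⟩, ⟨d2, _⟩⟩, _⟩ := d
  obtain ⟨⟨⟨e1, _⟩, ⟨e2, _⟩⟩, _⟩ := e
  simp only [Cross, CrossLT, Fin.mk_lt_mk] at *
  omega

/-- Removing one copy of c must leave a crossing. By hypothesis it is not disjoint from the pair c,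
d, which forces it to use the only copy of d. The comparison with `if c = e` says that e is still
present after the removal. -/
theorem exists_cross_of_not_uncrossable {m : Diagram n} (hm : ¬ Uncrossable m) {c d : Chord n}
    (hcd : Cross c d) (hc : m c ≠ 0) (hd : m d ≠ 0)
    (h : ∀ e f, Cross e f → ¬ ∀ x, [c, d, e, f].count x ≤ m x) :
    m d = 1 ∧ ∃ e, Cross d e ∧ (if c = e then 1 else 0) < m e := by
  have h1 : ¬ Uncrossed (m - Pi.single c 1) := fun hu => hm (Or.inr ⟨_, c, hu, by
    funext x
    by_cases hx : x = c
    · subst hx; simp; omega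
    · simp [hx]⟩)
  obtain ⟨e, f, hef, he, hf⟩ := not_uncrossed_iff.1 h1
  simp only [Pi.sub_apply, Pi.single_apply] at he hf
  have hne := hef.ne
  have hcne := hcd.ne
  have h2 := h e f hef
  push Not at h2
  obtain ⟨x, hx⟩ := h2
  simp only [List.count_cons, List.count_nil, beq_iff_eq] at hx
  by_cases hxd : d = x
  · subst hxd
    by_cases hed : e = d
    · subst hed
      simp [hcne, hne.symm] at hx
      refine ⟨by omega, f, hef, ?_⟩
      simp only [eq_comm (a := c)]
      omega
    · by_cases hfd : f = d
      · subst hfd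
        simp [hcne, hed] at hx
        refine ⟨by omega, e, hef.symm, ?_⟩
        simp only [eq_comm (a := c)]
        omega
      · simp [hcne, hed, hfd] at hx
        omega
  · exfalso
    by_cases hxc : c = x
    · subst hxc
      by_cases hec : e = c
      · subst hec
        simp [hne.symm, hxd] at hx he
        omega
      · by_cases hfc : f = c
        · subst hfc
          simp [hne, hxd] at hx hf
          omega
        · simp [hxd, hec, hfc] at hx
          omega
    · by_cases hex : e = x
      · subst hex; simp [hxd, hxc, hne.symm] at hx he; omega
      · by_cases hfx : f = x
        · subst hfx; simp [hxd, hxc, hne] at hx hf; omega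
        · simp [hxd, hxc, hex, hfx] at hx

/-- Otherwise a crossing of c and d has both chords simple, with some e crossing d and some f
crossing c. Since three chords cannot cross pairwise, e ≠ f, and then the crossings of d with e and
of c with f are disjoint. -/
theorem exists_two_cross (hn : n ≤ 5) {m : Diagram n} (hm : ¬ Uncrossable m) :
    ∃ c d e f, CrossLT c d ∧ CrossLT e f ∧ ∀ x, [c, d, e, f].count x ≤ m x := by
  suffices h : ∃ c d e f, Cross c d ∧ Cross e f ∧ ∀ x, [c, d, e, f].count x ≤ m x by
    obtain ⟨c, d, e, f, hcd, hef, hx⟩ := h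
    simp only [List.count_cons, List.count_nil] at hx ⊢
    rcases hcd with hcd | hcd <;> rcases hef with hef | hef
    · exact ⟨c, d, e, f, hcd, hef, hx⟩
    · exact ⟨c, d, f, e, hcd, hef, fun x => by have := hx x; omega⟩
    · exact ⟨d, c, e, f, hcd, hef, fun x => by have := hx x; omega⟩
    · exact ⟨d, c, f, e, hcd, hef, fun x => by have := hx x; omega⟩
  by_contra hno
  push Not at hno
  obtain ⟨c, d, hcd, hc, hd⟩ := not_uncrossed_iff.1 fun h => hm (Or.inl h)
  obtain ⟨hd1, e, hde, he⟩ := exists_cross_of_not_uncrossable hm hcd hc hd fun e f hef hx => by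
    obtain ⟨x, hx'⟩ := hno c d e f hcd hef
    exact absurd (hx x) (by omega)
  obtain ⟨hc1, f, hcf, hf⟩ := exists_cross_of_not_uncrossable hm hcd.symm hd hc fun e f hef hx => by
    obtain ⟨x, hx'⟩ := hno d c e f hcd.symm hef
    exact absurd (hx x) (by omega)
  have hce : c ≠ e := by rintro rfl; simp at he; omega
  have hdf : d ≠ f := by rintro rfl; simp at hf; omega
  have hef : e ≠ f := by
    rintro rfl
    exact not_three_cross hn hcd hcf hde
  obtain ⟨x, hx⟩ := hno d e c f hde hcf
  rw [if_neg hce] at he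
  rw [if_neg hdf] at hf
  have n1 := hcd.ne
  have n2 := hde.ne
  have n3 := hcf.ne
  have hnd : [d, e, c, f].Nodup := by
    simp [n1.symm, n2, hdf, hce.symm, hef, n3]
  have hle := List.nodup_iff_count_le_one.1 hnd x
  have hmem : x ∈ [d, e, c, f] := List.count_pos_iff.1 (by omega)
  simp only [List.mem_cons, List.not_mem_nil, or_false] at hmem
  rcases hmem with rfl | rfl | rfl | rfl <;> omega

end TAMA

end

noncomputable section

namespace TAMA

variable {n : ℕ}

/-! ### Straightening of words -/

section Words

variable {R : Type*} [Ring R] [Algebra ℂ R] (γ : Chord n → R)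

/-- The span of the words with fewer than `d` letters. -/
def wordsLT (d : ℕ) : Submodule ℂ R :=
  Submodule.span ℂ {a | ∃ w : List (Chord n), w.length < d ∧ a = (w.map γ).prod}

variable {γ}

theorem word_mem_wordsLT {w : List (Chord n)} {d : ℕ} (h : w.length < d) :
    (w.map γ).prod ∈ wordsLT γ d := Submodule.subset_span ⟨w, h, rfl⟩

theorem wordsLT_mono {d e : ℕ} (h : d ≤ e) : wordsLT γ d ≤ wordsLT γ e :=
  Submodule.span_mono fun _ ⟨w, hw, ha⟩ => ⟨w, hw.trans_le h, ha⟩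

theorem mul_word_mem {d e : ℕ} {a : R} (ha : a ∈ wordsLT γ d) (w : List (Chord n))
    (he : d + w.length ≤ e) : a * (w.map γ).prod ∈ wordsLT γ e := by
  induction ha using Submodule.span_induction with
  | mem x hx =>
    obtain ⟨u, hu, rfl⟩ := hx
    rw [← List.prod_append, ← List.map_append]
    exact word_mem_wordsLT (by rw [List.length_append]; omega)
  | zero => rw [zero_mul]; exact Submodule.zero_mem _
  | add x y _ _ hx hy => rw [add_mul]; exact Submodule.add_mem _ hx hy
  | smul c x _ hx => rw [smul_mul_assoc]; exact Submodule.smul_mem _ _ hx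

theorem letter_mul_mem {d : ℕ} {a : R} (ha : a ∈ wordsLT γ d) (c : Chord n) :
    γ c * a ∈ wordsLT γ (d + 1) := by
  induction ha using Submodule.span_induction with
  | mem x hx =>
    obtain ⟨u, hu, rfl⟩ := hx
    rw [← List.prod_cons, ← List.map_cons]
    exact word_mem_wordsLT (by rw [List.length_cons]; omega)
  | zero => rw [mul_zero]; exact Submodule.zero_mem _
  | add x y _ _ hx hy => rw [mul_add]; exact Submodule.add_mem _ hx hy
  | smul c x _ hx => rw [mul_smul_comm]; exact Submodule.smul_mem _ _ hx

/-- An adjacent transposition costs a commutator, which replaces two letters by at most one. -/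
theorem word_sub_word_mem (hγ : ∀ c d, γ c * γ d - γ d * γ c ∈ wordsLT γ 2) {w w' : List (Chord n)}
    (h : w.Perm w') : (w.map γ).prod - (w'.map γ).prod ∈ wordsLT γ w.length := by
  induction h with
  | nil => rw [sub_self]; exact Submodule.zero_mem _
  | cons c h ih =>
    rw [List.map_cons, List.map_cons, List.prod_cons, List.prod_cons, ← mul_sub]
    exact letter_mul_mem ih c
  | swap c d w =>
    have : ((d :: c :: w).map γ).prod - ((c :: d :: w).map γ).prod
        = (γ d * γ c - γ c * γ d) * (w.map γ).prod := by
      simp only [List.map_cons, List.prod_cons]; noncomm_ring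
    rw [this]
    exact mul_word_mem (hγ d c) w (by simp only [List.length_cons]; omega)
  | trans h₁ h₂ ih₁ ih₂ =>
    rw [← sub_add_sub_cancel]
    exact Submodule.add_mem _ ih₁ (h₁.length_eq ▸ ih₂)

variable (γ)

/-- The monomial of a diagram, for the order of the chords given by the list `l`. -/
def mon (l : List (Chord n)) (m : Diagram n) : R := (l.map fun c => γ c ^ m c).prod

/-- The span of the monomials of uncrossable diagrams with at most `d` chords. -/
def uncrossableSpan (l : List (Chord n)) (d : ℕ) : Submodule ℂ R :=
  Submodule.span ℂ {a | ∃ m : Diagram n, Uncrossable m ∧ ∑ c, m c ≤ d ∧ a = mon γ l m}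

variable {γ}

theorem mon_eq_word (l : List (Chord n)) (m : Diagram n) :
    mon γ l m = ((l.flatMap fun c => List.replicate (m c) c).map γ).prod := by
  rw [mon]
  induction l with
  | nil => rfl
  | cons c l ih =>
    rw [List.map_cons, List.prod_cons, ih, List.flatMap_cons, List.map_append, List.prod_append,
      List.map_replicate, List.prod_replicate]

theorem count_flatMap_replicate {l : List (Chord n)} (hl : l.Nodup) (hc : ∀ c, c ∈ l) (m : Diagram n)
    (x : Chord n) : (l.flatMap fun c => List.replicate (m c) c).count x = m x := by
  have key : ∀ l : List (Chord n), l.Nodup → (l.flatMap fun c => List.replicate (m c) c).count x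
      = if x ∈ l then m x else 0 := by
    intro l
    induction l with
    | nil => simp
    | cons c l ih =>
      intro h
      rw [List.nodup_cons] at h
      rw [List.flatMap_cons, List.count_append, ih h.2, List.count_replicate]
      by_cases hx : x = c
      · subst hx; simp [h.1]
      · simp [hx]
        exact fun h => absurd (Subtype.ext h.symm) hx
  rw [key l hl, if_pos (hc x)]

theorem perm_flatMap_replicate {l : List (Chord n)} (hl : l.Nodup) (hc : ∀ c, c ∈ l)
    (w : List (Chord n)) : w.Perm (l.flatMap fun c => List.replicate (w.count c) c) :=
  List.perm_iff_count.2 fun x => (count_flatMap_replicate hl hc (fun c => w.count c) x).symm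

theorem sum_count_eq_length (w : List (Chord n)) : ∑ c, w.count c = w.length := by
  induction w with
  | nil => simp
  | cons a w ih =>
    have h : (Finset.univ.filter fun x : Chord n => a.1 = x.1) = {a} := by
      ext x; simp [Subtype.ext_iff, eq_comm]
    simp [List.count_cons, Finset.sum_add_distrib, ih, h]

theorem uncrossableSpan_mono (l : List (Chord n)) {d e : ℕ} (h : d ≤ e) :
    uncrossableSpan γ l d ≤ uncrossableSpan γ l e :=
  Submodule.span_mono fun _ ⟨m, hm, hd, ha⟩ => ⟨m, hm, hd.trans h, ha⟩

/-- The weight of a word. -/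
def wordWt (w : List (Chord n)) : ℕ := (w.map chordWt).sum

/-- The Pfaffian `γ_{ij} γ_{kl} - γ_{ik} γ_{jl} + γ_{il} γ_{jk}` of two crossing chords. -/
def crossPf (γ : Chord n → R) {c d : Chord n} (h : CrossLT c d) : R :=
  γ (chord h.1) * γ (chord h.2.2) - γ c * γ d
    + γ (chord (h.1.trans (h.2.1.trans h.2.2))) * γ (chord h.2.1)

/-- Induction on the length and then on the weight. Words with an uncrossable diagram are sorted; in
any other word two disjoint crossings are brought to the front and resolved by means of the product
of their Pfaffians, which equals shorter words. -/
theorem word_mem_uncrossableSpan (hn : n ≤ 5)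
    (hγ : ∀ c d, γ c * γ d - γ d * γ c ∈ wordsLT γ 2)
    (hpf : ∀ (c d e f : Chord n) (h : CrossLT c d) (h' : CrossLT e f),
      crossPf γ h * crossPf γ h' ∈ wordsLT γ 4)
    {l : List (Chord n)} (hl : l.Nodup) (hc : ∀ c, c ∈ l) (w : List (Chord n)) :
    (w.map γ).prod ∈ uncrossableSpan γ l w.length := by
  induction hd : w.length using Nat.strong_induction_on generalizing w with
  | _ d ihd =>
  induction hk : wordWt w using Nat.strong_induction_on generalizing w with
  | _ k ihk =>
  subst hk hd
  have hlt : wordsLT γ w.length ≤ uncrossableSpan γ l w.length := by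
    refine Submodule.span_le.2 ?_
    rintro _ ⟨u, hu, rfl⟩
    exact uncrossableSpan_mono l hu.le (ihd _ hu u rfl)
  by_cases hm : Uncrossable fun c => w.count c
  · have h1 := hlt (word_sub_word_mem hγ (perm_flatMap_replicate hl hc w))
    rw [← mon_eq_word l fun c => w.count c] at h1
    rw [← sub_add_cancel (w.map γ).prod (mon γ l fun c => w.count c)]
    exact Submodule.add_mem _ h1 (Submodule.subset_span ⟨_, hm, (sum_count_eq_length w).le, rfl⟩)
  · obtain ⟨c, d, e, f, hcd, hef, hle⟩ := exists_two_cross hn hm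
    obtain ⟨u, hu⟩ : ∃ u, w.Perm (c :: d :: e :: f :: u) := by
      have : (([c, d, e, f] : List (Chord n)) : Multiset (Chord n)) ≤ (w : Multiset (Chord n)) :=
        Multiset.coe_le.2 (List.subperm_ext_iff.2 fun x _ => hle x)
      obtain ⟨u, hu⟩ := Multiset.le_iff_exists_add.1 this
      induction u using Quotient.inductionOn with
      | _ u => exact ⟨u, Multiset.coe_eq_coe.1 hu⟩
    have hlen : w.length = u.length + 4 := by rw [hu.length_eq]; rfl
    have hwt : wordWt w = chordWt c + chordWt d + (chordWt e + chordWt f) + wordWt u := by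
      rw [wordWt, (hu.map chordWt).sum_eq]
      simp only [List.map_cons, List.sum_cons, wordWt]; ring
    have hlow (a b a' b' : Chord n)
        (hlt : chordWt a + chordWt b + (chordWt a' + chordWt b')
          < chordWt c + chordWt d + (chordWt e + chordWt f)) :
        γ a * γ b * (γ a' * γ b') * (u.map γ).prod ∈ uncrossableSpan γ l w.length := by
      have := ihk (wordWt (a :: b :: a' :: b' :: u)) (by
        rw [hwt]; simp only [wordWt, List.map_cons, List.sum_cons] at hlt ⊢; omega)
        (a :: b :: a' :: b' :: u) (by simp [hlen]) rfl
      simpa only [List.map_cons, List.prod_cons, mul_assoc] using this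
    obtain ⟨p1, p2⟩ := chordWt_uncross hcd.1 hcd.2.1 hcd.2.2
    obtain ⟨q1, q2⟩ := chordWt_uncross hef.1 hef.2.1 hef.2.2
    have h1 := hlt (word_sub_word_mem hγ hu)
    rw [← sub_add_cancel (w.map γ).prod ((c :: d :: e :: f :: u).map γ).prod]
    refine Submodule.add_mem _ h1 ?_
    have h2 : crossPf γ hcd * crossPf γ hef * (u.map γ).prod ∈ uncrossableSpan γ l w.length :=
      hlt (mul_word_mem (hpf _ _ _ _ hcd hef) u (by omega))
    set a₁ := chord hcd.1
    set a₃ := chord hcd.2.2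
    set a₂ := chord (hcd.1.trans (hcd.2.1.trans hcd.2.2))
    set a₄ := chord hcd.2.1
    set b₁ := chord hef.1
    set b₃ := chord hef.2.2
    set b₂ := chord (hef.1.trans (hef.2.1.trans hef.2.2))
    set b₄ := chord hef.2.1
    -- The expanded product of the Pfaffians, solved for the term with both crossings. In each of
    -- the eight other terms at least one crossing is resolved, so its weight is smaller.
    have e1 : ((c :: d :: e :: f :: u).map γ).prod = crossPf γ hcd * crossPf γ hef * (u.map γ).prod
        + γ c * γ d * (γ b₁ * γ b₃) * (u.map γ).prod + γ c * γ d * (γ b₂ * γ b₄) * (u.map γ).prod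
        + γ a₁ * γ a₃ * (γ e * γ f) * (u.map γ).prod + γ a₂ * γ a₄ * (γ e * γ f) * (u.map γ).prod
        - γ a₁ * γ a₃ * (γ b₁ * γ b₃) * (u.map γ).prod - γ a₁ * γ a₃ * (γ b₂ * γ b₄) * (u.map γ).prod
        - γ a₂ * γ a₄ * (γ b₁ * γ b₃) * (u.map γ).prod
        - γ a₂ * γ a₄ * (γ b₂ * γ b₄) * (u.map γ).prod := by
      simp only [List.map_cons, List.prod_cons, crossPf]
      noncomm_ring
    change chordWt a₁ + chordWt a₃ < chordWt c + chordWt d at p1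
    change chordWt a₂ + chordWt a₄ < chordWt c + chordWt d at p2
    change chordWt b₁ + chordWt b₃ < chordWt e + chordWt f at q1
    change chordWt b₂ + chordWt b₄ < chordWt e + chordWt f at q2
    rw [e1]
    exact Submodule.sub_mem _ (Submodule.sub_mem _ (Submodule.sub_mem _ (Submodule.sub_mem _
      (Submodule.add_mem _ (Submodule.add_mem _ (Submodule.add_mem _ (Submodule.add_mem _ h2
      (hlow _ _ _ _ (by omega))) (hlow _ _ _ _ (by omega))) (hlow _ _ _ _ (by omega)))
      (hlow _ _ _ _ (by omega))) (hlow _ _ _ _ (by omega))) (hlow _ _ _ _ (by omega)))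
      (hlow _ _ _ _ (by omega))) (hlow _ _ _ _ (by omega))

end Words

end TAMA

end

noncomputable section

namespace TAMA

variable {n : ℕ}

/-! ### Straightening for families with the commutation relations of 𝔰𝔬(n). -/

section Straighten

variable {R : Type*} [Ring R] [Algebra ℂ R]

/-- The restriction of a family to chords. -/
abbrev onChords (g : Fin n → Fin n → R) (c : Chord n) : R := g c.1.1 c.1.2

theorem IsSoFamily.eq_or_eq_neg {g : Fin n → Fin n → R} (hg : IsSoFamily g) {i j : Fin n}
    (hij : i ≠ j) : ∃ c : Chord n, g i j = onChords g c ∨ g i j = - onChords g c := by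
  rcases lt_or_gt_of_ne hij with h | h
  · exact ⟨chord h, Or.inl rfl⟩
  · exact ⟨chord h, Or.inr (hg.swap h.ne)⟩

theorem IsSoFamily.mem_wordsLT {g : Fin n → Fin n → R} (hg : IsSoFamily g) {i j : Fin n}
    (hij : i ≠ j) : g i j ∈ wordsLT (onChords g) 2 := by
  obtain ⟨c, hc⟩ := hg.eq_or_eq_neg hij
  have h : onChords g c ∈ wordsLT (onChords g) 2 := by
    simpa using word_mem_wordsLT (γ := onChords g) (w := [c]) (d := 2) (by simp)
  rcases hc with hc | hc <;> rw [hc]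
  · exact h
  · exact Submodule.neg_mem _ h

theorem IsSoFamily.mul_mem_wordsLT {g : Fin n → Fin n → R} (hg : IsSoFamily g) {i j k l : Fin n}
    (hij : i ≠ j) (hkl : k ≠ l) : g i j * g k l ∈ wordsLT (onChords g) 3 := by
  obtain ⟨c, hc⟩ := hg.eq_or_eq_neg hij
  have h := letter_mul_mem (hg.mem_wordsLT hkl) c
  rcases hc with hc | hc <;> rw [hc]
  · exact h
  · rw [neg_mul]; exact Submodule.neg_mem _ h

theorem IsSoFamily.commutator_mem {g : Fin n → Fin n → R} (hg : IsSoFamily g) (c d : Chord n) :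
    onChords g c * onChords g d - onChords g d * onChords g c ∈ wordsLT (onChords g) 2 := by
  obtain ⟨⟨i, j⟩, hij⟩ := c
  obtain ⟨⟨k, l⟩, hkl⟩ := d
  replace hij : i ≠ j := ne_of_lt hij
  replace hkl : k ≠ l := ne_of_lt hkl
  simp only [onChords]
  have key {i j k l : Fin n} (hij : i ≠ j) (hkl : k ≠ l) (h : j = k) :
      g i j * g k l - g k l * g i j ∈ wordsLT (onChords g) 2 := by
    subst h
    by_cases hil : i = l
    · subst hil
      rw [hg.swap hij]
      rw [show g i j * -g i j - -g i j * g i j = 0 by noncomm_ring]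
      exact Submodule.zero_mem _
    · rw [hg.bracket hij hkl hil]
      exact hg.mem_wordsLT hil
  by_cases hjk : j = k
  · exact key hij hkl hjk
  by_cases hil : i = l
  · have := key hkl hij hil.symm
    rw [← neg_sub]; exact Submodule.neg_mem _ this
  by_cases hik : i = k
  · have := key hij.symm hkl hik
    rw [hg.swap hij] at this
    rw [show g i j * g k l - g k l * g i j = -(-g i j * g k l - g k l * -g i j) by noncomm_ring]
    exact Submodule.neg_mem _ this
  by_cases hjl : j = l
  · have := key hij hkl.symm hjl
    rw [hg.swap hkl] at this
    rw [show g i j * g k l - g k l * g i j = -(g i j * -g k l - -g k l * g i j) by noncomm_ring]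
    exact Submodule.neg_mem _ this
  · rw [hg.comm hij hkl hik hil hjk hjl, sub_self]
    exact Submodule.zero_mem _

/-- The four end points of two crossing chords. -/
def crossSeq (c d : Chord n) : Fin 4 → Fin n := ![c.1.1, d.1.1, c.1.2, d.1.2]

theorem crossSeq_injective {c d : Chord n} (h : CrossLT c d) : Function.Injective (crossSeq c d) := by
  have : StrictMono (crossSeq c d) := by
    rw [Fin.strictMono_iff_lt_succ]
    intro i
    fin_cases i
    · exact h.1
    · exact h.2.1
    · exact h.2.2
  exact this.injective

theorem crossPf_eq {g : Fin n → Fin n → R} (hg : IsSoFamily g) {c d : Chord n} (h : CrossLT c d) :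
    crossPf (onChords g) h = pf g (crossSeq c d) := by
  rw [pf_eq hg (crossSeq_injective h)]
  rfl

/-- This is needed because the polarised relation controls only the symmetrised product of two
Pfaffians. -/
theorem crossPf_commutator_mem {γ : Chord n → R} (hγ : ∀ c d, γ c * γ d - γ d * γ c ∈ wordsLT γ 2)
    {c d e f : Chord n} (h : CrossLT c d) (h' : CrossLT e f) :
    crossPf γ h * crossPf γ h' - crossPf γ h' * crossPf γ h ∈ wordsLT γ 4 := by
  have key (a b c d : Chord n) : γ a * γ b * (γ c * γ d) - γ c * γ d * (γ a * γ b) ∈ wordsLT γ 4 := by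
    have := word_sub_word_mem hγ (List.perm_append_comm (l₁ := [a, b]) (l₂ := [c, d]))
    simpa [mul_assoc] using this
  have k1 := fun x y => key (chord h.1) (chord h.2.2) x y
  have k2 := fun x y => key c d x y
  have k3 := fun x y => key (chord (h.1.trans (h.2.1.trans h.2.2))) (chord h.2.1) x y
  have s := (wordsLT γ 4).add_mem ((wordsLT γ 4).add_mem ((wordsLT γ 4).sub_mem ((wordsLT γ 4).add_mem
    (k1 (chord h'.1) (chord h'.2.2)) (k1 (chord (h'.1.trans (h'.2.1.trans h'.2.2))) (chord h'.2.1)))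
    (k1 e f)) ((wordsLT γ 4).sub_mem ((wordsLT γ 4).add_mem
    (k3 (chord h'.1) (chord h'.2.2)) (k3 (chord (h'.1.trans (h'.2.1.trans h'.2.2))) (chord h'.2.1)))
    (k3 e f))) ((wordsLT γ 4).sub_mem (k2 e f) ((wordsLT γ 4).add_mem
    (k2 (chord h'.1) (chord h'.2.2)) (k2 (chord (h'.1.trans (h'.2.1.trans h'.2.2))) (chord h'.2.1))))
  convert s using 1
  rw [crossPf, crossPf]
  noncomm_ring

/-- The matching of common entries is a bijection between subsets of the positions and extends to a
permutation. -/
theorem exists_aligned {A B : Fin 4 → Fin n} (hA : Function.Injective A) (hB : Function.Injective B) :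
    ∃ σ : Equiv.Perm (Fin 4), Aligned A (B ∘ σ) := by
  classical
  have hex (p : {p // A p ∈ Set.range B}) : ∃ q : {q // B q ∈ Set.range A}, B q = A p := by
    obtain ⟨q, hq⟩ := p.2
    exact ⟨⟨q, p, hq.symm⟩, hq⟩
  choose f hf using hex
  have hbij : Function.Bijective f := by
    constructor
    · intro p p' h
      have h1 := hf p
      rw [h, hf p'] at h1
      exact Subtype.ext (hA h1.symm)
    · rintro ⟨q, p, hp⟩
      refine ⟨⟨p, q, hp.symm⟩, Subtype.ext (hB ?_)⟩
      rw [hf, hp]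
  refine ⟨(Equiv.ofBijective f hbij).extendSubtype, hA, hB.comp (Equiv.injective _), fun p q h => ?_⟩
  have hp : A p ∈ Set.range B := ⟨_, h.symm⟩
  have h1 := Equiv.extendSubtype_apply_of_mem (Equiv.ofBijective f hbij) p hp
  have h2 : B ((Equiv.ofBijective f hbij).extendSubtype p) = A p := by
    rw [h1]; exact hf ⟨p, hp⟩
  exact (Equiv.injective _) (hB (h2.trans h))

/-- For A = B the relation expresses the square of the Pfaffian by a scalar and quadratic terms.
Otherwise it expresses the anticommutator by quadratic terms, and the commutator is controlled by
hypothesis. -/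
theorem pf_mul_pf_mem {g : Fin n → Fin n → R} (hn : n ≤ 5) (hg : IsSoFamily g)
    (hT : ∀ A : Fin 4 → Fin n, Function.Injective A → tabTerm g A A = (3 / 4 : ℂ) • (1 : R))
    {A B : Fin 4 → Fin n} (hAB : Aligned A B)
    (hc : pf g A * pf g B - pf g B * pf g A ∈ wordsLT (onChords g) 4) :
    pf g A * pf g B ∈ wordsLT (onChords g) 4 := by
  have hsum (A B : Fin 4 → Fin n) (hA : Function.Injective A) (hB : Function.Injective B) :
      ∑ q : Fin 4 × Fin 4 with q.1 < q.2 ∧ ∀ p, p ≠ q.1 → p ≠ q.2 → A p = B p,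
      g (A q.1) (A q.2) * g (B q.1) (B q.2) ∈ wordsLT (onChords g) 4 := by
    refine Submodule.sum_mem _ fun q hq => wordsLT_mono (d := 3) (by norm_num) ?_
    have := (Finset.mem_filter.1 hq).2.1.ne
    exact hg.mul_mem_wordsLT (hA.ne this) (hB.ne this)
  have hone : (1 : R) ∈ wordsLT (onChords g) 4 := by
    simpa using word_mem_wordsLT (γ := onChords g) (w := []) (d := 4) (by simp)
  have htwo (a : R) : 2 * a = (2 : ℂ) • a := by rw [two_mul, two_smul]
  rcases aligned_cases hn hAB with rfl | ⟨p, hp⟩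
  · have h1 := hT A hAB.1
    rw [tabTerm, ← eq_sub_iff_add_eq, htwo, smul_mul_smul_comm] at h1
    have h2 : pf g A * pf g A = ((2 : ℂ) * 2)⁻¹ • (((2 : ℂ) * 2) • (pf g A * pf g A)) := by
      rw [smul_smul, inv_mul_cancel₀ (by norm_num), one_smul]
    rw [h2, h1]
    exact Submodule.smul_mem _ _ (Submodule.sub_mem _ (Submodule.smul_mem _ _ hone)
      (hsum A A hAB.1 hAB.1))
  · have h1 := tabTerm_add_eq_zero hg hAB.1 hp fun a => by
      rw [hT A hAB.1, mul_smul_comm, smul_mul_assoc, mul_one, one_mul]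
    have h2 := hsum A B hAB.1 hAB.2.1
    have h3 := hsum B A hAB.2.1 hAB.1
    rw [tabTerm, tabTerm, htwo, htwo, smul_mul_smul_comm, smul_mul_smul_comm] at h1
    have h4 : pf g A * pf g B = (1 / 2 : ℂ) • (pf g A * pf g B - pf g B * pf g A)
        - (1 / 8 : ℂ) • (∑ q : Fin 4 × Fin 4 with q.1 < q.2 ∧ ∀ p, p ≠ q.1 → p ≠ q.2 → A p = B p,
            g (A q.1) (A q.2) * g (B q.1) (B q.2))
        - (1 / 8 : ℂ) • (∑ q : Fin 4 × Fin 4 with q.1 < q.2 ∧ ∀ p, p ≠ q.1 → p ≠ q.2 → B p = A p,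
            g (B q.1) (B q.2) * g (A q.1) (A q.2)) := by
      linear_combination (norm := module) (1 / 8 : ℂ) • h1
    rw [h4]
    exact Submodule.sub_mem _ (Submodule.sub_mem _ (Submodule.smul_mem _ _ hc)
      (Submodule.smul_mem _ _ h2)) (Submodule.smul_mem _ _ h3)

/-- The uncrossable monomials span. -/
theorem IsSoFamily.word_mem_uncrossableSpan {g : Fin n → Fin n → R} (hn : n ≤ 5) (hg : IsSoFamily g)
    (hT : ∀ A : Fin 4 → Fin n, Function.Injective A → tabTerm g A A = (3 / 4 : ℂ) • (1 : R))
    {l : List (Chord n)} (hl : l.Nodup) (hc : ∀ c, c ∈ l) (w : List (Chord n)) :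
    (w.map (onChords g)).prod ∈ uncrossableSpan (onChords g) l w.length := by
  refine TAMA.word_mem_uncrossableSpan hn hg.commutator_mem (fun c d e f h h' => ?_) hl hc w
  obtain ⟨σ, hσ⟩ := exists_aligned (crossSeq_injective h) (crossSeq_injective h')
  have hcomm := crossPf_commutator_mem hg.commutator_mem h h'
  rw [crossPf_eq hg, crossPf_eq hg] at hcomm ⊢
  have hmem := pf_mul_pf_mem hn hg hT hσ
  rcases pf_perm hg σ (crossSeq_injective h') with hs | hs
  · rw [hs] at hmem
    exact hmem hcomm
  · rw [hs, mul_neg, neg_mul, neg_mem_iff] at hmem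
    refine hmem ?_
    rw [show -(pf g (crossSeq c d) * pf g (crossSeq e f)) - -(pf g (crossSeq e f) * pf g (crossSeq c d))
      = -(pf g (crossSeq c d) * pf g (crossSeq e f) - pf g (crossSeq e f) * pf g (crossSeq c d)) by abel]
    exact Submodule.neg_mem _ hcomm

end Straighten

end TAMA

end

noncomputable section

namespace TAMA

open MvPolynomial

variable {n : ℕ}

/-! ### Symbols of monomials -/

theorem isSymb_word (w : List (Chord n)) :
    IsSymb (2 * w.length) (act n (w.map fun c => O c.1.1 c.1.2).prod)
      (polyZ n (w.map MvPolynomial.X).prod) := by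
  induction w with
  | nil => simpa using isSymb_one
  | cons c w ih =>
    rw [List.map_cons, List.map_cons, List.prod_cons, List.prod_cons, map_mul, map_mul, polyZ_X,
      List.length_cons]
    have := (isSymb_O c.1.1 c.1.2).mul ih
    convert this using 1
    push_cast; ring

theorem isHom_word (w : List (Chord n)) :
    IsHom (2 * w.length) (polyZ n (w.map MvPolynomial.X).prod) := by
  induction w with
  | nil => intro d F; simp
  | cons c w ih =>
    rw [List.map_cons, List.prod_cons, map_mul, polyZ_X, List.length_cons]
    exact (isHom_Z c.1.1 c.1.2).mul ih (by push_cast; ring)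

/-- The exponent of a diagram. -/
abbrev toExp (m : Diagram n) : Chord n →₀ ℕ := Finsupp.equivFunOnFinite.symm m

theorem prod_map_X (w : List (Chord n)) : (w.map MvPolynomial.X).prod
    = MvPolynomial.monomial (toExp fun c => w.count c) (1 : ℂ) := by
  induction w with
  | nil =>
    have h : (toExp fun c : Chord n => ([] : List (Chord n)).count c) = 0 := by ext c; simp
    rw [h]; rfl
  | cons a w ih =>
    have h : Finsupp.single a 1 + (toExp fun c => w.count c) = toExp fun c => (a :: w).count c := by
      ext c
      simp only [Finsupp.add_apply, Finsupp.equivFunOnFinite_symm_apply_apply, List.count_cons,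
        Finsupp.single_apply, beq_iff_eq]
      rw [add_comm]
    rw [List.map_cons, List.prod_cons, ih, MvPolynomial.X, monomial_mul, one_mul, h]

theorem diagram_word (m : Diagram n) : ∃ w : List (Chord n), w.length = ∑ c, m c ∧
    (w.map MvPolynomial.X).prod = MvPolynomial.monomial (toExp m) (1 : ℂ) := by
  have hc := count_flatMap_replicate (Finset.nodup_toList (Finset.univ : Finset (Chord n)))
    (fun c => by simp) m
  refine ⟨(Finset.univ : Finset (Chord n)).toList.flatMap fun c => List.replicate (m c) c, ?_, ?_⟩
  · rw [← sum_count_eq_length]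
    exact Finset.sum_congr rfl fun c _ => hc c
  · rw [prod_map_X, show (fun c => List.count c _) = m from _root_.funext hc]

theorem isSymb_monomial {l : List (Chord n)} (hl : l.Nodup) (hc : ∀ c, c ∈ l) (m : Diagram n) :
    IsSymb (2 * ∑ c, m c : ℕ) (act n (monomial l m)) (polyZ n (MvPolynomial.monomial (toExp m) 1)) := by
  have h := isSymb_word (l.flatMap fun c => List.replicate (m c) c)
  have h1 : monomial l m = ((l.flatMap fun c => List.replicate (m c) c).map fun c => O c.1.1 c.1.2).prod :=
    mon_eq_word (R := WC n) (γ := fun c => O c.1.1 c.1.2) l m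
  have hcount := count_flatMap_replicate hl hc m
  rw [prod_map_X, ← h1, ← sum_count_eq_length] at h
  simp only [hcount] at h
  exact_mod_cast h

theorem isHom_polyZ_monomial (m : Diagram n) :
    IsHom (2 * ∑ c, m c : ℕ) (polyZ n (MvPolynomial.monomial (toExp m) 1)) := by
  obtain ⟨w, h1, h2⟩ := diagram_word m
  rw [← h2, ← h1]
  exact_mod_cast isHom_word w

theorem comp_oneSymb (k : ℤ) : comp k (oneSymb n) = if k = 0 then oneSymb n else 0 := by
  funext S
  rw [comp_apply]
  by_cases hS : S = ∅
  · subst hS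
    ext m
    rw [oneSymb_empty, coeff_homComp, coeff_one]
    by_cases hm : 0 = m
    · subst hm
      by_cases hk : k = 0
      · simp [hk, oneSymb_empty]
      · simp [hk, Ne.symm hk]
    · split_ifs with h1 h2 <;> simp [oneSymb_empty, coeff_one, hm]
  · rw [oneSymb_of_ne hS, map_zero]
    split_ifs
    · rw [oneSymb_of_ne hS]
    · rfl

theorem comp_comp_self (k : ℤ) (F : Symb n) : comp k (comp k F) = comp k F := by
  funext S
  ext m
  rw [comp_apply, comp_apply, coeff_homComp, coeff_homComp]
  split_ifs <;> rfl

theorem comp_polyZ_monomial (k : ℤ) (m : Diagram n) :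
    comp k (polyZ n (MvPolynomial.monomial (toExp m) 1) (oneSymb n))
      = if k = (2 * ∑ c, m c : ℕ) then polyZ n (MvPolynomial.monomial (toExp m) 1) (oneSymb n)
        else 0 := by
  have h := isHom_polyZ_monomial m (k - (2 * ∑ c, m c : ℕ)) (oneSymb n)
  rw [sub_add_cancel, comp_oneSymb] at h
  rw [h]
  by_cases hk : k = (2 * ∑ c, m c : ℕ)
  · rw [if_pos hk, if_pos (by omega)]
  · rw [if_neg hk, if_neg (by omega), map_zero]

/-- The symbol 1 is concentrated in degree zero, and each factor O has order two with leading part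
Z. The order of the factors is lost in the leading part because the Z commute. -/
theorem comp_symbol_monomial {l : List (Chord n)} (hl : l.Nodup) (hc : ∀ c, c ∈ l) (m : Diagram n)
    {k : ℤ} (hk : (2 * ∑ c, m c : ℕ) ≤ k) : comp k (symbol n (monomial l m))
      = if k = (2 * ∑ c, m c : ℕ) then polyZ n (MvPolynomial.monomial (toExp m) 1) (oneSymb n)
        else 0 := by
  have h := isSymb_monomial hl hc m 0 (oneSymb n)
    (fun e he => by rw [comp_oneSymb, if_neg he.ne']) (k - (2 * ∑ c, m c : ℕ)) (by omega)
  rw [sub_add_cancel, comp_oneSymb] at h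
  rw [symbol_apply, h]
  by_cases hk : k = (2 * ∑ c, m c : ℕ)
  · rw [if_pos hk, if_pos (by omega)]
  · rw [if_neg hk, if_neg (by omega), map_zero]

theorem toExp_coe (μ : Chord n →₀ ℕ) : toExp (⇑μ) = μ := Finsupp.equivFunOnFinite.symm_apply_apply μ

/-- The span of the symbols of the uncrossable monomials. -/
def uncrossableSymb (n : ℕ) : Submodule ℂ (Symb n) :=
  Submodule.map ((LinearMap.applyₗ (oneSymb n)).comp (polyZ n).toLinearMap)
    (restrictSupport ℂ {μ : Chord n →₀ ℕ | Uncrossable ⇑μ})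

theorem mem_uncrossableSymb {F : Symb n} : F ∈ uncrossableSymb n ↔
    ∃ q, UncrossableSupport q ∧ F = polyZ n q (oneSymb n) := by
  rw [uncrossableSymb, Submodule.mem_map]
  constructor
  · rintro ⟨q, hq, rfl⟩
    exact ⟨q, fun μ hμ => (mem_restrictSupport_iff _).1 hq hμ, rfl⟩
  · rintro ⟨q, hq, rfl⟩
    exact ⟨q, (mem_restrictSupport_iff _).2 fun μ hμ => hq μ hμ, rfl⟩

theorem polyZ_monomial_mem {m : Diagram n} (hm : Uncrossable m) :
    polyZ n (MvPolynomial.monomial (toExp m) 1) (oneSymb n) ∈ uncrossableSymb n :=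
  mem_uncrossableSymb.2 ⟨_, fun μ hμ => by
    rw [Finset.mem_singleton.1 (support_monomial_subset hμ)]; exact hm, rfl⟩

theorem monomial_mem_uncrossableSpan (hn : n ≤ 5) {l : List (Chord n)} (hl : l.Nodup)
    (hc : ∀ c, c ∈ l) (w : List (Chord n)) :
    (w.map fun c => O c.1.1 c.1.2).prod
      ∈ uncrossableSpan (R := WC n) (fun c => O c.1.1 c.1.2) l w.length :=
  O_isSoFamily.word_mem_uncrossableSpan (R := WC n) hn (fun _ hA => tabTerm_O_self hA) hl hc w

/-- The classical statement is deduced from the noncommutative one: straighten the monomial in the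
O's and take the component of top degree of the symbols. -/
theorem polyZ_mem_uncrossableSymb (hn : n ≤ 5) (p : MvPolynomial (Chord n) ℂ) :
    polyZ n p (oneSymb n) ∈ uncrossableSymb n := by
  induction p using MvPolynomial.induction_on' with
  | add p q hp hq => rw [map_add]; exact Submodule.add_mem _ hp hq
  | monomial μ a =>
    have h1 : MvPolynomial.monomial μ a = a • MvPolynomial.monomial (toExp ⇑μ) (1 : ℂ) := by
      rw [smul_monomial, smul_eq_mul, mul_one, toExp_coe]
    rw [h1, map_smul, LinearMap.smul_apply]
    refine Submodule.smul_mem _ _ ?_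
    set l := (Finset.univ : Finset (Chord n)).toList with hl'
    have hl : l.Nodup := Finset.nodup_toList _
    have hc : ∀ c, c ∈ l := fun c => by simp [hl']
    have h2 := monomial_mem_uncrossableSpan hn hl hc (l.flatMap fun c => List.replicate (μ c) c)
    have h3 : monomial l μ
        = ((l.flatMap fun c => List.replicate (μ c) c).map fun c => O c.1.1 c.1.2).prod :=
      mon_eq_word (R := WC n) (γ := fun c => O c.1.1 c.1.2) l μ
    rw [← h3, ← sum_count_eq_length] at h2
    simp only [count_flatMap_replicate hl hc] at h2
    have h4 := comp_symbol_monomial hl hc μ le_rfl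
    rw [if_pos rfl] at h4
    rw [← h4]
    -- In this degree monomials with fewer chords have zero component, and those with equally many
    -- give their leading symbols.
    have h5 : uncrossableSpan (R := WC n) (fun c => O c.1.1 c.1.2) l (∑ c, μ c)
        ≤ (uncrossableSymb n).comap ((comp ((2 * ∑ c, μ c : ℕ) : ℤ)).comp (symbol n)) := by
      refine Submodule.span_le.2 ?_
      rintro _ ⟨m, hm, hd, rfl⟩
      change comp _ (symbol n (monomial l m)) ∈ uncrossableSymb n
      rw [comp_symbol_monomial hl hc m (by exact_mod_cast Nat.mul_le_mul_left 2 hd)]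
      split_ifs
      · exact polyZ_monomial_mem hm
      · exact Submodule.zero_mem _
    exact h5 h2

/-- Some power of Z_ab carries F to a polynomial in Z applied to 1; this polynomial is straightened
to uncrossable form, and the power is then cancelled one factor at a time. -/
theorem mem_uncrossableSymb_of_mem_invariants (hn : n = 4 ∨ n = 5) {F : Symb n}
    (hF : F ∈ invariants n) : F ∈ uncrossableSymb n := by
  have hn5 : n ≤ 5 := by omega
  obtain ⟨a, b, ha, hab, hsep⟩ := exists_separates hn
  obtain ⟨N, p, hp⟩ := exists_polyZ_eq_pow hn5 hF hab.ne
  obtain ⟨q, hq, hpq⟩ := mem_uncrossableSymb.1 (polyZ_mem_uncrossableSymb hn5 p)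
  obtain ⟨r, hr, h⟩ := exists_of_polyZ_pow ha hab hsep N hq (hp.trans hpq)
  exact mem_uncrossableSymb.2 ⟨r, hr, h⟩

/-! ### The even total angular momentum algebra -/

theorem comp_parOp (k : ℤ) (F : Symb n) : comp k (parOp n F) = parOp n (comp k F) := by
  funext S
  rw [comp_apply, parOp_apply, map_smul, parOp_apply, comp_apply]

/-- The full bracket operators kill the symbol of a, so their leading parts kill its top component.
-/
theorem comp_symbol_mem_invariants {a : WC n} (ha : a ∈ evenTama n) {d : ℤ}
    (hd : ∀ k, d < k → comp k (symbol n a) = 0) : comp d (symbol n a) ∈ invariants n := by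
  obtain ⟨⟨-, hodd⟩, heven⟩ := ha
  have hpar := parOp_symbol heven
  have h1 := hodd (dirac n) (Submodule.subset_span (by simp))
  have h2 := hodd (vecVar n) (Submodule.subset_span (by simp))
  rw [parity_of_mem_evenWC heven] at h1 h2
  refine mem_invariants.2 ⟨?_, ?_, ?_⟩
  · rw [← isSymb_diracOp_add d _ hd d le_rfl, diracOp_add_apply h1 hpar, map_zero]
  · rw [← isSymb_vecOp_add d _ hd d le_rfl, vecOp_add_apply h2 hpar, map_zero]
  · rw [← comp_parOp, hpar]

theorem twoIndexAlg_le_evenTama : twoIndexAlg n ≤ evenTama n := by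
  refine Algebra.adjoin_le ?_
  rintro _ ⟨c, rfl⟩
  exact O_mem_evenTama c.2.ne

theorem monomial_mem_twoIndexAlg (l : List (Chord n)) (m : Diagram n) :
    monomial l m ∈ twoIndexAlg n := by
  refine Subalgebra.list_prod_mem _ ?_
  intro x hx
  obtain ⟨c, -, rfl⟩ := List.mem_map.1 hx
  exact Subalgebra.pow_mem _ (show O c.1.1 c.1.2 ∈ twoIndexAlg n from Algebra.subset_adjoin ⟨c, rfl⟩) _

theorem evenTama_le_twoIndexAlg (hn : n = 4 ∨ n = 5) : evenTama n ≤ twoIndexAlg n := by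
  intro a ha
  obtain ⟨d, hd⟩ := exists_comp_bound (symbol n a)
  induction d generalizing a with
  | zero =>
    have h0 : symbol n a = 0 := eq_zero_of_comp fun k => by
      by_cases hk : k < 0
      · exact comp_of_neg hk _
      · exact hd k (by exact_mod_cast not_lt.1 hk)
    have : a = 0 := symbol_injective (h0.trans (map_zero _).symm)
    rw [this]; exact Subalgebra.zero_mem _
  | succ d ih =>
    have hinv : comp d (symbol n a) ∈ invariants n :=
      comp_symbol_mem_invariants ha fun k hk => hd k (by push_cast; omega)
    obtain ⟨q, hq, hF⟩ := mem_uncrossableSymb.1 (mem_uncrossableSymb_of_mem_invariants hn hinv)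
    set l := (Finset.univ : Finset (Chord n)).toList with hl'
    have hl : l.Nodup := Finset.nodup_toList _
    have hc : ∀ c, c ∈ l := fun c => by simp [hl']
    -- The polynomial q need not be homogeneous. Keeping its part of degree d leaves the value on 1
    -- unchanged in that degree and adds nothing above it.
    set b : WC n := ∑ μ ∈ q.support with 2 * ∑ c, μ c = d, coeff μ q • monomial l μ with hb
    have hbmem : b ∈ twoIndexAlg n := Subalgebra.sum_mem _ fun μ _ =>
      Subalgebra.smul_mem _ (monomial_mem_twoIndexAlg l μ) _
    have hb1 (k : ℤ) (hk : d < k) : comp k (symbol n b) = 0 := by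
      rw [hb, map_sum, map_sum]
      refine Finset.sum_eq_zero fun μ hμ => ?_
      have := (Finset.mem_filter.1 hμ).2
      rw [map_smul, map_smul, comp_symbol_monomial hl hc μ (by omega), if_neg (by omega), smul_zero]
    have hb2 : comp d (symbol n b) = comp d (symbol n a) := by
      have h0 : comp d (symbol n a) = comp d (polyZ n q (oneSymb n)) := by
        rw [← hF, comp_comp_self]
      rw [h0]
      conv_rhs => rw [q.as_sum, map_sum, LinearMap.sum_apply, map_sum]
      rw [hb, map_sum, map_sum, Finset.sum_filter]
      refine Finset.sum_congr rfl fun μ _ => ?_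
      have h1 : MvPolynomial.monomial μ (coeff μ q)
          = coeff μ q • MvPolynomial.monomial (toExp ⇑μ) (1 : ℂ) := by
        rw [smul_monomial, smul_eq_mul, mul_one, toExp_coe]
      have h2 : comp d (polyZ n (MvPolynomial.monomial μ (coeff μ q)) (oneSymb n)) = coeff μ q •
          comp d (polyZ n (MvPolynomial.monomial (toExp ⇑μ) 1) (oneSymb n)) := by
        rw [h1, map_smul, LinearMap.smul_apply, map_smul]
      rw [h2, comp_polyZ_monomial]
      by_cases hμ : 2 * ∑ c, μ c = d
      · rw [if_pos hμ, map_smul, map_smul, comp_symbol_monomial hl hc μ (by omega)]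
      · rw [if_neg hμ, if_neg (by omega), smul_zero]
    have hmem : a + (-1 : ℂ) • b ∈ evenTama n :=
      Subalgebra.add_mem _ ha (Subalgebra.smul_mem _ (twoIndexAlg_le_evenTama hbmem) _)
    have hab := ih hmem fun k hk => by
      rw [map_add, map_add, map_smul, map_smul]
      rcases hk.eq_or_lt with rfl | hk
      · rw [hb2, neg_one_smul, add_neg_cancel]
      · rw [hd k (by push_cast; omega), hb1 k hk, smul_zero, add_zero]
    have h1 : a + (-1 : ℂ) • b + (1 : ℂ) • b = a := by
      rw [add_assoc, ← add_smul, neg_add_cancel, zero_smul, add_zero]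
    rw [← h1]
    exact Subalgebra.add_mem _ hab (Subalgebra.smul_mem _ hbmem _)

theorem twoIndexAlg_eq_evenTama (hn : n = 4 ∨ n = 5) : twoIndexAlg n = evenTama n :=
  le_antisymm twoIndexAlg_le_evenTama (evenTama_le_twoIndexAlg hn)

/-! ### The basis of uncrossable monomials -/

/-- The terms with the most chords in a linear relation give, in top degree, a relation among the
symbols of uncrossable monomials, where independence is known. -/
theorem linearIndependent_monomial (hn : n = 4 ∨ n = 5) {l : List (Chord n)} (hl : l.Nodup)
    (hc : ∀ c, c ∈ l) :
    LinearIndependent ℂ fun m : {m : Diagram n // Uncrossable m} => monomial l m.1 := by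
  refine LinearIndependent.of_comp (symbol n) ?_
  rw [linearIndependent_iff]
  intro f hf
  by_contra hne
  obtain ⟨m₀, hm₀, hmax⟩ := f.support.exists_max_image
    (fun m : {m : Diagram n // Uncrossable m} => ∑ c, m.1 c) (Finsupp.support_nonempty_iff.2 hne)
  set p : MvPolynomial (Chord n) ℂ := ∑ m ∈ f.support with ∑ c, m.1 c = ∑ c, m₀.1 c,
    MvPolynomial.monomial (toExp m.1) (f m) with hp
  have hcoeff (m : {m : Diagram n // Uncrossable m}) (μ : Chord n →₀ ℕ)
      (h : μ = toExp m.1) : coeff μ p = if ∑ c, m.1 c = ∑ c, m₀.1 c then f m else 0 := by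
    rw [hp, coeff_sum, Finset.sum_filter]
    subst h
    rw [Finset.sum_eq_single m]
    · rw [coeff_monomial, if_pos rfl]
    · intro m' _ hm'
      have hne : toExp m'.1 ≠ toExp m.1 := fun h =>
        hm' (Subtype.ext (Finsupp.equivFunOnFinite.symm.injective h))
      rw [coeff_monomial, if_neg hne, ite_self]
    · intro h
      rw [Finsupp.notMem_support_iff.1 h, map_zero, coeff_zero, ite_self]
  have hps : UncrossableSupport p := by
    intro μ hμ
    obtain ⟨m, -, hm⟩ := Finset.mem_biUnion.1 (support_sum hμ)
    rw [Finset.mem_singleton.1 (support_monomial_subset hm)]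
    exact m.2
  have hp0 : polyZ n p (oneSymb n) = 0 := by
    have h1 := congrArg (comp ((2 * ∑ c, m₀.1 c : ℕ) : ℤ)) hf
    simp only [Finsupp.linearCombination_apply, Finsupp.sum, map_sum, map_zero, map_smul,
      Function.comp_apply] at h1
    rw [← h1, hp, map_sum, LinearMap.sum_apply, Finset.sum_filter]
    refine Finset.sum_congr rfl fun m hm => ?_
    have h2 := hmax m hm
    rw [comp_symbol_monomial hl hc m.1 (by exact_mod_cast Nat.mul_le_mul_left 2 h2)]
    have h3 : MvPolynomial.monomial (toExp m.1) (f m)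
        = f m • MvPolynomial.monomial (toExp m.1) (1 : ℂ) := by
      rw [smul_monomial, smul_eq_mul, mul_one]
    by_cases h : ∑ c, m.1 c = ∑ c, m₀.1 c
    · rw [if_pos h, if_pos (by rw [h]), h3, map_smul, LinearMap.smul_apply]
    · rw [if_neg h, if_neg (by omega), smul_zero]
  have h4 := hcoeff m₀ _ rfl
  rw [eq_zero_of_polyZ_eq_zero hn hps hp0, coeff_zero, if_pos rfl] at h4
  exact Finsupp.mem_support_iff.1 hm₀ h4.symm

theorem adjoin_le_span_mon {R : Type*} [Ring R] [Algebra ℂ R] {γ : Chord n → R} {l : List (Chord n)}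
    (h : ∀ w : List (Chord n), (w.map γ).prod ∈ uncrossableSpan γ l w.length) {a : R}
    (ha : a ∈ Algebra.adjoin ℂ (Set.range γ)) :
    a ∈ Submodule.span ℂ (Set.range fun m : {m : Diagram n // Uncrossable m} => mon γ l m.1) := by
  rw [← Subalgebra.mem_toSubmodule, Algebra.adjoin_eq_span] at ha
  refine Submodule.span_le.2 ?_ ha
  intro x hx
  obtain ⟨v, hv, rfl⟩ := Submonoid.exists_list_of_mem_closure hx
  obtain ⟨w, rfl⟩ : ∃ w : List (Chord n), w.map γ = v := by
    have : v ∈ Set.range (List.map γ) := by rw [Set.range_list_map]; exact hv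
    exact this
  have := h w
  refine Submodule.span_mono ?_ this
  rintro _ ⟨m, hm, -, rfl⟩
  exact ⟨⟨m, hm⟩, rfl⟩

theorem exists_basis_monomial (hn : n = 4 ∨ n = 5) {l : List (Chord n)} (hl : l.Nodup)
    (hc : ∀ c, c ∈ l) :
    ∃ b : Module.Basis {m : Diagram n // Uncrossable m} ℂ (twoIndexAlg n),
      ∀ m, (b m : WC n) = monomial l m.1 := by
  have hli := linearIndependent_monomial hn hl hc
  let v (m : {m : Diagram n // Uncrossable m}) : twoIndexAlg n :=
    ⟨monomial l m.1, monomial_mem_twoIndexAlg l m.1⟩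
  have hv : LinearIndependent ℂ v :=
    LinearIndependent.of_comp (twoIndexAlg n).val.toLinearMap hli
  have hspan : ⊤ ≤ Submodule.span ℂ (Set.range v) := by
    rintro ⟨a, ha⟩ -
    have h1 := adjoin_le_span_mon (R := WC n)
      (monomial_mem_uncrossableSpan (by omega) hl hc) ha
    have h2 : (Set.range fun m : {m : Diagram n // Uncrossable m} => monomial l m.1)
        = (twoIndexAlg n).val.toLinearMap '' Set.range v := by
      rw [← Set.range_comp]; rfl
    change a ∈ Submodule.span ℂ (Set.range fun m : {m : Diagram n // Uncrossable m} => monomial l m.1) at h1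
    rw [h2, Submodule.span_image] at h1
    obtain ⟨x, hx, hxa⟩ := h1
    have : x = ⟨a, ha⟩ := Subtype.ext hxa
    rwa [← this]
  exact ⟨Module.Basis.mk hv hspan, fun m => by rw [Module.Basis.mk_apply]⟩

end TAMA

end

noncomputable section

namespace TAMA

variable {n : ℕ}

/-! ### The presentation of the even total angular momentum algebra -/

theorem soElt_sum (A : LieAlgebra.Orthogonal.so (Fin n) ℂ) :
    A = (1 / 2 : ℂ) • ∑ i, ∑ j, A.1 i j • soElt i j := by
  have hA : A.1.transpose = -A.1 := (LieAlgebra.Orthogonal.mem_so _ _ _).1 A.2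
  refine Subtype.ext ?_
  have h1 : ((∑ i, ∑ j, A.1 i j • soElt i j : LieAlgebra.Orthogonal.so (Fin n) ℂ)
      : Matrix (Fin n) (Fin n) ℂ)
      = ∑ i, ∑ j, A.1 i j • (Matrix.single i j 1 - Matrix.single j i 1) := by
    push_cast
    rfl
  have h2 : ∑ i, ∑ j, A.1 i j • (Matrix.single i j 1 - Matrix.single j i 1)
      = A.1 - A.1.transpose := by
    simp only [smul_sub, Finset.sum_sub_distrib, Matrix.smul_single, smul_eq_mul, mul_one]
    congr 1
    · exact (Matrix.matrix_eq_sum_single A.1).symm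
    · rw [Finset.sum_comm]
      exact (Matrix.matrix_eq_sum_single A.1.transpose).symm
  change A.1 = (1 / 2 : ℂ) • (_ : Matrix (Fin n) (Fin n) ℂ)
  rw [h1, h2, hA]
  module

theorem uso_adjoin : Algebra.adjoin ℂ (Set.range (onChords (X (n := n)))) = ⊤ := by
  have hX (i j : Fin n) : X i j ∈ Algebra.adjoin ℂ (Set.range (onChords (X (n := n)))) := by
    rcases lt_trichotomy i j with h | rfl | h
    · exact Algebra.subset_adjoin ⟨chord h, rfl⟩
    · have : soElt i i = 0 := Subtype.ext (sub_self _)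
      rw [X, this, map_zero]
      exact Subalgebra.zero_mem _
    · rw [X_isSoFamily.swap h.ne]
      exact Subalgebra.neg_mem _ (Algebra.subset_adjoin ⟨chord h, rfl⟩)
  have hι (A : LieAlgebra.Orthogonal.so (Fin n) ℂ) : UniversalEnvelopingAlgebra.ι ℂ A
      ∈ Algebra.adjoin ℂ (Set.range (onChords (X (n := n)))) := by
    rw [soElt_sum A, map_smul, map_sum]
    refine Subalgebra.smul_mem _ (Subalgebra.sum_mem _ fun i _ => ?_) _
    rw [map_sum]
    refine Subalgebra.sum_mem _ fun j _ => ?_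
    rw [map_smul]
    exact Subalgebra.smul_mem _ (hX i j) _
  rw [eq_top_iff]
  intro u _
  obtain ⟨t, rfl⟩ : ∃ t, UniversalEnvelopingAlgebra.mkAlgHom ℂ _ t = u := RingCon.mk'_surjective _ u
  have ht : t ∈ Algebra.adjoin ℂ (Set.range (TensorAlgebra.ι ℂ)) :=
    TensorAlgebra.adjoin_range_ι (R := ℂ) (M := LieAlgebra.Orthogonal.so (Fin n) ℂ) ▸ Algebra.mem_top
  induction ht using Algebra.adjoin_induction with
  | mem x hx => obtain ⟨A, rfl⟩ := hx; exact hι A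
  | algebraMap r => rw [AlgHom.commutes]; exact Subalgebra.algebraMap_mem _ r
  | add x y _ _ hx hy => rw [map_add]; exact Subalgebra.add_mem _ (hx trivial) (hy trivial)
  | mul x y _ _ hx hy => rw [map_mul]; exact Subalgebra.mul_mem _ (hx trivial) (hy trivial)

/-- The quotient of the enveloping algebra by the tableau relations. -/
abbrev TabQuot (n : ℕ) : Type := (tableauIdeal n).ringCon.Quotient

/-- The class of `X_{ij}` modulo the tableau relations. -/
def qX (i j : Fin n) : TabQuot n := (tableauIdeal n).ringCon.mk' (X i j)

theorem qX_isSoFamily : IsSoFamily (qX (n := n)) :=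
  X_isSoFamily.map (tableauIdeal n).ringCon.mk' fun _ _ _ => rfl

theorem mk_eq_zero {u : Uso n} : (tableauIdeal n).ringCon.mk' u = 0 ↔ u ∈ tableauIdeal n := by
  rw [← TwoSidedIdeal.mem_ker, TwoSidedIdeal.ker_ringCon_mk']

theorem tabTerm_qX_self {A : Fin 4 → Fin n} (hA : Function.Injective A) :
    tabTerm qX A A = (3 / 4 : ℂ) • (1 : TabQuot n) := by
  have h1 : (tableauIdeal n).ringCon.mk' (tableauRel A A) = 0 :=
    mk_eq_zero.2 (TwoSidedIdeal.subset_span ⟨A, A, ⟨hA, hA, fun _ _ h => hA h⟩, rfl⟩)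
  have h2 : (tableauIdeal n).ringCon.mk' (tabTerm X A A) = tabTerm qX A A := by
    simp only [tabTerm, pf, map_add, map_mul, map_sum, map_ofNat]
    rfl
  rw [tableauRel_self, map_sub, map_mul, h2, map_ofNat, map_ofNat, sub_eq_zero] at h1
  have h3 : (16 : TabQuot n) * tabTerm qX A A = (16 : ℂ) • tabTerm qX A A := by
    rw [Algebra.smul_def, map_ofNat]
  have h4 : (12 : TabQuot n) = (12 : ℂ) • (1 : TabQuot n) := by
    rw [Algebra.smul_def, map_ofNat, mul_one]
  rw [h3, h4] at h1
  have h5 := congrArg (fun a => (1 / 16 : ℂ) • a) h1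
  simp only [smul_smul] at h5
  norm_num at h5
  exact h5

theorem tabQuot_adjoin : Algebra.adjoin ℂ (Set.range (onChords (qX (n := n)))) = ⊤ := by
  have h := congrArg (Subalgebra.map ((tableauIdeal n).ringCon.mkₐ ℂ)) (uso_adjoin (n := n))
  rw [AlgHom.map_adjoin, ← Set.range_comp] at h
  refine h.trans ?_
  rw [Algebra.map_top, AlgHom.range_eq_top]
  exact RingCon.mk'_surjective _

/-- The homomorphism induced on the quotient by the tableau relations. -/
theorem exists_quotient_hom (hn : n ≤ 5) : ∃ ψ : TabQuot n →ₐ[ℂ] WC n,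
    ∀ u, ψ ((tableauIdeal n).ringCon.mk' u) = usoHom n u := by
  have hle : tableauIdeal n ≤ TwoSidedIdeal.ker (usoHom n) := by
    refine TwoSidedIdeal.span_le.2 ?_
    rintro _ ⟨A, B, h, rfl⟩
    exact (TwoSidedIdeal.mem_ker _).2 (usoHom_tableauRel hn h)
  refine ⟨RingCon.liftₐ _ (usoHom n) fun u v huv => ?_, fun u => rfl⟩
  exact (TwoSidedIdeal.rel_iff (TwoSidedIdeal.ker (usoHom n)) u v).2
    (hle ((TwoSidedIdeal.rel_iff (tableauIdeal n) u v).1 huv))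

/-- Straightening also works in the quotient, so uncrossable monomials span it, and ψ sends them to
an independent family. -/
theorem quotient_hom_injective (hn : n = 4 ∨ n = 5) {ψ : TabQuot n →ₐ[ℂ] WC n}
    (hψ : ∀ u, ψ ((tableauIdeal n).ringCon.mk' u) = usoHom n u) : Function.Injective ψ := by
  set l := (Finset.univ : Finset (Chord n)).toList with hl'
  have hl : l.Nodup := Finset.nodup_toList _
  have hc : ∀ c, c ∈ l := fun c => by simp [hl']
  have hli := linearIndependent_monomial hn hl hc
  have hm (m : Diagram n) : ψ (mon (onChords qX) l m) = monomial l m := by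
    rw [mon, map_list_prod, List.map_map, monomial]
    congr 1
    refine List.map_congr_left fun c _ => ?_
    rw [Function.comp_apply, map_pow]
    congr 1
    exact (hψ _).trans (usoHom_X c.2.ne)
  have hspan (x : TabQuot n) : x ∈ Submodule.span ℂ
      (Set.range fun m : {m : Diagram n // Uncrossable m} => mon (onChords qX) l m.1) :=
    adjoin_le_span_mon (qX_isSoFamily.word_mem_uncrossableSpan (by omega)
      (fun _ hA => tabTerm_qX_self hA) hl hc) (tabQuot_adjoin ▸ Algebra.mem_top)
  have hkey (x : TabQuot n) : ∃ f : {m : Diagram n // Uncrossable m} →₀ ℂ,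
      x = Finsupp.linearCombination ℂ (fun m => mon (onChords qX) l m.1) f ∧
      ψ x = Finsupp.linearCombination ℂ (fun m => monomial l m.1) f := by
    obtain ⟨f, rfl⟩ := (Finsupp.mem_span_range_iff_exists_finsupp).1 (hspan x)
    refine ⟨f, rfl, ?_⟩
    rw [Finsupp.linearCombination_apply, Finsupp.sum, map_sum]
    simp only [map_smul, hm]
    rfl
  intro x y hxy
  obtain ⟨f, rfl, hf⟩ := hkey x
  obtain ⟨g, rfl, hg⟩ := hkey y
  rw [hf, hg] at hxy
  rw [hli hxy]

theorem usoHom_range (hn : n = 4 ∨ n = 5) : (usoHom n).range = evenTama n := by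
  rw [← twoIndexAlg_eq_evenTama hn, ← Algebra.map_top, ← uso_adjoin, AlgHom.map_adjoin,
    ← Set.range_comp, twoIndexAlg]
  congr 2
  funext c
  exact usoHom_X c.2.ne

end TAMA

end

/-! ### The basis, the equality with the even centraliser, and the presentation. -/

theorem mainTheorem1 (n : ℕ) (hn : n = 4 ∨ n = 5) :
    (∀ l : List (TAMA.Chord n), l.Nodup → (∀ c, c ∈ l) →
      ∃ b : Module.Basis {m : TAMA.Diagram n // TAMA.Uncrossable m} ℂ (TAMA.twoIndexAlg n),
        ∀ m, (b m : TAMA.WC n) = TAMA.monomial l m.1) ∧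
    TAMA.twoIndexAlg n = TAMA.evenTama n ∧
    ∃ φ : TAMA.Uso n →ₐ[ℂ] TAMA.WC n,
      (∀ i j : Fin n, i ≠ j → φ (TAMA.X i j) = TAMA.O i j) ∧
      φ.range = TAMA.evenTama n ∧
      TwoSidedIdeal.ker φ = TAMA.tableauIdeal n ∧
      ∃ e : (TAMA.tableauIdeal n).ringCon.Quotient ≃ₐ[ℂ] TAMA.evenTama n,
        ∀ u : TAMA.Uso n, (e ((TAMA.tableauIdeal n).ringCon.mk' u) : TAMA.WC n) = φ u := by
  obtain ⟨ψ, hψ⟩ := TAMA.exists_quotient_hom (n := n) (by omega)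
  have hinj := TAMA.quotient_hom_injective hn hψ
  have hrange := TAMA.usoHom_range hn
  refine ⟨fun l hl hc => TAMA.exists_basis_monomial hn hl hc, TAMA.twoIndexAlg_eq_evenTama hn,
    TAMA.usoHom n, fun i j hij => TAMA.usoHom_X hij, hrange, ?_, ?_⟩
  · ext u
    rw [TwoSidedIdeal.mem_ker, ← hψ, map_eq_zero_iff ψ hinj, TAMA.mk_eq_zero]
  · have hmem (x : (TAMA.tableauIdeal n).ringCon.Quotient) : ψ x ∈ TAMA.evenTama n := by
      obtain ⟨u, rfl⟩ := RingCon.mk'_surjective _ x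
      rw [hψ, ← hrange]
      exact ⟨u, rfl⟩
    refine ⟨AlgEquiv.ofBijective (ψ.codRestrict _ hmem) ⟨fun x y h => hinj (congrArg Subtype.val h), ?_⟩,
      fun u => hψ u⟩
    rintro ⟨a, ha⟩
    rw [← hrange] at ha
    obtain ⟨u, hu⟩ := ha
    exact ⟨(TAMA.tableauIdeal n).ringCon.mk' u, Subtype.ext ((hψ u).trans hu)⟩
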